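/- Let $\mathcal R$ be the infinite (rotated) square lattice graph whose vertices are the pairs $(i,j)\in\mathbb Z^2$, where $(i,j)$ lies in row $i$, the second index increases from left to right within a row, rows are numbered from top to bottom, and the two neighbours of $(i,j)$ in the row above are $(i-1,j)$ (upper left) and $(i-1,j+1)$ (upper right). A subgraph $\Gamma$ of $\mathcal R$ is called ordinary if (1) it is a finite, nonempty, connected full subgraph; (2) whenever $(i,j),(i,j+1)\in\Gamma$, also $(i+1,j)\in\Gamma$; (3) whenever $i>a_\Gamma$ and $(i,j),(i,j+1)\in\Gamma$, also $(i-1,j+1)\in\Gamma$, where $a_\Gamma$ is the number of the top row containing vertices of $\Gamma$. Let $l_\Gamma$ be the number of vertices of $\Gamma$ in row $a_\Gamma$. For integers $b_1\ge\dots\ge b_{l_\Gamma}$ let $D=D_\Gamma(b_1,\dots,b_{l_\Gamma})$ be the polyhedron of all real arrays $s=(s_{i,j})_{(i,j)\in\mathbb Z^2}$ such that $s_{i,j}=0$ for $(i,j)\notin\Gamma$, the coordinates of $s$ in the vertices of row $a_\Gamma$ of $\Gamma$ are $b_1,\dots,b_{l_\Gamma}$ from left to right, and for every $(i,j)\in\Gamma$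 one has $s_{i-1,j}\ge s_{i,j}$ if $(i-1,j)\in\Gamma$ and $s_{i,j}\ge s_{i-1,j+1}$ if $(i-1,j+1)\in\Gamma$. For a face $f$ of $D$ let $\Delta_f$ be the subgraph of $\Gamma$ that contains all vertices of $\Gamma$ and those edges of $\Gamma$ whose two end coordinates are equal at every point of $f$. Put $\varphi_\Gamma(f)=\prod_{l\ge1}(1-t^l)^{d_l}\in\mathbb Z[t]$, where $d_l$ is the number of pairs $(E,i)$ such that $E$ is a connected component of $\Delta_f$, $i>a_\Gamma$ is an integer, and $E$ has exactly $l-1$ vertices in row $i-1$ and exactly $l$ vertices in row $i$. Let $S=\sum_a \varphi_\Gamma(f_a)\,e^a$, the sum being over the integer points $a$ of $D$, where $f_a$ is the minimal face of $D$ containing $a$ and $e^a=\prod t_{i,j}^{a_{i,j}}$. Let $\sigma=\frac{QS}{Q}$ for any nonzero Laurent polynomial $Q$ over $\mathbb Z[t]$ in the variables $t_{i,j}$ such that $QS$ is a Laurent polynomial (the weighted integer point transform of $D$; the rational function $\sigma$ does not depend on $Q$). Let $\psi_\Gamma(b_1,\dots,b_{l_\Gamma})$ be the rational function over $\mathbb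 Z[t]$ in independent variables $x_i$ $(i\in\mathbb Z)$ obtained from $\sigma$ by the specialization $t_{i,j}\mapsto x_i^{-1}x_{i+1}$. Theorem. Let $\Gamma$ be an ordinary subgraph such that for some $i\ge a_\Gamma$ the number of vertices of $\Gamma$ in row $i+1$ is greater than in row $i$. Then for all integers $b_1\ge\dots\ge b_{l_\Gamma}$ the rational function $\psi_\Gamma(b_1,\dots,b_{l_\Gamma})$ is well defined (that is, such a $Q$ exists, and $\sigma$ is a quotient of two Laurent polynomials whose denominator does not vanish under the specialization), and $$\psi_\Gamma(b_1,\dots,b_{l_\Gamma})=0.$$ -/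

import Mathlib

open scoped AddMonoidAlgebra

/-! ### Laurent polynomials, formal Laurent series, rational functions -/

/-- Laurent polynomials with coefficients in `R` in variables indexed by `ι`; the monomial with
exponent vector `a` is `AddMonoidAlgebra.single a 1`. -/
abbrev LaurentPoly (R ι : Type*) [CommRing R] := AddMonoidAlgebra R (ι →₀ ℤ)

/-- The field of rational functions over `R` in variables indexed by `ι`, as the field of fractions
of the Laurent polynomials. -/
abbrev RatFun (R ι : Type*) [CommRing R] := FractionRing (LaurentPoly R ι)

/-- Product of a Laurent polynomial and a formal (two-sided infinite) Laurent series, the latter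
given by its coefficients. -/
noncomputable def laurentMul {R ι : Type*} [CommRing R] (Q : LaurentPoly R ι)
    (S : (ι →₀ ℤ) → R) : (ι →₀ ℤ) → R :=
  fun a => Q.coeff.sum fun b c => c * S (a - b)

/-- `σ` is the rational function `Q S / Q`, for some nonzero Laurent polynomial `Q` such that
`Q S` is a Laurent polynomial. -/
def SumsTo {R ι : Type*} [CommRing R] [IsDomain R] (S : (ι →₀ ℤ) → R)
    (σ : RatFun R ι) : Prop :=
  ∃ Q N : LaurentPoly R ι, Q ≠ 0 ∧ laurentMul Q S = ⇑N.coeff ∧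
    σ = algebraMap (LaurentPoly R ι) (RatFun R ι) N / algebraMap (LaurentPoly R ι) (RatFun R ι) Q

theorem laurentMul_mul {R ι : Type*} [CommRing R] (P Q : LaurentPoly R ι)
    (S : (ι →₀ ℤ) → R) : laurentMul (P * Q) S = laurentMul P (laurentMul Q S) := by
  classical
  have hadd : ∀ (A B : LaurentPoly R ι) (T : (ι →₀ ℤ) → R),
      laurentMul (A + B) T = laurentMul A T + laurentMul B T := by
    intro A B T
    funext a
    simp only [laurentMul, AddMonoidAlgebra.coeff_add, Pi.add_apply]
    exact Finsupp.sum_add_index' (by simp) (by intros; ring)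
  have hadd2 : ∀ (A : LaurentPoly R ι) (T U : (ι →₀ ℤ) → R),
      laurentMul A (T + U) = laurentMul A T + laurentMul A U := by
    intro A T U
    funext a
    simp only [laurentMul, Pi.add_apply, mul_add]
    exact Finsupp.sum_add
  have hzero : ∀ T : (ι →₀ ℤ) → R, laurentMul (0 : LaurentPoly R ι) T = 0 := by
    intro T; funext a; simp [laurentMul]
  have hzero2 : ∀ A : LaurentPoly R ι, laurentMul A 0 = 0 := by
    intro A; funext a; simp [laurentMul]
  have hsing : ∀ (m : ι →₀ ℤ) (r : R) (T : (ι →₀ ℤ) → R) (a : ι →₀ ℤ),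
      laurentMul (AddMonoidAlgebra.single m r) T a = r * T (a - m) := by
    intro m r T a; simp [laurentMul]
  induction P using AddMonoidAlgebra.induction_linear with
  | zero => simp [hzero]
  | add f g hf hg => rw [add_mul, hadd, hadd, hf, hg]
  | single m r =>
    induction Q using AddMonoidAlgebra.induction_linear with
    | zero => simp [hzero, hzero2]
    | add f g hf hg => rw [mul_add, hadd, hadd, hadd2, hf, hg]
    | single n s =>
      funext a
      rw [AddMonoidAlgebra.single_mul_single, hsing, hsing, hsing, mul_assoc, sub_sub]

theorem laurentMul_coeff {R ι : Type*} [CommRing R] (Q N : LaurentPoly R ι) :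
    laurentMul Q ⇑N.coeff = ⇑(Q * N).coeff := by
  classical
  have h : laurentMul N (fun a => if a = 0 then 1 else 0) = ⇑N.coeff := by
    funext a
    simp [laurentMul, sub_eq_zero, Finsupp.sum]; exact Eq.symm
  have h2 : laurentMul (Q * N) (fun a => if a = 0 then 1 else 0) = ⇑(Q * N).coeff := by
    funext a
    simp [laurentMul, sub_eq_zero, Finsupp.sum]; exact Eq.symm
  rw [← h2, laurentMul_mul, h]

theorem SumsTo.unique {R ι : Type*} [CommRing R] [IsDomain R] {S : (ι →₀ ℤ) → R}
    {σ τ : RatFun R ι} (hσ : SumsTo S σ) (hτ : SumsTo S τ) : σ = τ := by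
  obtain ⟨Q, N, hQ, hN, rfl⟩ := hσ
  obtain ⟨P, M, hP, hM, rfl⟩ := hτ
  have inj := IsFractionRing.injective (LaurentPoly R ι) (RatFun R ι)
  have key : P * N = Q * M := by
    apply AddMonoidAlgebra.coeff_injective
    apply DFunLike.coe_injective
    rw [← laurentMul_coeff, ← laurentMul_coeff, ← hN, ← hM, ← laurentMul_mul, ← laurentMul_mul,
      mul_comm]
  rw [div_eq_div_iff ((map_ne_zero_iff _ inj).2 hQ) ((map_ne_zero_iff _ inj).2 hP),
    ← map_mul, ← map_mul, mul_comm N, key, mul_comm]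

/-! ### Weighted integer point transforms -/

/-- The faces of a polyhedron: its nonempty exposed subsets (including the polyhedron itself). -/
def polyFaces {ι : Type*} (P : Set (ι → ℝ)) : Set (Set (ι → ℝ)) :=
  {f | f.Nonempty ∧ IsExposed ℝ P f}

/-- The minimal face of `P` containing the point `x`. -/
def minFace {ι : Type*} (P : Set (ι → ℝ)) (x : ι → ℝ) : Set (ι → ℝ) :=
  ⋂₀ {f | f ∈ polyFaces P ∧ x ∈ f}

open Classical in
/-- The weighted generating function `S_φ(P)` of the integer points of `P`: the coefficient at an
integer point `a` of `P` is the value of `φ` at the minimal face of `P` containing `a`. -/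
noncomputable def weightedSeries {R ι : Type*} [CommRing R] (P : Set (ι → ℝ))
    (φ : Set (ι → ℝ) → R) : (ι →₀ ℤ) → R :=
  fun a => if (fun k => (a k : ℝ)) ∈ P then φ (minFace P fun k => (a k : ℝ)) else 0

open Classical in
/-- The weighted integer point transform `σ_φ(P)` (zero if it does not exist). -/
noncomputable def weightedIPT {R ι : Type*} [CommRing R] [IsDomain R] (P : Set (ι → ℝ))
    (φ : Set (ι → ℝ) → R) : RatFun R ι :=
  if h : ∃ σ, SumsTo (weightedSeries P φ) σ then h.choose else 0

/-! ### Monomial specializations of rational functions -/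

/-- The ring homomorphism of Laurent polynomials that substitutes for each variable `t_k` the
monomial with exponent vector `m k`. -/
noncomputable def monomialSubst (R : Type*) {ι κ : Type*} [CommRing R] (m : ι → (κ →₀ ℤ)) :
    LaurentPoly R ι →+* LaurentPoly R κ :=
  AddMonoidAlgebra.mapDomainRingHom R
    (Finsupp.liftAddHom fun k => (zmultiplesHom (κ →₀ ℤ)) (m k))

/-- The rational function `σ` is the quotient of two Laurent polynomials whose denominator does not
vanish under the substitution `t_k ↦ x ^ (m k)`, and `f` is the result of the substitution. -/
def SpecializesTo {R ι κ : Type*} [CommRing R] [IsDomain R] (m : ι → (κ →₀ ℤ))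
    (σ : RatFun R ι) (f : RatFun R κ) : Prop :=
  ∃ N Q : LaurentPoly R ι, monomialSubst R m Q ≠ 0 ∧
    σ = algebraMap (LaurentPoly R ι) (RatFun R ι) N /
      algebraMap (LaurentPoly R ι) (RatFun R ι) Q ∧
    f = algebraMap (LaurentPoly R κ) (RatFun R κ) (monomialSubst R m N) /
      algebraMap (LaurentPoly R κ) (RatFun R κ) (monomialSubst R m Q)

theorem SpecializesTo.unique {R ι κ : Type*} [CommRing R] [IsDomain R] {m : ι → (κ →₀ ℤ)}
    {σ : RatFun R ι} {f g : RatFun R κ} (hf : SpecializesTo m σ f) (hg : SpecializesTo m σ g) :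
    f = g := by
  obtain ⟨N, Q, hQ, rfl, rfl⟩ := hf
  obtain ⟨M, P, hP, h, rfl⟩ := hg
  have inj := IsFractionRing.injective (LaurentPoly R ι) (RatFun R ι)
  have inj' := IsFractionRing.injective (LaurentPoly R κ) (RatFun R κ)
  have hQ0 : Q ≠ 0 := by rintro rfl; simp at hQ
  have hP0 : P ≠ 0 := by rintro rfl; simp at hP
  rw [div_eq_div_iff ((map_ne_zero_iff _ inj).2 hQ0) ((map_ne_zero_iff _ inj).2 hP0),
    ← map_mul, ← map_mul] at h
  rw [div_eq_div_iff ((map_ne_zero_iff _ inj').2 hQ) ((map_ne_zero_iff _ inj').2 hP),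
    ← map_mul, ← map_mul, ← map_mul, ← map_mul, inj h]

open Classical in
/-- The value of the specialization `t_k ↦ x ^ (m k)` at a rational function (zero if it is not
defined there). -/
noncomputable def specialize {R ι κ : Type*} [CommRing R] [IsDomain R] (m : ι → (κ →₀ ℤ))
    (σ : RatFun R ι) : RatFun R κ :=
  if h : ∃ f, SpecializesTo m σ f then h.choose else 0

/-! ### The rotated square lattice and its ordinary subgraphs -/

/-- The rotated square lattice: the vertex `(i, j)` is in row `i`, and the two vertices directly
above it are `(i - 1, j)` (to the left) and `(i - 1, j + 1)` (to the right). -/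
def rotatedLattice : SimpleGraph (ℤ × ℤ) :=
  SimpleGraph.fromRel fun u v => v = (u.1 - 1, u.2) ∨ v = (u.1 - 1, u.2 + 1)

/-- The number `a_Γ` of the top row containing vertices of `Γ`. -/
noncomputable def topRow (Γ : Finset (ℤ × ℤ)) : ℤ :=
  sInf (Prod.fst '' (Γ : Set (ℤ × ℤ)))

/-- The set of the second indices of the vertices of `Γ` in row `i`. -/
def rowOf (Γ : Finset (ℤ × ℤ)) (i : ℤ) : Finset ℤ :=
  (Γ.filter fun v => v.1 = i).image Prod.snd

/-- Ordinary subgraphs of the rotated square lattice. A finite full subgraph is given by its finite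
set `Γ` of vertices. -/
structure IsOrdinary (Γ : Finset (ℤ × ℤ)) : Prop where
  connected : (rotatedLattice.induce (Γ : Set (ℤ × ℤ))).Connected
  below : ∀ i j : ℤ, (i, j) ∈ Γ → (i, j + 1) ∈ Γ → (i + 1, j) ∈ Γ
  above : ∀ i j : ℤ, topRow Γ < i → (i, j) ∈ Γ → (i, j + 1) ∈ Γ → (i - 1, j + 1) ∈ Γ

/-- The generalized Gelfand-Tsetlin polyhedron `D_Γ(b_1, …, b_l)`, where `l` is the number of
vertices of `Γ` in its top row; these are numbered from left to right. -/
def gtPolyhedron (Γ : Finset (ℤ × ℤ)) (b : Fin (rowOf Γ (topRow Γ)).card → ℤ) :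
    Set (ℤ × ℤ → ℝ) :=
  {s | (∀ v, v ∉ Γ → s v = 0) ∧
    (∀ k, s (topRow Γ, (rowOf Γ (topRow Γ)).orderEmbOfFin rfl k) = b k) ∧
    ∀ i j : ℤ, (i, j) ∈ Γ →
      ((i - 1, j) ∈ Γ → s (i, j) ≤ s (i - 1, j)) ∧
      ((i - 1, j + 1) ∈ Γ → s (i - 1, j + 1) ≤ s (i, j))}

/-- The subgraph `Δ_f` of `Γ`: all vertices of `Γ`, and the edges of `Γ` at whose two ends the
coordinates of every point of `f` are equal. -/
def faceGraph (Γ : Finset (ℤ × ℤ)) (f : Set (ℤ × ℤ → ℝ)) : SimpleGraph Γ where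
  Adj u v := rotatedLattice.Adj u v ∧ ∀ s ∈ f, s u = s v
  symm := ⟨fun _ _ h => ⟨h.1.symm, fun s hs => (h.2 s hs).symm⟩⟩
  loopless := ⟨fun _ h => h.1.ne rfl⟩

/-- The number of vertices in row `i` of a connected component `E`. -/
noncomputable def rowCount {Γ : Finset (ℤ × ℤ)} {G : SimpleGraph Γ}
    (E : G.ConnectedComponent) (i : ℤ) : ℕ :=
  {v : Γ | v ∈ E.supp ∧ v.1.1 = i}.ncard

/-- The weight `φ_Γ(f) = ∏ (1 - t ^ l) ^ (d_l)` of a face `f`. The product is taken over the pairs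
of a component `E` of `Δ_f` and a row `i` of `Γ` below the top row; such a pair contributes
`1 - t ^ l` if `E` has exactly `l - 1` vertices in row `i - 1` and `l` vertices in row `i`. -/
noncomputable def faceWeight (Γ : Finset (ℤ × ℤ)) (f : Set (ℤ × ℤ → ℝ)) : Polynomial ℤ :=
  ∏ᶠ E : (faceGraph Γ f).ConnectedComponent,
    ∏ i ∈ (Γ.image Prod.fst).filter (fun i => topRow Γ < i),
      if rowCount E i = rowCount E (i - 1) + 1 then 1 - Polynomial.X ^ rowCount E i else 1

/-- The exponent vectors of the specialization `t_{i,j} ↦ x_i⁻¹ x_{i+1}`. -/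
noncomputable def gtSpec (v : ℤ × ℤ) : ℤ →₀ ℤ :=
  Finsupp.single (v.1 + 1) 1 - Finsupp.single v.1 1

/-- The specialized weighted transform `ψ_Γ(b_1, …, b_l)`, a rational function in the variables
`x_i`, `i ∈ ℤ`, over `ℤ[t]`. -/
noncomputable def psi (Γ : Finset (ℤ × ℤ)) (b : Fin (rowOf Γ (topRow Γ)).card → ℤ) :
    RatFun (Polynomial ℤ) ℤ :=
  specialize gtSpec (weightedIPT (gtPolyhedron Γ b) (faceWeight Γ))

/-! Connectivity together with conditions (2) and (3) forces `Γ` to be a stack of intervals whose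
ends move by half a step from each row to the next, with a single vertex in the last row
(`IsOrdinary.exists_isRowChain`). For an integer point, a component of the face graph that meets row
`k` meets the rows `k` and `k - 1` exactly in the entries with its value. Hence the weight of the
minimal face is a product of local weights of consecutive interlacing rows
(`IsRowChain.faceWeight_minFace`), and `S` becomes a `chainSeries`.

Under the specialization the term of an array `s` is multiplied by `∏ y_k ^ (sum of row k)` with
`y_k = x_k⁻¹ x_{k+1}`. The resulting infinite sum is given a value by regularization: one multiplies
by an element of the group algebra of nonzero augmentation that makes the support finite
(`HasRegSum`). The value is unique, it is the specialization of `σ`, and Fubini's theorem holds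
along a row (`HasRegSum.summand`, `HasRegSum.chain_row`).

Let row `r` be longer than row `r - 1`, and sum over row `r` alone with both neighbouring rows
fixed; put `z = y_r`. In terms of height functions the heights of interlacing rows differ by 0 or 1,
so row `r` is a path of bits indexed by the possible values, and the sum is a one-row partition
function of a vertex model. Moving an R-matrix through all values by the Yang–Baxter equation
(`yangBaxter`, `pathSum_intertwine`) identifies this sum, up to constants and a power of `z`, with
the sum over a row with other ends and parameter `z⁻¹` (`rowSum_swap`). With the new row `r`, the
growth step lies between the rows `r` and `r + 1`. The power of `z` is absorbed by the characters of
the rows `r - 1` and `r + 1`; altogether the characters undergo a simple reflection, which keeps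
them generic (`IsGenericChar.swapChar`).

Repeating this moves the growth step down to the last row, which has one vertex, so that the row
above it has become empty. The last entry is then unconstrained, and the regularized sum of a
geometric progression over all of `ℤ` is zero (`chainSeries_hasRegSum_zero`). -/

/-! ### Regularized sums of functions on abelian groups -/

section RegularizedSum

variable {K G H : Type*} [CommRing K] [AddCommGroup G] [AddCommGroup H]

/-- The translation action of an abelian group on the functions on it. -/
def translateHom (K G : Type*) [CommRing K] [AddCommGroup G] :
    Multiplicative G →* Module.End K (G → K) where
  toFun g :=
    { toFun := fun F a => F (a - g.toAdd)
      map_add' := fun _ _ => rfl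
      map_smul' := fun _ _ => rfl }
  map_one' := by ext; simp
  map_mul' g h := by ext F a; simp [sub_sub]

/-- The action of the group algebra on the functions on the group. -/
noncomputable def act : AddMonoidAlgebra K G →ₐ[K] Module.End K (G → K) :=
  AddMonoidAlgebra.lift K (Module.End K (G → K)) G (translateHom K G)

/-- The augmentation of the group algebra. -/
noncomputable def aug : AddMonoidAlgebra K G →ₐ[K] K :=
  AddMonoidAlgebra.lift K K G 1

@[simp] theorem act_single (g : G) (c : K) (F : G → K) (a : G) :
    act (AddMonoidAlgebra.single g c) F a = c * F (a - g) := by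
  simp [act, translateHom]

@[simp] theorem aug_single (g : G) (c : K) :
    aug (AddMonoidAlgebra.single g c) = c := by
  simp [aug]

theorem act_mul (P Q : AddMonoidAlgebra K G) (F : G → K) : act (P * Q) F = act P (act Q F) := by
  rw [map_mul]; rfl

theorem act_add (P Q : AddMonoidAlgebra K G) (F : G → K) : act (P + Q) F = act P F + act Q F := by
  rw [map_add]; rfl

theorem act_one_sub_single (g : G) (c : K) (F : G → K) (a : G) :
    act (1 - AddMonoidAlgebra.single g c) F a = F a - c * F (a - g) := by
  rw [map_sub, map_one]
  simp

theorem act_finite (Q : AddMonoidAlgebra K G) {F : G → K} (hF : F.support.Finite) :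
    (act Q F).support.Finite := by
  induction Q using AddMonoidAlgebra.induction_linear with
  | zero => simp
  | add P Q hP hQ =>
    rw [act_add]
    exact (hP.union hQ).subset (Function.support_add _ _)
  | single g c =>
    refine (hF.image (fun a => a + g)).subset fun a ha => ?_
    rw [Function.mem_support, act_single] at ha
    exact ⟨a - g, right_ne_zero_of_mul ha, by simp⟩

/-- Translations preserve the total sum of a finitely supported function; the rest is linearity. -/
theorem finsum_act [IsDomain K] (Q : AddMonoidAlgebra K G) {F : G → K} (hF : F.support.Finite) :
    ∑ᶠ a, act Q F a = aug Q * ∑ᶠ a, F a := by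
  induction Q using AddMonoidAlgebra.induction_linear with
  | zero => simp
  | add P Q hP hQ =>
    rw [act_add, map_add, add_mul, ← hP, ← hQ]
    exact finsum_add_distrib (act_finite P hF) (act_finite Q hF)
  | single g c =>
    simp only [act_single, aug_single]
    have h2 : ∑ᶠ a, F (a - g) = ∑ᶠ a, F a := finsum_comp_equiv (Equiv.subRight g)
    rw [← mul_finsum, h2]

/-- The function `F` is summable up to multiplication by an element of the group algebra with
nonzero augmentation, with regularized sum `v`. -/
def HasRegSum (F : G → K) (v : K) : Prop :=
  ∃ Q : AddMonoidAlgebra K G, aug Q ≠ 0 ∧ (act Q F).support.Finite ∧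
    ∑ᶠ a, act Q F a = aug Q * v

/-- By commutativity, applying `Q` after `P` or `P` after `Q` gives the same finitely supported
function. Computing its sum in both ways, the two nonzero augmentations cancel. -/
theorem HasRegSum.unique [IsDomain K] {F : G → K} {v w : K} (hv : HasRegSum F v)
    (hw : HasRegSum F w) : v = w := by
  obtain ⟨P, hP, hPf, hPs⟩ := hv
  obtain ⟨Q, hQ, hQf, hQs⟩ := hw
  have h1 := finsum_act Q hPf
  have h2 := finsum_act P hQf
  rw [← act_mul, hPs] at h1
  rw [← act_mul, mul_comm, hQs] at h2
  have h3 : aug P * aug Q * v = aug P * aug Q * w := by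
    rw [mul_comm (aug P), mul_assoc, ← h1, h2]; ring
  exact mul_left_cancel₀ (mul_ne_zero hP hQ) h3

theorem HasRegSum.act_right [IsDomain K] {F : G → K} {v : K} (hF : HasRegSum F v)
    (Q : AddMonoidAlgebra K G) :
    HasRegSum (act Q F) (aug Q * v) := by
  obtain ⟨P, hP, hPf, hPs⟩ := hF
  refine ⟨P, hP, ?_, ?_⟩
  · rw [← act_mul, mul_comm, act_mul]
    exact act_finite Q hPf
  · rw [← act_mul, mul_comm, act_mul, finsum_act Q hPf, hPs]
    ring

theorem HasRegSum.const_mul [IsDomain K] {F : G → K} {v : K} (hF : HasRegSum F v) (c : K) :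
    HasRegSum (fun a => c * F a) (c * v) := by
  have h := hF.act_right (AddMonoidAlgebra.single 0 c)
  rw [aug_single] at h
  convert h using 2
  simp

/-- The constant moves from the function into the element of the group algebra, whose augmentation
stays nonzero. -/
theorem HasRegSum.of_const_mul [IsDomain K] {F : G → K} {c : K} (hc : c ≠ 0)
    (hF : HasRegSum (fun a => c * F a) 0) : HasRegSum F 0 := by
  obtain ⟨P, hP, hPf, hPs⟩ := hF
  have key : act (K := K) P (fun a => c * F a) = act (P * AddMonoidAlgebra.single 0 c) F := by
    rw [act_mul]; congr 1; funext a; simp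
  refine ⟨P * AddMonoidAlgebra.single 0 c, ?_, ?_, ?_⟩
  · rw [map_mul, aug_single]; exact mul_ne_zero hP hc
  · rwa [← key]
  · rw [← key, hPs]; simp

/-- The source of the vanishing: for `z ≠ 1` the progression `n ↦ z ^ n` on `ℤ` is annihilated by `1
- single 1 z`, of augmentation `1 - z`. -/
theorem hasRegSum_zero_of_act_eq_zero {F : G → K} (Q : AddMonoidAlgebra K G) (hQ : aug Q ≠ 0)
    (h : act Q F = 0) : HasRegSum F 0 :=
  ⟨Q, hQ, by simp [h], by simp [h]⟩

/-- The sums of a function along the fibers of a homomorphism. -/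
noncomputable def fiberSum (π : G →+ H) (F : G → K) : H → K :=
  fun a => ∑ᶠ s ∈ π ⁻¹' {a}, F s

theorem act_fiber_finite (π : G →+ H) {F : G → K} (Q : AddMonoidAlgebra K G)
    (hF : ∀ a, (π ⁻¹' {a} ∩ F.support).Finite) (a : H) :
    (π ⁻¹' {a} ∩ (act Q F).support).Finite := by
  induction Q using AddMonoidAlgebra.induction_linear with
  | zero => simp
  | add P Q hP hQ =>
    rw [act_add]
    refine (hP.union hQ).subset ?_
    rw [← Set.inter_union_distrib_left]
    exact Set.inter_subset_inter_right _ (Function.support_add _ _)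
  | single g c =>
    refine ((hF (a - π g)).image (fun s => s + g)).subset fun s hs => ?_
    obtain ⟨hs1, hs2⟩ := hs
    rw [Function.mem_support, act_single] at hs2
    refine ⟨s - g, ⟨?_, right_ne_zero_of_mul hs2⟩, by simp⟩
    simp only [Set.mem_preimage, Set.mem_singleton_iff] at hs1
    simp [hs1]

theorem act_fiberSum [IsDomain K] (π : G →+ H) {F : G → K} (Q : AddMonoidAlgebra K G)
    (hF : ∀ a, (π ⁻¹' {a} ∩ F.support).Finite) :
    act (Q.mapDomain π) (fiberSum π F) = fiberSum π (act Q F) := by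
  induction Q using AddMonoidAlgebra.induction_linear with
  | zero => funext a; simp [fiberSum]
  | add P Q hP hQ =>
    rw [AddMonoidAlgebra.mapDomain_add, act_add, act_add, hP, hQ]
    funext a
    exact (finsum_mem_add_distrib' (act_fiber_finite π P hF a) (act_fiber_finite π Q hF a)).symm
  | single g c =>
    funext a
    rw [AddMonoidAlgebra.mapDomain_single, act_single]
    simp only [fiberSum, act_single]
    have h2 : ∑ᶠ s ∈ π ⁻¹' {a}, F (s - g) = ∑ᶠ s ∈ π ⁻¹' {a - π g}, F s := by
      have := finsum_comp_equiv (Equiv.subRight g)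
        (f := fun s => ∑ᶠ (_ : s ∈ π ⁻¹' {a - π g}), F s)
      rw [← this]
      refine finsum_congr fun s => ?_
      have : s ∈ π ⁻¹' {a} ↔ s - g ∈ π ⁻¹' {a - π g} := by simp
      simp only [Equiv.subRight_apply]
      exact finsum_congr_Prop (propext this) fun _ => rfl
    rw [← h2, mul_finsum_mem]

theorem aug_mapDomain (π : G →+ H) (Q : AddMonoidAlgebra K G) :
    aug (Q.mapDomain π) = aug Q := by
  induction Q using AddMonoidAlgebra.induction_linear with
  | zero => simp
  | add P Q hP hQ => rw [AddMonoidAlgebra.mapDomain_add, map_add, map_add, hP, hQ]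
  | single g c => simp

theorem finsum_fiberSum (π : G →+ H) {F : G → K} (hF : F.support.Finite) :
    (fiberSum π F).support.Finite ∧ ∑ᶠ a, fiberSum π F a = ∑ᶠ s, F s := by
  classical
  have h1 : ∀ a, fiberSum π F a = ∑ s ∈ hF.toFinset, if π s = a then F s else 0 := by
    intro a
    rw [fiberSum, ← Finset.sum_filter]
    refine finsum_mem_eq_sum_of_inter_support_eq _ ?_
    ext s
    simp only [Set.mem_inter_iff, Set.mem_preimage, Set.mem_singleton_iff, Function.mem_support,
      Finset.coe_filter, Set.Finite.mem_toFinset, Set.mem_ofPred_eq]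
    tauto
  have h2 : (fiberSum π F).support ⊆ ↑(hF.toFinset.image π) := by
    intro a ha
    rw [Function.mem_support, h1] at ha
    obtain ⟨s, hs, hs'⟩ := Finset.exists_ne_zero_of_sum_ne_zero ha
    have : π s = a := by by_contra h; simp [h] at hs'
    exact Finset.mem_coe.2 (Finset.mem_image.2 ⟨s, hs, this⟩)
  refine ⟨(Finset.finite_toSet _).subset h2, ?_⟩
  rw [finsum_eq_sum_of_support_subset _ h2, finsum_eq_sum_of_support_subset (s := hF.toFinset) F
    (by simp)]
  simp only [h1]
  rw [Finset.sum_comm]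
  refine Finset.sum_congr rfl fun s hs => ?_
  rw [Finset.sum_ite_eq, if_pos (Finset.mem_image_of_mem _ hs)]

/-- Fubini's theorem for regularized sums. -/
theorem HasRegSum.fiber [IsDomain K] (π : G →+ H) {F : G → K} {v : K} (h : HasRegSum F v)
    (hF : ∀ a, (π ⁻¹' {a} ∩ F.support).Finite) : HasRegSum (fiberSum π F) v := by
  obtain ⟨Q, hQ, hQf, hQs⟩ := h
  refine ⟨Q.mapDomain π, by rwa [aug_mapDomain], ?_, ?_⟩
  · rw [act_fiberSum π Q hF]; exact (finsum_fiberSum π hQf).1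
  · rw [act_fiberSum π Q hF, (finsum_fiberSum π hQf).2, aug_mapDomain, hQs]

/-- An element supported on the image of `ι` moves points only within their coset, so it can be
applied coset by coset. -/
theorem act_mapDomain (ι : H →+ G) (Q : AddMonoidAlgebra K H) (F : G → K) (a : G) (μ : H) :
    act (Q.mapDomain ι) F (a + ι μ) = act Q (fun ν => F (a + ι ν)) μ := by
  induction Q using AddMonoidAlgebra.induction_linear generalizing μ with
  | zero => simp
  | add P Q hP hQ =>
    rw [AddMonoidAlgebra.mapDomain_add, act_add, act_add, Pi.add_apply, Pi.add_apply, hP, hQ]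
  | single g c => simp [add_sub_assoc]

/-- Fubini's theorem for regularized sums along a direct summand, where the sums along the summand
are regularized uniformly. -/
theorem HasRegSum.summand [IsDomain K] (π : G →+ G) (ι : H →+ G) (hι : Function.Injective ι)
    (hπι : ∀ μ, π (ι μ) = 0) (hdec : ∀ s, ∃ μ, s = π s + ι μ) {F : G → K} {v : K}
    (h : HasRegSum F v) (Q : AddMonoidAlgebra K H)
    (hQ : ∀ a, (act Q fun μ => F (a + ι μ)).support.Finite) :
    HasRegSum (fun a => ∑ᶠ (_ : π a = a), ∑ᶠ μ, act Q (fun μ => F (a + ι μ)) μ) (aug Q * v) := by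
  classical
  have hfib : ∀ a, π a = a → π ⁻¹' {a} = (fun μ => a + ι μ) '' Set.univ := by
    intro a ha
    ext s
    simp only [Set.mem_preimage, Set.mem_singleton_iff, Set.image_univ, Set.mem_range]
    constructor
    · intro hs
      obtain ⟨μ, hμ⟩ := hdec s
      exact ⟨μ, by rw [hμ, hs]⟩
    · rintro ⟨μ, rfl⟩
      simp [ha, hπι]
  have hemp : ∀ a, π a ≠ a → π ⁻¹' {a} = ∅ := by
    intro a ha
    ext s
    simp only [Set.mem_preimage, Set.mem_singleton_iff, Set.mem_empty_iff_false, iff_false]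
    rintro rfl
    obtain ⟨μ, hμ⟩ := hdec s
    apply ha
    conv_rhs => rw [hμ]
    simp [hπι]
  have hinj : ∀ a, Function.Injective fun μ => a + ι μ := fun a x y hxy => hι (by simpa using hxy)
  -- The function `F` may have infinite fibers over `π`. After `Q` has acted along the summand, `hQ`
  -- makes the fibers finite, and the elementary form of Fubini's theorem applies.
  have h2 := h.act_right (Q.mapDomain ι)
  rw [aug_mapDomain] at h2
  have h3 := h2.fiber π ?_
  · convert h3 using 1
    funext a
    rw [fiberSum]
    by_cases ha : π a = a
    · rw [finsum_eq_if, if_pos ha, hfib a ha, finsum_mem_image (hinj a).injOn, finsum_mem_univ]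
      exact finsum_congr fun μ => (act_mapDomain ι Q F a μ).symm
    · rw [finsum_eq_if, if_neg ha, hemp a ha, finsum_mem_empty]
  · intro a
    by_cases ha : π a = a
    · rw [hfib a ha]
      refine ((hQ a).image fun μ => a + ι μ).subset ?_
      rintro _ ⟨⟨μ, -, rfl⟩, hs⟩
      rw [Function.mem_support, act_mapDomain] at hs
      exact ⟨μ, hs, rfl⟩
    · rw [hemp a ha]; simp

/-- Expanded, the product yields at `s` a combination of the values of `F` at the points `s - ∑ j ∈
J, g j`. -/
theorem act_prod_eq_zero_of_forall {I : Type*} [DecidableEq I] (S : Finset I) (g : I → G)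
    (c : I → K) (F : G → K) (s : G) (h : ∀ J ⊆ S, F (s - ∑ j ∈ J, g j) = 0) :
    act (∏ j ∈ S, (1 - AddMonoidAlgebra.single (g j) (c j))) F s = 0 := by
  induction S using Finset.induction_on generalizing s with
  | empty => simpa using h ∅ (by simp)
  | insert k T hk ih =>
    rw [Finset.prod_insert hk, act_mul, act_one_sub_single, ih s, ih (s - g k)]
    · simp
    · intro J hJ
      have := h (insert k J) (Finset.insert_subset_insert _ hJ)
      rwa [Finset.sum_insert (fun h => hk (hJ h)), ← sub_sub] at this
    · exact fun J hJ => h J (hJ.trans (Finset.subset_insert _ _))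

/-- A product of difference operators annihilates a function at a point if near that point the
function is quasi-periodic with respect to one of the factors. -/
theorem act_prod_eq_zero {I : Type*} [DecidableEq I] (S : Finset I) (g : I → G) (c : I → K)
    (F : G → K) (s : G) {i : I} (hi : i ∈ S)
    (h : ∀ J ⊆ S, F (s - ∑ j ∈ J, g j) = c i * F (s - ∑ j ∈ J, g j - g i)) :
    act (∏ j ∈ S, (1 - AddMonoidAlgebra.single (g j) (c j))) F s = 0 := by
  rw [← Finset.prod_erase_mul _ _ hi, act_mul]
  apply act_prod_eq_zero_of_forall
  intro J hJ
  rw [act_one_sub_single, h J (hJ.trans (Finset.erase_subset _ _)), sub_self]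

end RegularizedSum

/-! ### Weighted chains of interlacing rows -/

section Chain

variable {R : Type*} [CommRing R]

/-- The multiplicity of a value in a row. -/
def mult (J : Finset ℤ) (μ : ℤ → ℤ) (c : ℤ) : ℕ := (J.filter fun j => μ j = c).card

/-- The entries `μ j`, `j ∈ J`, of a row interlace the entries `l j`, `j ∈ I`, of the row above. -/
def Interlace (I J : Finset ℤ) (l μ : ℤ → ℤ) : Prop :=
  ∀ j ∈ J, (j ∈ I → μ j ≤ l j) ∧ (j + 1 ∈ I → l (j + 1) ≤ μ j)

/-- The weight of two consecutive rows. -/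
def stepWeight (t : R) (I J : Finset ℤ) (l μ : ℤ → ℤ) : R :=
  ∏ c ∈ J.image μ, if mult J μ c = mult I l c + 1 then 1 - t ^ mult J μ c else 1

open Classical in
/-- The weight of two consecutive rows if they interlace, and zero otherwise. -/
noncomputable def stepTerm (t : R) (I J : Finset ℤ) (l μ : ℤ → ℤ) : R :=
  if Interlace I J l μ then stepWeight t I J l μ else 0

/-- Multiplicities only record which entries coincide; the common values merely label the factors
and can be relabelled. -/
theorem stepWeight_congr (t : R) {I J : Finset ℤ} {l μ l' μ' : ℤ → ℤ}
    (h1 : ∀ j ∈ J, ∀ k ∈ J, μ j = μ k ↔ μ' j = μ' k)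
    (h2 : ∀ i ∈ I, ∀ j ∈ J, l i = μ j ↔ l' i = μ' j) :
    stepWeight t I J l μ = stepWeight t I J l' μ' := by
  classical
  have hm1 : ∀ j ∈ J, mult J μ (μ j) = mult J μ' (μ' j) := fun j hj =>
    congrArg Finset.card (Finset.filter_congr fun k hk => h1 k hk j hj)
  have hm2 : ∀ j ∈ J, mult I l (μ j) = mult I l' (μ' j) := fun j hj =>
    congrArg Finset.card (Finset.filter_congr fun k hk => h2 k hk j hj)
  have hex : ∀ c ∈ J.image μ, ∃ j ∈ J, μ j = c := fun c hc => Finset.mem_image.1 hc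
  choose! f hfJ hf using hex
  refine Finset.prod_bij (fun c _ => μ' (f c)) (fun c hc => Finset.mem_image_of_mem _ (hfJ c hc))
    ?_ ?_ ?_
  · intro c hc d hd h
    rw [← hf c hc, ← hf d hd]
    exact (h1 _ (hfJ c hc) _ (hfJ d hd)).2 h
  · intro d hd
    obtain ⟨j, hj, rfl⟩ := Finset.mem_image.1 hd
    have hj' := Finset.mem_image_of_mem μ hj
    exact ⟨μ j, hj', (h1 _ (hfJ _ hj') _ hj).1 (hf _ hj')⟩
  · intro c hc
    have e1 := hm1 _ (hfJ c hc)
    have e2 := hm2 _ (hfJ c hc)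
    rw [hf c hc] at e1 e2
    rw [e1, e2]

/-- Only the relative order of the entries matters, so entries can be translated as long as they do
not meet others. -/
theorem stepTerm_congr (t : R) {I J : Finset ℤ} {l μ l' μ' : ℤ → ℤ}
    (h1 : ∀ j ∈ J, ∀ k ∈ J, μ j = μ k ↔ μ' j = μ' k)
    (h2 : ∀ i ∈ I, ∀ j ∈ J, l i ≤ μ j ↔ l' i ≤ μ' j)
    (h3 : ∀ i ∈ I, ∀ j ∈ J, μ j ≤ l i ↔ μ' j ≤ l' i) :
    stepTerm t I J l μ = stepTerm t I J l' μ' := by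
  classical
  have hi : Interlace I J l μ ↔ Interlace I J l' μ' := by
    refine forall₂_congr fun j hj => and_congr ?_ ?_
    · exact forall_congr' fun hi => h3 j hi j hj
    · exact forall_congr' fun hi => h2 _ hi j hj
  have hw := stepWeight_congr t (I := I) (J := J) (l := l) (μ := μ) (l' := l') (μ' := μ') h1
    fun i hi j hj => by rw [le_antisymm_iff, le_antisymm_iff, h2 i hi j hj, h3 i hi j hj]
  unfold stepTerm
  simp only [hi, hw]

/-- The vertices in the rows `a, …, e` of a chain of rows. -/
noncomputable def chainVertices (a e : ℤ) (row : ℤ → Finset ℤ) : Finset (ℤ × ℤ) :=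
  (Finset.Icc a e).biUnion fun k => (row k).image (Prod.mk k)

theorem mem_chainVertices {a e : ℤ} {row : ℤ → Finset ℤ} {v : ℤ × ℤ} :
    v ∈ chainVertices a e row ↔ (a ≤ v.1 ∧ v.1 ≤ e) ∧ v.2 ∈ row v.1 := by
  obtain ⟨i, j⟩ := v
  simp only [chainVertices, Finset.mem_biUnion, Finset.mem_Icc, Finset.mem_image, Prod.mk.injEq]
  constructor
  · rintro ⟨k, hk, j', hj', rfl, rfl⟩
    exact ⟨hk, hj'⟩
  · rintro ⟨hk, hj⟩
    exact ⟨i, hk, j, hj, rfl, rfl⟩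

open Classical in
/-- The weighted series of the arrays with interlacing rows `a, …, e` and top row `b`, multiplied
by a character that is constant on every row. -/
noncomputable def chainSeries (t : R) (y : ℤ → Rˣ) (a e : ℤ) (row : ℤ → Finset ℤ) (b : ℤ → ℤ)
    (s : ℤ × ℤ →₀ ℤ) : R :=
  (if (∀ v, v ∉ chainVertices a e row → s v = 0) ∧ ∀ j ∈ row a, s (a, j) = b j then 1 else 0) *
    (∏ k ∈ Finset.Ioc a e,
      stepTerm t (row (k - 1)) (row k) (fun j => s (k - 1, j)) fun j => s (k, j)) *
    ∏ k ∈ Finset.Icc a e, ((y k ^ (∑ j ∈ row k, s (k, j)) : Rˣ) : R)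

theorem zpow_finset_sum {M ι : Type*} [CommGroup M] (x : M) (J : Finset ι) (f : ι → ℤ) :
    x ^ (∑ j ∈ J, f j) = ∏ j ∈ J, x ^ f j := by
  classical
  induction J using Finset.induction_on with
  | empty => simp
  | insert k J hk ih => rw [Finset.sum_insert hk, Finset.prod_insert hk, zpow_add, ih]

theorem prod_rows_eq (y : ℤ → Rˣ) (a e : ℤ) (row : ℤ → Finset ℤ) (s : ℤ × ℤ →₀ ℤ) :
    ∏ k ∈ Finset.Icc a e, ((y k ^ (∑ j ∈ row k, s (k, j)) : Rˣ) : R) =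
      ((∏ v ∈ chainVertices a e row, y v.1 ^ s v : Rˣ) : R) := by
  rw [chainVertices, Finset.prod_biUnion, Units.coe_prod]
  · refine Finset.prod_congr rfl fun k _ => ?_
    rw [Finset.prod_image (fun x _ x' _ h => (Prod.mk.inj h).2)]
    congr 1
    exact zpow_finset_sum _ _ _
  · intro k _ k' _ hkk'
    rw [Function.onFun, Finset.disjoint_left]
    intro v hv hv'
    obtain ⟨x, _, rfl⟩ := Finset.mem_image.1 hv
    obtain ⟨x', _, h⟩ := Finset.mem_image.1 hv'
    exact hkk' (Prod.mk.inj h).1.symm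

/-- The indicator function of a finite set of vertices. -/
noncomputable def indicatorVec {V : Type*} (U : Finset V) : V →₀ ℤ := ∑ v ∈ U, Finsupp.single v 1

theorem indicatorVec_apply {V : Type*} [DecidableEq V] (U : Finset V) (v : V) :
    indicatorVec U v = if v ∈ U then 1 else 0 := by
  simp [indicatorVec, Finsupp.finsetSum_apply, Finsupp.single_apply]

theorem chainSeries_shift_of_stepTerm_eq (t : R) (y : ℤ → Rˣ) (a e : ℤ) (row : ℤ → Finset ℤ)
    (b : ℤ → ℤ) (s : ℤ × ℤ →₀ ℤ) (U : Finset (ℤ × ℤ)) (hU : U ⊆ chainVertices a e row)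
    (htop : ∀ u ∈ U, u.1 ≠ a)
    (h2 : ∀ k ∈ Finset.Ioc a e,
      stepTerm t (row (k - 1)) (row k) (fun j => s (k - 1, j)) (fun j => s (k, j)) =
      stepTerm t (row (k - 1)) (row k) (fun j => (s - indicatorVec U) (k - 1, j))
        (fun j => (s - indicatorVec U) (k, j))) :
    chainSeries t y a e row b s =
      ((∏ v ∈ U, y v.1 : Rˣ) : R) * chainSeries t y a e row b (s - indicatorVec U) := by
  classical
  have h1 : ((∀ v, v ∉ chainVertices a e row → s v = 0) ∧ ∀ j ∈ row a, s (a, j) = b j) ↔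
      ((∀ v, v ∉ chainVertices a e row → (s - indicatorVec U) v = 0) ∧
        ∀ j ∈ row a, (s - indicatorVec U) (a, j) = b j) := by
    simp only [Finsupp.coe_sub, Pi.sub_apply, indicatorVec_apply]
    refine and_congr (forall₂_congr fun v hv => ?_) (forall₂_congr fun j hj => ?_)
    · rw [if_neg fun h => hv (hU h), sub_zero]
    · rw [if_neg fun h => htop _ h rfl, sub_zero]
  have h3 : ∏ v ∈ chainVertices a e row, y v.1 ^ s v =
      (∏ v ∈ U, y v.1) * ∏ v ∈ chainVertices a e row, y v.1 ^ (s - indicatorVec U) v := by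
    rw [← Finset.inter_eq_right.2 hU, ← Finset.prod_ite_mem, ← Finset.prod_mul_distrib]
    refine Finset.prod_congr rfl fun v hv => ?_
    simp only [Finsupp.coe_sub, Pi.sub_apply, indicatorVec_apply, Finset.mem_inter, hv, true_and]
    by_cases h : v ∈ U
    · simp only [h, if_true]
      rw [zpow_sub_one, mul_comm, inv_mul_cancel_right]
    · simp [h]
  unfold chainSeries
  rw [prod_rows_eq, prod_rows_eq, h3, Units.val_mul, Finset.prod_congr rfl h2]
  simp only [h1]
  ring

/-- Entries at distance at least 2 from all others can be lowered by 1 without changing the order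
pattern, so only the character changes. -/
theorem chainSeries_shift (t : R) (y : ℤ → Rˣ) (a e : ℤ) (row : ℤ → Finset ℤ) (b : ℤ → ℤ)
    (s : ℤ × ℤ →₀ ℤ) (U : Finset (ℤ × ℤ)) (hU : U ⊆ chainVertices a e row)
    (htop : ∀ u ∈ U, u.1 ≠ a)
    (hgap : ∀ u ∈ U, ∀ w ∈ chainVertices a e row, w ∉ U → s u + 2 ≤ s w ∨ s w + 2 ≤ s u) :
    chainSeries t y a e row b s =
      ((∏ v ∈ U, y v.1 : Rˣ) : R) * chainSeries t y a e row b (s - indicatorVec U) := by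
  classical
  have hle : ∀ v ∈ chainVertices a e row, ∀ w ∈ chainVertices a e row,
      s v ≤ s w ↔ (s - indicatorVec U) v ≤ (s - indicatorVec U) w := by
    intro v hv w hw
    simp only [Finsupp.coe_sub, Pi.sub_apply, indicatorVec_apply]
    by_cases h1 : v ∈ U <;> by_cases h2 : w ∈ U
    · simp [h1, h2]
    · have := hgap v h1 w hw h2
      simp only [h1, h2, if_true, if_false]; omega
    · have := hgap w h2 v hv h1
      simp only [h1, h2, if_true, if_false]; omega
    · simp [h1, h2]
  refine chainSeries_shift_of_stepTerm_eq t y a e row b s U hU htop ?_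
  intro k hk
  rw [Finset.mem_Ioc] at hk
  have m1 : ∀ j ∈ row k, (k, j) ∈ chainVertices a e row := fun j hj =>
    mem_chainVertices.2 ⟨⟨hk.1.le, hk.2⟩, hj⟩
  have m2 : ∀ j ∈ row (k - 1), (k - 1, j) ∈ chainVertices a e row := fun j hj =>
    mem_chainVertices.2 ⟨⟨by simp only; omega, by simp only; omega⟩, hj⟩
  refine stepTerm_congr t ?_ ?_ ?_
  · intro j hj k hk
    rw [le_antisymm_iff, le_antisymm_iff, hle _ (m1 _ hj) _ (m1 _ hk),
      hle _ (m1 _ hk) _ (m1 _ hj)]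
  · exact fun i hi j hj => hle _ (m2 _ hi) _ (m1 _ hj)
  · exact fun i hi j hj => hle _ (m1 _ hj) _ (m2 _ hi)

/-- The product of difference operators over all nonempty sets of vertices of a chain of rows. -/
noncomputable def chainDenominator (y : ℤ → Rˣ) (V : Finset (ℤ × ℤ)) :
    AddMonoidAlgebra R (ℤ × ℤ →₀ ℤ) :=
  ∏ U ∈ V.powerset.erase ∅,
    (1 - AddMonoidAlgebra.single (indicatorVec U) ((∏ v ∈ U, y v.1 : Rˣ) : R))

/-- Pigeonhole: `V.card + 1` consecutive intervals of length `L` above `C` cannot all contain one of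
the `V.card` values `|s w|`. The hypothesis on `v` places it beyond all these intervals. -/
theorem exists_abs_gap (V : Finset (ℤ × ℤ)) (s : ℤ × ℤ → ℤ) (C L : ℤ) (hL : 0 < L) {v : ℤ × ℤ}
    (hs : C + (V.card + 1) * L < |s v|) :
    ∃ D, C ≤ D ∧ D + L < |s v| ∧ ∀ w ∈ V, |s w| ≤ D ∨ D + L < |s w| := by
  classical
  -- The number of the interval containing `|s w|`. Values up to `C` are sent to 0, which at worst
  -- occupies an interval needlessly.
  let f : ℤ × ℤ → ℕ := fun w => ((|s w| - C - 1) / L).toNat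
  obtain ⟨k, hk, hk'⟩ : ∃ k ∈ Finset.range (V.card + 1), k ∉ V.image f :=
    Finset.exists_mem_notMem_of_card_lt_card
      (Finset.card_image_le.trans_lt (by simp))
  have hk1 : (k : ℤ) * L ≤ V.card * L := by
    have : (k : ℤ) ≤ V.card := by exact_mod_cast Nat.lt_succ_iff.1 (Finset.mem_range.1 hk)
    exact mul_le_mul_of_nonneg_right this hL.le
  refine ⟨C + k * L, ?_, ?_, fun w hw => ?_⟩
  · nlinarith [Int.natCast_nonneg k]
  · nlinarith
  · by_contra! h
    apply hk'
    refine Finset.mem_image.2 ⟨w, hw, ?_⟩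
    have : (|s w| - C - 1) / L = k := by
      rw [Int.ediv_eq_iff_of_pos hL]
      constructor <;> nlinarith
    simp only [f, this, Int.toNat_natCast]

/-- The top row is bounded on the support. If some other entry is very large in absolute value, a
gap separates a set `U` of large entries of one sign, disjoint from the top row, from all remaining
entries. There the series is quasi-periodic under the translation by `U`, and the factor of the
denominator with index `U` annihilates it. -/
theorem chainSeries_act_finite (t : R) (y : ℤ → Rˣ) (a e : ℤ)
    (row : ℤ → Finset ℤ) (b : ℤ → ℤ) :
    (act (chainDenominator y (chainVertices a e row))
      (chainSeries t y a e row b)).support.Finite := by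
  classical
  set V := chainVertices a e row with hV
  set S := V.powerset.erase ∅ with hS
  set N : ℤ := (S.card : ℤ) with hN
  set C : ℤ := N + ∑ j ∈ row a, |b j| with hC
  set M : ℤ := C + (V.card + 1) * (N + 2) with hM
  have hN0 : 0 ≤ N := Int.natCast_nonneg _
  have hC0 : 0 ≤ C := add_nonneg hN0 (Finset.sum_nonneg fun _ _ => abs_nonneg _)
  have hCM : C ≤ M := by
    have : (0 : ℤ) ≤ (V.card + 1) * (N + 2) := by positivity
    omega
  have hshift : ∀ J ⊆ S, ∀ v, 0 ≤ (∑ U ∈ J, indicatorVec U) v ∧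
      (∑ U ∈ J, indicatorVec U) v ≤ N := by
    intro J hJ v
    rw [Finsupp.finsetSum_apply]
    simp only [indicatorVec_apply]
    refine ⟨Finset.sum_nonneg fun _ _ => by split_ifs <;> simp, ?_⟩
    refine (Finset.sum_le_card_nsmul J _ 1 fun _ _ => by split_ifs <;> simp).trans ?_
    simp only [nsmul_eq_mul, mul_one, hN]
    exact_mod_cast Finset.card_le_card hJ
  have hshift0 : ∀ J ⊆ S, ∀ v ∉ V, (∑ U ∈ J, indicatorVec U) v = 0 := by
    intro J hJ v hv
    rw [Finsupp.finsetSum_apply]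
    refine Finset.sum_eq_zero fun U hU => ?_
    rw [indicatorVec_apply, if_neg]
    have := Finset.mem_powerset.1 (Finset.mem_of_mem_erase (hJ hU))
    exact fun h => hv (this h)
  refine (Finset.finite_toSet (V.finsupp fun _ => Finset.Icc (-M) M)).subset fun s hs => ?_
  rw [Finset.mem_coe, Finset.mem_finsupp_iff]
  rw [Function.mem_support, chainDenominator] at hs
  have hsupp : s.support ⊆ V := by
    by_contra hcon
    rw [Finset.not_subset] at hcon
    obtain ⟨v, hv, hvV⟩ := hcon
    rw [Finsupp.mem_support_iff] at hv
    apply hs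
    apply act_prod_eq_zero_of_forall
    intro J hJ
    rw [chainSeries, if_neg, zero_mul, zero_mul]
    rintro ⟨h, -⟩
    have := h v hvV
    rw [Finsupp.coe_sub, Pi.sub_apply, hshift0 J hJ v hvV, sub_zero] at this
    exact hv this
  refine ⟨hsupp, ?_⟩
  have htop : ∀ j ∈ row a, b j ≤ s (a, j) ∧ s (a, j) ≤ b j + N := by
    by_contra hcon
    push Not at hcon
    obtain ⟨j, hj, hj'⟩ := hcon
    apply hs
    apply act_prod_eq_zero_of_forall
    intro J hJ
    rw [chainSeries, if_neg, zero_mul, zero_mul]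
    rintro ⟨-, h⟩
    have h1 := h j hj
    rw [Finsupp.coe_sub, Pi.sub_apply] at h1
    have h2 := hshift J hJ (a, j)
    by_cases h3 : b j ≤ s (a, j)
    · have := hj' h3; omega
    · omega
  have htop' : ∀ j ∈ row a, |s (a, j)| ≤ C := by
    intro j hj
    have h1 := htop j hj
    have h2 : |b j| ≤ ∑ j ∈ row a, |b j| :=
      Finset.single_le_sum (f := fun j => |b j|) (fun _ _ => abs_nonneg _) hj
    have h3 := abs_le.1 (le_refl |b j|)
    rw [abs_le]; constructor <;> omega
  intro v hv
  rw [Finset.mem_Icc, ← abs_le]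
  by_contra! hbig
  -- The translations in the expanded product lower each entry by something between 0 and `N`, so a
  -- gap of `N + 2` leaves the distance 2 required by `chainSeries_shift`.
  obtain ⟨D, hCD, hDv, hD⟩ := exists_abs_gap V s C (N + 2) (by omega) hbig
  obtain ⟨U, hUV, hvU, hUtop, hUgap⟩ : ∃ U ⊆ V, v ∈ U ∧ (∀ u ∈ U, u.1 ≠ a) ∧
      ∀ u ∈ U, ∀ w ∈ V, w ∉ U → s u + (N + 2) ≤ s w ∨ s w + (N + 2) ≤ s u := by
    have htopD : ∀ u ∈ V, D < |s u| → u.1 ≠ a := by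
      intro u hu hu' h
      have h1 := htop' u.2 (by rw [← h]; exact (mem_chainVertices.1 hu).2)
      rw [← h] at h1
      simp only [Prod.mk.eta] at h1
      omega
    rcases le_total 0 (s v) with h0 | h0
    · refine ⟨V.filter fun u => D < s u, Finset.filter_subset _ _, ?_, ?_, ?_⟩
      · rw [Finset.mem_filter]; rw [abs_of_nonneg h0] at hDv; exact ⟨hv, by omega⟩
      · intro u hu
        rw [Finset.mem_filter] at hu
        exact htopD u hu.1 (hu.2.trans_le (le_abs_self _))
      · intro u hu w hw hw'
        rw [Finset.mem_filter] at hu hw'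
        have h1 := hD u hu.1
        rw [abs_of_nonneg (by omega)] at h1
        have h2 : s w ≤ D := by by_contra! h; exact hw' ⟨hw, h⟩
        right; omega
    · refine ⟨V.filter fun u => s u < -D, Finset.filter_subset _ _, ?_, ?_, ?_⟩
      · rw [Finset.mem_filter]; rw [abs_of_nonpos h0] at hDv; exact ⟨hv, by omega⟩
      · intro u hu
        rw [Finset.mem_filter] at hu
        exact htopD u hu.1 (by rw [abs_of_nonpos (by omega)]; omega)
      · intro u hu w hw hw'
        rw [Finset.mem_filter] at hu hw'
        have h1 := hD u hu.1
        rw [abs_of_nonpos (by omega)] at h1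
        have h2 : -D ≤ s w := by by_contra! h; exact hw' ⟨hw, h⟩
        left; omega
  apply hs
  have hUS : U ∈ S := by
    rw [hS, Finset.mem_erase, Finset.mem_powerset]
    exact ⟨fun h => by simp [h] at hvU, hUV⟩
  refine act_prod_eq_zero S _ _ _ s hUS fun J hJ => ?_
  refine chainSeries_shift t y a e row b _ U hUV hUtop fun u hu w hw hwU => ?_
  have h1 := hshift J hJ u
  have h2 := hshift J hJ w
  have h3 := hUgap u hu w hw hwU
  simp only [Finsupp.coe_sub, Pi.sub_apply]
  omega

end Chain

/-! ### Height functions of rows -/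

section Height

/-- The index behind the last entry of the row `l j`, `p ≤ j < q`, that is at least `c`, provided
that the row is weakly decreasing. -/
noncomputable def height (p q : ℤ) (l : ℤ → ℤ) (c : ℤ) : ℤ :=
  p + (((Finset.Ico p q).filter fun j => c ≤ l j).card : ℤ)

theorem le_height (p q : ℤ) (l : ℤ → ℤ) (c : ℤ) : p ≤ height p q l c := by
  unfold height; omega

theorem height_le {p q : ℤ} (hpq : p ≤ q) (l : ℤ → ℤ) (c : ℤ) : height p q l c ≤ q := by
  have := Finset.card_filter_le (Finset.Ico p q) fun j => c ≤ l j
  rw [Int.card_Ico] at this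
  unfold height; omega

/-- A decreasing row and its height function are conjugate to each other, like a partition and its
transpose. -/
theorem lt_height_iff {p q : ℤ} {l : ℤ → ℤ} (hl : AntitoneOn l (Set.Ico p q)) {j : ℤ}
    (hj : j ∈ Finset.Ico p q) (c : ℤ) : j < height p q l c ↔ c ≤ l j := by
  have hj' := Finset.mem_Ico.1 hj
  constructor
  · intro h
    by_contra! hc
    have : (Finset.Ico p q).filter (fun j => c ≤ l j) ⊆ Finset.Ico p j := by
      intro k hk
      rw [Finset.mem_filter, Finset.mem_Ico] at hk
      rw [Finset.mem_Ico]
      refine ⟨hk.1.1, ?_⟩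
      by_contra! hjk
      have := hl (Set.mem_Ico.2 hj') (Set.mem_Ico.2 hk.1) hjk
      omega
    have := Finset.card_le_card this
    rw [Int.card_Ico] at this
    unfold height at h; omega
  · intro h
    have : Finset.Ico p (j + 1) ⊆ (Finset.Ico p q).filter (fun j => c ≤ l j) := by
      intro k hk
      rw [Finset.mem_Ico] at hk
      rw [Finset.mem_filter, Finset.mem_Ico]
      refine ⟨⟨hk.1, by omega⟩, ?_⟩
      have := hl (Set.mem_Ico.2 ⟨hk.1, by omega⟩) (Set.mem_Ico.2 hj') (by omega)
      omega
    have := Finset.card_le_card this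
    rw [Int.card_Ico] at this
    unfold height; omega

/-- This makes the weights local: a condition on multiplicities becomes one on the heights at two
adjacent levels. -/
theorem height_sub_height (p q : ℤ) (l : ℤ → ℤ) (c : ℤ) :
    height p q l c - height p q l (c + 1) = mult (Finset.Ico p q) l c := by
  have h : (Finset.Ico p q).filter (fun j => c ≤ l j) =
      (Finset.Ico p q).filter (fun j => c + 1 ≤ l j) ∪
        (Finset.Ico p q).filter fun j => l j = c := by
    rw [← Finset.filter_or]
    exact Finset.filter_congr fun j _ => by omega
  have hd : Disjoint ((Finset.Ico p q).filter fun j => c + 1 ≤ l j)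
      ((Finset.Ico p q).filter fun j => l j = c) :=
    Finset.disjoint_filter.2 fun j _ h1 h2 => by omega
  rw [height, height, mult, h, Finset.card_union_of_disjoint hd]
  push_cast; ring

theorem height_eq_left {p q : ℤ} {l : ℤ → ℤ} {c : ℤ} (h : ∀ j ∈ Finset.Ico p q, l j < c) :
    height p q l c = p := by
  rw [height, Finset.filter_false_of_mem]
  · simp
  · intro j hj; have := h j hj; omega

theorem height_eq_right {p q : ℤ} (hpq : p ≤ q) {l : ℤ → ℤ} {c : ℤ}
    (h : ∀ j ∈ Finset.Ico p q, c ≤ l j) : height p q l c = q := by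
  rw [height, Finset.filter_true_of_mem h, Int.card_Ico]
  omega

/-- Layer-cake summation: an entry exceeds `A` by the number of levels in `A + 1, …, B` that it
reaches. -/
theorem sum_eq_sum_height {p q : ℤ} (hpq : p ≤ q) {l : ℤ → ℤ} {A B : ℤ}
    (h : ∀ j ∈ Finset.Ico p q, A ≤ l j ∧ l j ≤ B) :
    ∑ j ∈ Finset.Ico p q, l j =
      A * (q - p) + ∑ c ∈ Finset.Icc (A + 1) B, (height p q l c - p) := by
  have h1 : ∀ j ∈ Finset.Ico p q, l j =
      A + ∑ c ∈ Finset.Icc (A + 1) B, if c ≤ l j then 1 else 0 := by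
    intro j hj
    have := h j hj
    rw [← Finset.sum_filter, Finset.sum_const]
    have : (Finset.Icc (A + 1) B).filter (fun c => c ≤ l j) = Finset.Icc (A + 1) (l j) := by
      ext c; simp only [Finset.mem_filter, Finset.mem_Icc]; omega
    rw [this, Int.card_Icc]
    simp only [nsmul_eq_mul, mul_one]
    omega
  rw [Finset.sum_congr rfl h1, Finset.sum_add_distrib, Finset.sum_const, Int.card_Ico,
    Finset.sum_comm]
  congr 1
  · simp only [nsmul_eq_mul]
    rw [Int.toNat_of_nonneg (by omega)]; ring
  · refine Finset.sum_congr rfl fun c _ => ?_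
    rw [height, ← Finset.sum_filter, Finset.sum_const]
    simp

variable {p q p' q' : ℤ} {l μ : ℤ → ℤ}

theorem Interlace.antitoneOn_bottom (h : Interlace (Finset.Ico p q) (Finset.Ico p' q') l μ)
    (hp : p ≤ p' + 1) (hq : q' ≤ q) : AntitoneOn μ (Set.Ico p' q') := by
  refine antitoneOn_of_add_one_le Set.ordConnected_Ico fun j _ hj hj' => ?_
  rw [Set.mem_Ico] at hj hj'
  have h1 : j + 1 ∈ Finset.Ico p q := Finset.mem_Ico.2 ⟨by omega, by omega⟩
  exact ((h (j + 1) (Finset.mem_Ico.2 hj')).1 h1).trans ((h j (Finset.mem_Ico.2 hj)).2 h1)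

theorem Interlace.antitoneOn_top (h : Interlace (Finset.Ico p q) (Finset.Ico p' q') l μ)
    (hp : p' ≤ p) (hq : q ≤ q' + 1) : AntitoneOn l (Set.Ico p q) := by
  refine antitoneOn_of_add_one_le Set.ordConnected_Ico fun j _ hj hj' => ?_
  rw [Set.mem_Ico] at hj hj'
  have h1 : j ∈ Finset.Ico p' q' := Finset.mem_Ico.2 ⟨by omega, by omega⟩
  exact ((h j h1).2 (Finset.mem_Ico.2 hj')).trans ((h j h1).1 (Finset.mem_Ico.2 hj))

/-- Otherwise the index `height p q l c` occurs in both rows, with a lower entry at least `c` and an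
upper entry less than `c`. With the companion bound, heights of interlacing rows differ by 0 or 1;
this difference is the bit used below. -/
theorem Interlace.height_le_height (h : Interlace (Finset.Ico p q) (Finset.Ico p' q') l μ)
    (hp : p' ≤ p) (hp' : p ≤ p' + 1) (hq : q' ≤ q) (hq' : q ≤ q' + 1) (hpq' : p' ≤ q') (c : ℤ) :
    height p' q' μ c ≤ height p q l c := by
  by_contra! hc
  have h1 := le_height p q l c
  have h2 := height_le hpq' μ c
  have m1 : height p q l c ∈ Finset.Ico p' q' := Finset.mem_Ico.2 ⟨by omega, by omega⟩
  have m2 : height p q l c ∈ Finset.Ico p q := Finset.mem_Ico.2 ⟨by omega, by omega⟩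
  have h3 := (lt_height_iff (h.antitoneOn_bottom hp' hq) m1 c).1 hc
  exact lt_irrefl _ ((lt_height_iff (h.antitoneOn_top hp hq') m2 c).2 (h3.trans ((h _ m1).1 m2)))

theorem Interlace.height_le_height_add_one
    (h : Interlace (Finset.Ico p q) (Finset.Ico p' q') l μ)
    (hp : p' ≤ p) (hp' : p ≤ p' + 1) (hq : q' ≤ q) (hq' : q ≤ q' + 1) (hpq : p ≤ q) (c : ℤ) :
    height p q l c ≤ height p' q' μ c + 1 := by
  by_contra! hc
  have h1 := le_height p' q' μ c
  have h2 := height_le hpq l c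
  have m1 : height p' q' μ c ∈ Finset.Ico p' q' := Finset.mem_Ico.2 ⟨by omega, by omega⟩
  have m2 : height p' q' μ c + 1 ∈ Finset.Ico p q := Finset.mem_Ico.2 ⟨by omega, by omega⟩
  have h3 := (lt_height_iff (h.antitoneOn_top hp hq') m2 c).1 hc
  exact lt_irrefl _ ((lt_height_iff (h.antitoneOn_bottom hp' hq) m1 c).2
    (h3.trans ((h _ m1).2 m2)))

/-- Each interlacing inequality needs the comparison of heights only at a level that occurs as an
entry. -/
theorem interlace_of_height (hl : AntitoneOn l (Set.Ico p q)) (hμ : AntitoneOn μ (Set.Ico p' q'))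
    (h1 : ∀ j ∈ Finset.Ico p' q', height p' q' μ (μ j) ≤ height p q l (μ j))
    (h2 : ∀ j ∈ Finset.Ico p q, height p q l (l j) ≤ height p' q' μ (l j) + 1) :
    Interlace (Finset.Ico p q) (Finset.Ico p' q') l μ := by
  refine fun j hj => ⟨fun hj' => ?_, fun hj' => ?_⟩
  · rw [← lt_height_iff hl hj']
    exact ((lt_height_iff hμ hj _).2 le_rfl).trans_le (h1 j hj)
  · rw [← lt_height_iff hμ hj]
    have := (lt_height_iff hl hj' _).2 le_rfl
    have := h2 _ hj'
    omega

/-- A row with prescribed height function. -/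
theorem height_of_forall_lt_iff {h : ℤ → ℤ} {c : ℤ} (hp : p ≤ h c) (hq : h c ≤ q)
    (hμ : ∀ j ∈ Finset.Ico p q, c ≤ μ j ↔ j < h c) : height p q μ c = h c := by
  have : (Finset.Ico p q).filter (fun j => c ≤ μ j) = Finset.Ico p (h c) := by
    ext j
    rw [Finset.mem_filter, Finset.mem_Ico, Finset.mem_Ico]
    constructor
    · rintro ⟨hj, hc⟩
      exact ⟨hj.1, (hμ j (Finset.mem_Ico.2 hj)).1 hc⟩
    · rintro ⟨hj, hc⟩
      have hj' : p ≤ j ∧ j < q := ⟨hj, by omega⟩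
      exact ⟨hj', (hμ j (Finset.mem_Ico.2 hj')).2 hc⟩
  rw [height, this, Int.card_Ico]
  omega

/-- The row with a given height function on the window `A, …, B + 1`. -/
noncomputable def rowOfHeight (A B : ℤ) (h : ℤ → ℤ) (j : ℤ) : ℤ :=
  A + (((Finset.Icc (A + 1) B).filter fun c => j < h c).card : ℤ)

theorem le_rowOfHeight_iff {A B : ℤ} {h : ℤ → ℤ}
    (hh : ∀ c ∈ Finset.Icc A B, h (c + 1) ≤ h c) {c j : ℤ} (hc : c ∈ Finset.Icc (A + 1) B) :
    c ≤ rowOfHeight A B h j ↔ j < h c := by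
  have hanti : AntitoneOn h (Set.Icc A (B + 1)) := by
    refine antitoneOn_of_add_one_le Set.ordConnected_Icc fun j _ hj hj' => ?_
    rw [Set.mem_Icc] at hj hj'
    exact hh j (Finset.mem_Icc.2 ⟨by omega, by omega⟩)
  rw [Finset.mem_Icc] at hc
  constructor
  · intro hr
    by_contra! hj
    have : (Finset.Icc (A + 1) B).filter (fun c => j < h c) ⊆ Finset.Ico (A + 1) c := by
      intro c' hc'
      rw [Finset.mem_filter, Finset.mem_Icc] at hc'
      rw [Finset.mem_Ico]
      refine ⟨hc'.1.1, ?_⟩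
      by_contra! hcc
      have := hanti (Set.mem_Icc.2 ⟨by omega, by omega⟩) (Set.mem_Icc.2 ⟨by omega, by omega⟩) hcc
      omega
    have := Finset.card_le_card this
    rw [Int.card_Ico] at this
    unfold rowOfHeight at hr; omega
  · intro hj
    have : Finset.Icc (A + 1) c ⊆ (Finset.Icc (A + 1) B).filter (fun c => j < h c) := by
      intro c' hc'
      rw [Finset.mem_Icc] at hc'
      rw [Finset.mem_filter, Finset.mem_Icc]
      refine ⟨⟨hc'.1, by omega⟩, ?_⟩
      have := hanti (Set.mem_Icc.2 ⟨by omega, by omega⟩) (Set.mem_Icc.2 ⟨by omega, by omega⟩)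
        hc'.2
      omega
    have := Finset.card_le_card this
    rw [Int.card_Icc] at this
    unfold rowOfHeight; omega

theorem rowOfHeight_mem (A B : ℤ) (hAB : A ≤ B) (h : ℤ → ℤ) (j : ℤ) :
    rowOfHeight A B h j ∈ Finset.Icc A B := by
  have := Finset.card_filter_le (Finset.Icc (A + 1) B) fun c => j < h c
  rw [Int.card_Icc] at this
  rw [Finset.mem_Icc]
  unfold rowOfHeight; omega

theorem height_rowOfHeight {A B : ℤ} (hAB : A ≤ B) {h : ℤ → ℤ}
    (hh : ∀ c ∈ Finset.Icc A B, h (c + 1) ≤ h c) (hA : h A = q) (hB : h (B + 1) = p)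
    {c : ℤ} (hc : c ∈ Finset.Icc A (B + 1)) : height p q (rowOfHeight A B h) c = h c := by
  have hanti : AntitoneOn h (Set.Icc A (B + 1)) := by
    refine antitoneOn_of_add_one_le Set.ordConnected_Icc fun j _ hj hj' => ?_
    rw [Set.mem_Icc] at hj hj'
    exact hh j (Finset.mem_Icc.2 ⟨by omega, by omega⟩)
  rw [Finset.mem_Icc] at hc
  have h1 := hanti (Set.mem_Icc.2 ⟨le_rfl, by omega⟩) (Set.mem_Icc.2 hc) hc.1
  have h2 := hanti (Set.mem_Icc.2 hc) (Set.mem_Icc.2 ⟨by omega, le_rfl⟩) hc.2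
  refine height_of_forall_lt_iff (by omega) (by omega) fun j hj => ?_
  have hm := Finset.mem_Icc.1 (rowOfHeight_mem A B hAB h j)
  rw [Finset.mem_Ico] at hj
  rcases eq_or_ne c A with rfl | hcA
  · exact ⟨fun _ => by omega, fun _ => hm.1⟩
  rcases eq_or_ne c (B + 1) with rfl | hcB
  · exact ⟨fun _ => by omega, fun _ => by omega⟩
  exact le_rowOfHeight_iff hh (Finset.mem_Icc.2 ⟨by omega, by omega⟩)

theorem eq_of_height_eq {A B : ℤ} {μ' : ℤ → ℤ} (hμ : AntitoneOn μ (Set.Ico p q))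
    (hμ' : AntitoneOn μ' (Set.Ico p q)) (h1 : ∀ j ∈ Finset.Ico p q, μ j ∈ Finset.Icc A B)
    (h2 : ∀ j ∈ Finset.Ico p q, μ' j ∈ Finset.Icc A B)
    (h : ∀ c ∈ Finset.Icc A B, height p q μ c = height p q μ' c) {j : ℤ}
    (hj : j ∈ Finset.Ico p q) : μ j = μ' j := by
  apply le_antisymm
  · rw [← lt_height_iff hμ' hj, ← h _ (h1 j hj), lt_height_iff hμ hj]
  · rw [← lt_height_iff hμ hj, h _ (h2 j hj), lt_height_iff hμ' hj]

/-- Extending the product from the occurring values to a whole window is harmless: at a level with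
lower multiplicity 0 the growth condition fails, and the factor is 1. -/
theorem stepWeight_eq_prod_height {R : Type*} [CommRing R] (t : R) {A B : ℤ}
    (h : ∀ j ∈ Finset.Ico p' q', μ j ∈ Finset.Icc A B) :
    stepWeight t (Finset.Ico p q) (Finset.Ico p' q') l μ = ∏ c ∈ Finset.Icc A B,
      if height p' q' μ c - height p' q' μ (c + 1) = height p q l c - height p q l (c + 1) + 1
      then 1 - t ^ (height p' q' μ c - height p' q' μ (c + 1)).toNat else 1 := by
  have hsub : (Finset.Ico p' q').image μ ⊆ Finset.Icc A B := by
    intro c hc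
    obtain ⟨j, hj, rfl⟩ := Finset.mem_image.1 hc
    exact h j hj
  rw [stepWeight, ← Finset.prod_subset hsub]
  · refine Finset.prod_congr rfl fun c _ => ?_
    rw [height_sub_height, height_sub_height, Int.toNat_natCast]
    simp only [← Int.natCast_succ, Nat.cast_inj, Nat.succ_eq_add_one]
  · intro c _ hc
    rw [height_sub_height, height_sub_height, if_neg]
    have : mult (Finset.Ico p' q') μ c = 0 := by
      rw [mult, Finset.card_eq_zero, Finset.filter_eq_empty_iff]
      exact fun j hj hjc => hc (Finset.mem_image.2 ⟨j, hj, hjc⟩)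
    omega

end Height

/-! ### Transfer matrices and the Yang–Baxter equation -/

section Transfer

variable {K : Type*} [Field K]

/-- The value of a bit as an integer. -/
def bit (x : Bool) : ℤ := cond x 1 0

theorem bit_nonneg (x : Bool) : 0 ≤ bit x := by cases x <;> simp [bit]

theorem bit_le_one (x : Bool) : bit x ≤ 1 := by cases x <;> simp [bit]

/-- Partial sums over paths of bits, with given initial bit `top` in position `B + 1`, that walk
down from `B + 1` through `n` steps with weights `step`. -/
def pathSum (step : ℤ → Bool → Bool → K) (B : ℤ) (top : Bool) : ℕ → Bool → K
  | 0, x => if x = top then 1 else 0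
  | n + 1, x => ∑ x', pathSum step B top n x' * step (B - n) x' x

/-- The bit in position `c` of the path given by a set of positions and an initial bit in position
`B + 1`. -/
def pathBit (B : ℤ) (top : Bool) (D : Finset ℤ) (c : ℤ) : Bool :=
  if c = B + 1 then top else decide (c ∈ D)

theorem pathSum_eq (step : ℤ → Bool → Bool → K) (B : ℤ) (top : Bool) (n : ℕ) (x : Bool) :
    pathSum step B top n x = ∑ D ∈ (Finset.Icc (B + 1 - n) B).powerset,
      if pathBit B top D (B + 1 - n) = x then
        ∏ c ∈ Finset.Icc (B + 1 - n) B, step c (pathBit B top D (c + 1)) (pathBit B top D c)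
      else 0 := by
  classical
  induction n generalizing x with
  | zero =>
    have : Finset.Icc (B + 1 - ((0 : ℕ) : ℤ)) B = ∅ := Finset.Icc_eq_empty (by simp)
    rw [this]
    simp only [pathSum, Finset.powerset_empty, Finset.sum_singleton, Finset.prod_empty, pathBit]
    simp [eq_comm]
  | succ n ih =>
    have e1 : B + 1 - ((n + 1 : ℕ) : ℤ) = B - n := by push_cast; ring
    have e2 : B + 1 - (n : ℤ) = B - n + 1 := by ring
    have hins : Finset.Icc (B - n) B = insert (B - n : ℤ) (Finset.Icc (B + 1 - n) B) := by
      ext c; simp only [Finset.mem_insert, Finset.mem_Icc]; omega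
    have hnot : (B - n : ℤ) ∉ Finset.Icc (B + 1 - (n : ℤ)) B := by
      simp only [Finset.mem_Icc]; omega
    -- The sets are split according to whether they contain the new position, that is, according to
    -- the last bit.
    rw [e1, hins, Finset.sum_powerset_insert hnot, pathSum]
    simp only [Finset.prod_insert hnot]
    rw [← Finset.sum_add_distrib]
    simp only [ih, Finset.sum_mul]
    rw [Finset.sum_comm]
    refine Finset.sum_congr rfl fun D hD => ?_
    rw [Finset.mem_powerset] at hD
    have hDn : (B - n : ℤ) ∉ D := fun h => hnot (hD h)
    have hne : (B - n : ℤ) ≠ B + 1 := by omega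
    have b1 : pathBit B top D (B - n) = false := by simp [pathBit, hne, hDn]
    have b2 : pathBit B top (insert (B - n : ℤ) D) (B - n) = true := by simp [pathBit, hne]
    have b3 : ∀ c ∈ Finset.Icc (B - n + 1 : ℤ) (B + 1),
        pathBit B top (insert (B - n : ℤ) D) c = pathBit B top D c := by
      intro c hc
      rw [Finset.mem_Icc] at hc
      have : c ≠ B - n := by omega
      simp [pathBit, this]
    have b4 : ∏ c ∈ Finset.Icc (B + 1 - (n : ℤ)) B,
          step c (pathBit B top (insert (B - n : ℤ) D) (c + 1))
            (pathBit B top (insert (B - n : ℤ) D) c) =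
        ∏ c ∈ Finset.Icc (B + 1 - (n : ℤ)) B, step c (pathBit B top D (c + 1))
            (pathBit B top D c) := by
      refine Finset.prod_congr rfl fun c hc => ?_
      rw [Finset.mem_Icc] at hc
      rw [b3 c (Finset.mem_Icc.2 ⟨by omega, by omega⟩),
        b3 (c + 1) (Finset.mem_Icc.2 ⟨by omega, by omega⟩)]
    rw [b4, b1, b2, b3 (B - n + 1) (Finset.mem_Icc.2 ⟨by omega, by omega⟩), e2]
    generalize ∏ c ∈ Finset.Icc (B - (n : ℤ) + 1) B, step c (pathBit B top D (c + 1))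
      (pathBit B top D c) = P
    generalize pathBit B top D (B - n + 1) = y
    cases x <;> cases y <;> simp [mul_comm]

/-- The weight of a vertex of the lattice model: `a` is the multiplicity of the value in the upper
row, `d'` and `d` are the differences of the heights of the upper and the lower row above and below
the vertex, and `x'` and `x` those of the heights of the upper and the middle row. -/
def vertexWeight (t : K) (a d' d : ℤ) (x' x : Bool) : K :=
  if (0 ≤ d' - bit x' ∧ d' - bit x' ≤ 1) ∧ 0 ≤ d - bit x ∧ d - bit x ≤ 1 then
    (if bit x' = bit x + 1 then 1 - t ^ (a + bit x' - bit x).toNat else 1) *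
      if d' - bit x' = d - bit x + 1 then 1 - t ^ (a - d + d').toNat else 1
  else 0

/-- The stochastic R-matrix. -/
def rMatrix (t z : K) (d : ℤ) (x' x : Bool) : K :=
  if d = 1 then cond x' (cond x (1 - t) (t * (1 - z))) (cond x (1 - z) (z * (1 - t)))
  else if x' = x then 1 - t * z else 0

/-- The exchange relation between rows with parameters `z` and `z⁻¹`, after removal of a factor
common to both. A nonzero vertex weight forces both gaps `d'` and `d` between the outer rows into
`{0, 1, 2}`, which leaves finitely many identities in `t`, `z` and `t ^ n`. -/
theorem yangBaxter (t z : K) (hz : z ≠ 0) {a d' d : ℤ} (ha : 0 ≤ a) (x' x : Bool) :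
    ∑ y, rMatrix t z d' x' y * (vertexWeight t a d' d y x * z ^ (-bit x)) =
      ∑ y, vertexWeight t a d' d x' y * z ^ (bit y - d) * rMatrix t z d y x := by
  obtain ⟨n, rfl⟩ := Int.eq_ofNat_of_zero_le ha
  by_cases h1 : d' < 0 ∨ 2 < d'
  · have hv : ∀ y w, vertexWeight t (n : ℤ) d' d y w = 0 := fun y w => by
      have := bit_nonneg y
      have := bit_le_one y
      rw [vertexWeight, if_neg]; omega
    simp [hv]
  by_cases h2 : d < 0 ∨ 2 < d
  · have hv : ∀ y w, vertexWeight t (n : ℤ) d' d y w = 0 := fun y w => by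
      have := bit_nonneg w
      have := bit_le_one w
      rw [vertexWeight, if_neg]; omega
    simp [hv]
  have e1 : ((n : ℤ) + 1).toNat = n + 1 := by omega
  have e2 : ((n : ℤ) + 2).toNat = n + 2 := by omega
  have e3 : ((n : ℤ) - 1 + 2).toNat = n + 1 := by omega
  obtain rfl | rfl | rfl : d' = 0 ∨ d' = 1 ∨ d' = 2 := by omega
  all_goals obtain rfl | rfl | rfl : d = 0 ∨ d = 1 ∨ d = 2 := by omega
  all_goals cases x' <;> cases x <;>
    simp [rMatrix, vertexWeight, bit, e1, e2, e3] <;> field_simp <;> ring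

end Transfer

/-! ### Sums over a row between two fixed rows -/

section Kernel

variable {K : Type*} [Field K]

/-- The path given by a set of positions, with prescribed bits in the positions `A` and `B + 1`. -/
def windowBit (A B : ℤ) (top bot : Bool) (D : Finset ℤ) (c : ℤ) : Bool :=
  if c = A then bot else pathBit B top D c

theorem windowBit_of_mem {A B : ℤ} {top bot : Bool} {D : Finset ℤ} {c : ℤ}
    (hc : c ∈ Finset.Icc (A + 1) B) : windowBit A B top bot D c = decide (c ∈ D) := by
  rw [Finset.mem_Icc] at hc
  rw [windowBit, if_neg (by omega), pathBit, if_neg (by omega)]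

/-- Here `u`, `m`, `n` stand for the heights of the upper, middle and lower row at a level, and
`u'`, `m'`, `n'` for those at the next higher level. -/
theorem ite_mul_ite_eq_vertexWeight (t : K) {u u' m m' n n' : ℤ} {x' x : Bool}
    (e : m = u - bit x) (e' : m' = u' - bit x') (h1 : n ≤ m) (h2 : m ≤ n + 1) (h1' : n' ≤ m')
    (h2' : m' ≤ n' + 1) :
    ((if m - m' = u - u' + 1 then 1 - t ^ (m - m').toNat else 1) *
      if n - n' = m - m' + 1 then 1 - t ^ (n - n').toNat else 1) =
    vertexWeight t (u - u') (u' - n') (u - n) x' x := by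
  have hc : (0 ≤ u' - n' - bit x' ∧ u' - n' - bit x' ≤ 1) ∧
      0 ≤ u - n - bit x ∧ u - n - bit x ≤ 1 := by omega
  rw [vertexWeight, if_pos hc]
  have c1 : m - m' = u - u' + 1 ↔ bit x' = bit x + 1 := by omega
  have c2 : n - n' = m - m' + 1 ↔ u' - n' - bit x' = u - n - bit x + 1 := by omega
  have c3 : m - m' = u - u' + bit x' - bit x := by omega
  have c4 : n - n' = u - u' - (u - n) + (u' - n') := by omega
  simp only [c1, c2]
  rw [← c3, ← c4]

/-- A middle row corresponds to the set of levels at which its height is one less than that of the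
upper row. At the levels `A` and `B + 1` the heights equal the ends of the rows, which fixes the
boundary bits. The function `φ` leaves room for powers of `z` and edge factors. -/
theorem sum_rows_eq_sum_paths (t : K) {p q P Q p' q' A B : ℤ} (hpq : p ≤ q) (hPQ : P ≤ Q)
    (hpq' : p' ≤ q') (h1 : P ≤ p) (h1' : p ≤ P + 1) (h2 : Q ≤ q) (h2' : q ≤ Q + 1)
    (h3 : p' ≤ P) (h3' : P ≤ p' + 1) (h4 : q' ≤ Q) (h4' : Q ≤ q' + 1) (hAB : A ≤ B)
    {top bot : Bool} (htop : bit top = p - P) (hbot : bit bot = q - Q) {l ν : ℤ → ℤ}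
    (hl : AntitoneOn l (Set.Ico p q)) (hν : AntitoneOn ν (Set.Ico p' q'))
    (hlw : ∀ j ∈ Finset.Ico p q, l j ∈ Finset.Icc A B)
    (hνw : ∀ j ∈ Finset.Ico p' q', ν j ∈ Finset.Icc A B) (φ : ℤ → ℤ → ℤ → K) :
    ∑ μ ∈ (Finset.Ico P Q).finsupp (fun _ => Finset.Icc A B),
      stepTerm t (Finset.Ico p q) (Finset.Ico P Q) l μ *
        stepTerm t (Finset.Ico P Q) (Finset.Ico p' q') μ ν *
        ∏ c ∈ Finset.Icc A B, φ c (height P Q μ (c + 1)) (height P Q μ c) =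
    ∑ D ∈ (Finset.Icc (A + 1) B).powerset, ∏ c ∈ Finset.Icc A B,
      (vertexWeight t (height p q l c - height p q l (c + 1))
        (height p q l (c + 1) - height p' q' ν (c + 1)) (height p q l c - height p' q' ν c)
        (windowBit A B top bot D (c + 1)) (windowBit A B top bot D c) *
      φ c (height p q l (c + 1) - bit (windowBit A B top bot D (c + 1)))
        (height p q l c - bit (windowBit A B top bot D c))) := by
  classical
  set hD : Finset ℤ → ℤ → ℤ := fun D c => height p q l c - bit (windowBit A B top bot D c)
    with hDdef
  set good : (ℤ →₀ ℤ) → Prop := fun μ => Interlace (Finset.Ico p q) (Finset.Ico P Q) l μ ∧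
    Interlace (Finset.Ico P Q) (Finset.Ico p' q') μ ν with hgood
  set goodD : Finset ℤ → Prop := fun D => ∀ c ∈ Finset.Icc A B, hD D (c + 1) ≤ hD D c ∧
    (height p' q' ν (c + 1) ≤ hD D (c + 1) ∧ hD D (c + 1) ≤ height p' q' ν (c + 1) + 1) ∧
    height p' q' ν c ≤ hD D c ∧ hD D c ≤ height p' q' ν c + 1 with hgoodD
  have hlB : height p q l (B + 1) = p :=
    height_eq_left fun j hj => by have := Finset.mem_Icc.1 (hlw j hj); omega
  have hlA : height p q l A = q :=
    height_eq_right hpq fun j hj => (Finset.mem_Icc.1 (hlw j hj)).1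
  have hDA : ∀ D, hD D A = Q := fun D => by simp only [hDdef, windowBit, if_true]; omega
  have hDB : ∀ D, hD D (B + 1) = P := fun D => by
    simp only [hDdef, windowBit, pathBit, if_true]; rw [if_neg (by omega)]; omega
  have hlmono : ∀ c, height p q l (c + 1) ≤ height p q l c := fun c => by
    have := height_sub_height p q l c; omega
  have hνmono : ∀ c, height p' q' ν (c + 1) ≤ height p' q' ν c := fun c => by
    have := height_sub_height p' q' ν c; omega
  have hdef : ∀ D c, height p q l c - bit (windowBit A B top bot D c) = hD D c := fun _ _ => rfl
  have hheight : ∀ μ ∈ (Finset.Ico P Q).finsupp (fun _ => Finset.Icc A B), good μ →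
      ∀ c ∈ Finset.Icc A (B + 1), height P Q μ c =
        hD ((Finset.Icc (A + 1) B).filter fun c => height P Q μ c = height p q l c - 1) c := by
    intro μ hμ hg c hc
    rw [Finset.mem_finsupp_iff] at hμ
    rw [Finset.mem_Icc] at hc
    rcases eq_or_ne c A with rfl | hcA
    · rw [hDA, height_eq_right hPQ fun j hj => (Finset.mem_Icc.1 (hμ.2 j hj)).1]
    rcases eq_or_ne c (B + 1) with rfl | hcB
    · rw [hDB, height_eq_left fun j hj => by have := Finset.mem_Icc.1 (hμ.2 j hj); omega]
    have hc' : c ∈ Finset.Icc (A + 1) B := Finset.mem_Icc.2 ⟨by omega, by omega⟩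
    simp only [hDdef]
    rw [windowBit_of_mem hc']
    have i1 := hg.1.height_le_height h1 h1' h2 h2' hPQ c
    have i2 := hg.1.height_le_height_add_one h1 h1' h2 h2' hpq c
    by_cases h : height P Q μ c = height p q l c - 1
    · simp [bit, hc', h]
    · simp only [Finset.mem_filter, hc', h, and_false, decide_false, bit, cond_false]; omega
  have hL : ∀ μ ∈ (Finset.Ico P Q).finsupp (fun _ => Finset.Icc A B), ¬ good μ →
      stepTerm t (Finset.Ico p q) (Finset.Ico P Q) l μ *
        stepTerm t (Finset.Ico P Q) (Finset.Ico p' q') μ ν *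
        ∏ c ∈ Finset.Icc A B, φ c (height P Q μ (c + 1)) (height P Q μ c) = 0 := by
    intro μ _ hg
    rcases not_and_or.1 hg with h | h
    · rw [stepTerm, if_neg h, zero_mul, zero_mul]
    · rw [stepTerm, stepTerm, if_neg h, mul_zero, zero_mul]
  have hR : ∀ D ∈ (Finset.Icc (A + 1) B).powerset, ¬ goodD D → ∏ c ∈ Finset.Icc A B,
      (vertexWeight t (height p q l c - height p q l (c + 1))
        (height p q l (c + 1) - height p' q' ν (c + 1)) (height p q l c - height p' q' ν c)
        (windowBit A B top bot D (c + 1)) (windowBit A B top bot D c) *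
      φ c (height p q l (c + 1) - bit (windowBit A B top bot D (c + 1)))
        (height p q l c - bit (windowBit A B top bot D c))) = 0 := by
    intro D _ hg
    simp only [hgoodD] at hg
    push Not at hg
    obtain ⟨c, hc, hg⟩ := hg
    refine Finset.prod_eq_zero hc ?_
    rw [mul_eq_zero]; left
    have b1 := bit_nonneg (windowBit A B top bot D c)
    have b2 := bit_le_one (windowBit A B top bot D c)
    have b3 := bit_nonneg (windowBit A B top bot D (c + 1))
    have b4 := bit_le_one (windowBit A B top bot D (c + 1))
    have m1 := hlmono c
    have m2 := hνmono c
    simp only [hDdef] at hg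
    rw [vertexWeight]
    split_ifs with i1 i2 i3 i3
    · omega
    · omega
    -- The sets `D` also include paths for which the height of the middle row would grow with the
    -- level. There the growth condition for the lower row holds with exponent 0, and `1 - t ^ 0 =
    -- 0` removes the path.
    · have : (height p q l c - height p q l (c + 1) - (height p q l c - height p' q' ν c) +
          (height p q l (c + 1) - height p' q' ν (c + 1))).toNat = 0 := by
        by_contra hne
        have := hg (by omega) (by omega)
        omega
      rw [this]; simp
    · exfalso
      have := hg (by omega) (by omega)
      omega
    · rfl
  rw [← Finset.sum_filter_of_ne (p := good) fun μ hμ h => by_contra fun hn => h (hL μ hμ hn),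
    ← Finset.sum_filter_of_ne (p := goodD) fun D hD h => by_contra fun hn => h (hR D hD hn)]
  refine Finset.sum_nbij
    (fun μ => (Finset.Icc (A + 1) B).filter fun c => height P Q μ c = height p q l c - 1)
    ?_ ?_ ?_ ?_
  · intro μ hμ
    rw [Finset.mem_filter] at hμ ⊢
    refine ⟨Finset.mem_powerset.2 (Finset.filter_subset _ _), fun c hc => ?_⟩
    rw [Finset.mem_Icc] at hc
    rw [← hheight μ hμ.1 hμ.2 c (Finset.mem_Icc.2 ⟨by omega, by omega⟩),
      ← hheight μ hμ.1 hμ.2 (c + 1) (Finset.mem_Icc.2 ⟨by omega, by omega⟩)]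
    have := height_sub_height P Q μ c
    exact ⟨by omega,
      ⟨hμ.2.2.height_le_height h3 h3' h4 h4' hpq' _,
        hμ.2.2.height_le_height_add_one h3 h3' h4 h4' hPQ _⟩,
      hμ.2.2.height_le_height h3 h3' h4 h4' hpq' _,
      hμ.2.2.height_le_height_add_one h3 h3' h4 h4' hPQ _⟩
  · intro μ hμ μ' hμ' heq
    rw [Finset.mem_coe, Finset.mem_filter] at hμ hμ'
    have k1 := (Finset.mem_finsupp_iff.1 hμ.1)
    have k2 := (Finset.mem_finsupp_iff.1 hμ'.1)
    ext j
    by_cases hj : j ∈ Finset.Ico P Q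
    · refine eq_of_height_eq (hμ.2.1.antitoneOn_bottom h1' h2)
        (hμ'.2.1.antitoneOn_bottom h1' h2) k1.2 k2.2 (fun c hc => ?_) hj
      rw [Finset.mem_Icc] at hc
      have hc' : c ∈ Finset.Icc A (B + 1) := Finset.mem_Icc.2 ⟨by omega, by omega⟩
      rw [hheight μ hμ.1 hμ.2 c hc', hheight μ' hμ'.1 hμ'.2 c hc']
      exact congrArg (fun D => hD D c) heq
    · rw [Finsupp.notMem_support_iff.1 fun h => hj (k1.1 h),
        Finsupp.notMem_support_iff.1 fun h => hj (k2.1 h)]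
  · intro D hDm
    rw [Finset.mem_coe, Finset.mem_filter, Finset.mem_powerset] at hDm
    obtain ⟨hDs, hDg⟩ := hDm
    set μ : ℤ →₀ ℤ := Finsupp.onFinset (Finset.Ico P Q)
      (fun j => if j ∈ Finset.Ico P Q then rowOfHeight A B (hD D) j else 0)
      (fun j hj => by by_contra h; simp [h] at hj) with hμdef
    have hμj : ∀ j ∈ Finset.Ico P Q, μ j = rowOfHeight A B (hD D) j := fun j hj => by
      rw [hμdef, Finsupp.onFinset_apply, if_pos hj]
    have hμh : ∀ c ∈ Finset.Icc A (B + 1), height P Q μ c = hD D c := fun c hc => by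
      rw [← height_rowOfHeight (p := P) (q := Q) hAB (fun c hc => (hDg c hc).1) (hDA D) (hDB D) hc]
      unfold height
      congr 3
      exact Finset.filter_congr fun j hj => by rw [hμj j hj]
    have hμbox : μ ∈ (Finset.Ico P Q).finsupp (fun _ => Finset.Icc A B) := by
      rw [Finset.mem_finsupp_iff]
      refine ⟨Finsupp.support_onFinset_subset, fun j hj => ?_⟩
      rw [hμj j hj]
      exact rowOfHeight_mem A B hAB _ _
    have hμw := (Finset.mem_finsupp_iff.1 hμbox).2
    have hμanti : AntitoneOn μ (Set.Ico P Q) := by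
      intro j hj k hk hjk
      rw [hμj j (Finset.mem_Ico.2 hj), hμj k (Finset.mem_Ico.2 hk)]
      unfold rowOfHeight
      gcongr with c
    have hsub : ∀ c ∈ Finset.Icc A B, c ∈ Finset.Icc A (B + 1) := fun c hc => by
      rw [Finset.mem_Icc] at hc ⊢; omega
    have b1 := fun c => bit_nonneg (windowBit A B top bot D c)
    have b2 := fun c => bit_le_one (windowBit A B top bot D c)
    have hg : good μ := by
      refine ⟨interlace_of_height hl hμanti (fun j hj => ?_) fun j hj => ?_,
        interlace_of_height hμanti hν (fun j hj => ?_) fun j hj => ?_⟩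
      · rw [hμh _ (hsub _ (hμw j hj))]
        have := b1 (μ j); simp only [hDdef]; omega
      · rw [hμh _ (hsub _ (hlw j hj))]
        have := b2 (l j); simp only [hDdef]; omega
      · rw [hμh _ (hsub _ (hνw j hj))]
        exact (hDg _ (hνw j hj)).2.2.1
      · rw [hμh _ (hsub _ (hμw j hj))]
        exact (hDg _ (hμw j hj)).2.2.2
    refine ⟨μ, Finset.mem_coe.2 (Finset.mem_filter.2 ⟨hμbox, hg⟩), ?_⟩
    ext c
    simp only [Finset.mem_filter]
    constructor
    · rintro ⟨hc, hh⟩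
      rw [hμh c (by rw [Finset.mem_Icc] at hc ⊢; omega)] at hh
      simp only [hDdef] at hh
      rw [windowBit_of_mem hc] at hh
      by_contra hcD
      simp only [bit, hcD, decide_false, cond_false] at hh
      omega
    · intro hcD
      have hc := hDs hcD
      refine ⟨hc, ?_⟩
      rw [hμh c (by rw [Finset.mem_Icc] at hc ⊢; omega)]
      simp only [hDdef]
      rw [windowBit_of_mem hc]
      simp [bit, hcD]
  · intro μ hμ
    rw [Finset.mem_filter] at hμ
    have hh := hheight μ hμ.1 hμ.2
    generalize ((Finset.Icc (A + 1) B).filter fun c => height P Q μ c = height p q l c - 1) = D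
      at hh ⊢
    have hw := (Finset.mem_finsupp_iff.1 hμ.1).2
    rw [stepTerm, stepTerm, if_pos hμ.2.1, if_pos hμ.2.2, stepWeight_eq_prod_height t hw,
      stepWeight_eq_prod_height t hνw, ← Finset.prod_mul_distrib, ← Finset.prod_mul_distrib]
    refine Finset.prod_congr rfl fun c hc => ?_
    rw [Finset.mem_Icc] at hc
    have e1 := hh c (Finset.mem_Icc.2 ⟨by omega, by omega⟩)
    have e2 := hh (c + 1) (Finset.mem_Icc.2 ⟨by omega, by omega⟩)
    have i1 := hμ.2.2.height_le_height h3 h3' h4 h4' hpq' c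
    have i2 := hμ.2.2.height_le_height_add_one h3 h3' h4 h4' hPQ c
    have i3 := hμ.2.2.height_le_height h3 h3' h4 h4' hpq' (c + 1)
    have i4 := hμ.2.2.height_le_height_add_one h3 h3' h4 h4' hPQ (c + 1)
    rw [hdef, hdef, ← e1, ← e2]
    congr 1
    exact ite_mul_ite_eq_vertexWeight t e1 e2 i1 i2 i3 i4

end Kernel

/-! ### Row sums as path sums and the passage of the R-matrix -/

section KernelSwap

variable {K : Type*} [Field K]

/-- The boundary factor that turns a sum over the window `A, …, B` into a regularized sum. -/
def edgeFactor (z : K) (A B u : ℤ) : K :=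
  (if A < u then 1 else 0) - z * if u < B then 1 else 0

/-- The sum over the row `P ≤ j < Q` between the rows `p ≤ j < q` and `p' ≤ j < q'`, computed in
the window `A, …, B`. -/
noncomputable def rowSum (t z : K) (p q P Q p' q' A B : ℤ) (l ν : ℤ → ℤ) : K :=
  ∑ μ ∈ (Finset.Ico P Q).finsupp (fun _ => Finset.Icc A B),
    stepTerm t (Finset.Ico p q) (Finset.Ico P Q) l μ *
      stepTerm t (Finset.Ico P Q) (Finset.Ico p' q') μ ν *
      (z ^ (∑ j ∈ Finset.Ico P Q, μ j) * ∏ j ∈ Finset.Ico P Q, edgeFactor z A B (μ j))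

/-- Adjacent entries of either outer row are separated by an entry of the middle row, so no middle
row fits unless both outer rows decrease. -/
theorem rowSum_eq_zero (t z : K) {p q P Q p' q' A B : ℤ} (h1 : P ≤ p) (h2' : q ≤ Q + 1)
    (h3' : P ≤ p' + 1) (h4 : q' ≤ Q) {l ν : ℤ → ℤ}
    (h : ¬ (AntitoneOn l (Set.Ico p q) ∧ AntitoneOn ν (Set.Ico p' q'))) :
    rowSum t z p q P Q p' q' A B l ν = 0 := by
  refine Finset.sum_eq_zero fun μ _ => ?_
  rcases not_and_or.1 h with h | h
  · rw [stepTerm, if_neg fun hi => h (hi.antitoneOn_top h1 h2'), zero_mul, zero_mul]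
  · rw [mul_assoc, mul_left_comm, stepTerm, if_neg fun hi => h (hi.antitoneOn_bottom h3' h4),
      zero_mul]

theorem zpow_finset_sum₀ {ι : Type*} {z : K} (hz : z ≠ 0) (J : Finset ι) (f : ι → ℤ) :
    z ^ (∑ j ∈ J, f j) = ∏ j ∈ J, z ^ f j := by
  classical
  induction J using Finset.induction_on with
  | empty => simp
  | insert k J hk ih => rw [Finset.sum_insert hk, Finset.prod_insert hk, zpow_add₀ hz, ih]

theorem Icc_eq_insert_Icc {A B : ℤ} (hAB : A ≤ B) :
    Finset.Icc A B = insert A (Finset.Icc (A + 1) B) := by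
  ext c; simp only [Finset.mem_insert, Finset.mem_Icc]; omega

/-- Multiplicative layer-cake summation. All entries reach level `A`, so this level is accounted for
by the prefactor. -/
theorem zpow_sum_row {z : K} (hz : z ≠ 0) {P Q A B : ℤ} (hPQ : P ≤ Q) (hAB : A ≤ B) {μ : ℤ → ℤ}
    (hμ : ∀ j ∈ Finset.Ico P Q, μ j ∈ Finset.Icc A B) :
    z ^ (∑ j ∈ Finset.Ico P Q, μ j) = z ^ (A * (Q - P)) *
      ∏ c ∈ Finset.Icc A B, if c = A then 1 else z ^ (height P Q μ c - P) := by
  rw [sum_eq_sum_height hPQ fun j hj => Finset.mem_Icc.1 (hμ j hj), zpow_add₀ hz,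
    Icc_eq_insert_Icc hAB, Finset.prod_insert (by simp), if_pos rfl, one_mul, zpow_finset_sum₀ hz]
  congr 1
  refine Finset.prod_congr rfl fun c hc => ?_
  rw [Finset.mem_Icc] at hc
  rw [if_neg (by omega)]

/-- Inside the window the edge factor is `1 - z`. Normalized by it, only the levels `A` and `B`
carry nontrivial factors, and the interior steps acquire the form required by the Yang–Baxter
equation. -/
theorem prod_edgeFactor {z : K} (hz : z ≠ 1) {P Q A B : ℤ} {μ : ℤ → ℤ}
    (hμ : ∀ j ∈ Finset.Ico P Q, μ j ∈ Finset.Icc A B) :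
    ∏ j ∈ Finset.Ico P Q, edgeFactor z A B (μ j) = (1 - z) ^ (Q - P).toNat *
      ∏ c ∈ Finset.Icc A B, (edgeFactor z A B c / (1 - z)) ^
        (height P Q μ c - height P Q μ (c + 1)).toNat := by
  have hz' : 1 - z ≠ 0 := sub_ne_zero.2 hz.symm
  have h1 : ∏ c ∈ Finset.Icc A B, (edgeFactor z A B c / (1 - z)) ^
        (height P Q μ c - height P Q μ (c + 1)).toNat =
      ∏ j ∈ Finset.Ico P Q, edgeFactor z A B (μ j) / (1 - z) := by
    rw [← Finset.prod_fiberwise_of_maps_to hμ]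
    refine Finset.prod_congr rfl fun c _ => ?_
    rw [height_sub_height, Int.toNat_natCast, mult]
    rw [Finset.prod_congr rfl (g := fun _ => edgeFactor z A B c / (1 - z)), Finset.prod_const]
    intro j hj
    rw [(Finset.mem_filter.1 hj).2]
  rw [h1, Finset.prod_div_distrib, Finset.prod_const, Int.card_Ico]
  field_simp

theorem sum_paths_eq_pathSum (w : ℤ → Bool → Bool → K) {A B : ℤ} (hAB : A ≤ B) (top bot : Bool) :
    ∑ D ∈ (Finset.Icc (A + 1) B).powerset, ∏ c ∈ Finset.Icc A B,
      w c (windowBit A B top bot D (c + 1)) (windowBit A B top bot D c) =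
    ∑ x, pathSum w B top (B - A).toNat x * w A x bot := by
  have e : B + 1 - ((B - A).toNat : ℤ) = A + 1 := by omega
  simp only [pathSum_eq, e, Finset.sum_mul]
  rw [Finset.sum_comm]
  refine Finset.sum_congr rfl fun D _ => ?_
  rw [Icc_eq_insert_Icc hAB, Finset.prod_insert (by simp)]
  have h1 : windowBit A B top bot D A = bot := by simp [windowBit]
  have h2 : ∀ c, A + 1 ≤ c → windowBit A B top bot D c = pathBit B top D c := fun c hc => by
    rw [windowBit, if_neg (by omega)]
  rw [h1, h2 _ le_rfl]
  have h3 : ∏ c ∈ Finset.Icc (A + 1) B,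
        w c (windowBit A B top bot D (c + 1)) (windowBit A B top bot D c) =
      ∏ c ∈ Finset.Icc (A + 1) B, w c (pathBit B top D (c + 1)) (pathBit B top D c) := by
    refine Finset.prod_congr rfl fun c hc => ?_
    rw [Finset.mem_Icc] at hc
    rw [h2 c hc.1, h2 (c + 1) (by omega)]
  rw [h3]
  simp only [ite_mul, zero_mul]
  rw [Finset.sum_ite_eq, if_pos (Finset.mem_univ _), mul_comm]

/-- The R-matrix is created at the upper end by `htop` and carried down one level at a time by
`yangBaxter`. The induction starts after one step because level `B` has its own edge factor. -/
theorem pathSum_intertwine {t z κ : K} (hz : z ≠ 0) {B : ℤ} {N : ℕ} {u d : ℤ → ℤ}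
    {stepL stepR : ℤ → Bool → Bool → K} {topL topR : Bool}
    (hu : ∀ c, u (c + 1) ≤ u c) (g : ℤ → K)
    (hL : ∀ c, B - N < c → c < B → ∀ x' x, stepL c x' x =
      g c * (vertexWeight t (u c - u (c + 1)) (d (c + 1)) (d c) x' x * z ^ (-bit x)))
    (hR : ∀ c, B - N < c → c < B → ∀ x' x, stepR c x' x =
      g c * (vertexWeight t (u c - u (c + 1)) (d (c + 1)) (d c) x' x * z ^ (bit x - d c)))
    (htop : ∀ x, κ * stepL B topL x = ∑ y, stepR B topR y * rMatrix t z (d B) y x)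
    (n : ℕ) (hn : 1 ≤ n) (hnN : n ≤ N) (x : Bool) :
    κ * pathSum stepL B topL n x =
      ∑ y, pathSum stepR B topR n y * rMatrix t z (d (B + 1 - n)) y x := by
  induction n, hn using Nat.le_induction generalizing x with
  | base =>
    have e : B + 1 - ((1 : ℕ) : ℤ) = B := by push_cast; ring
    simp only [pathSum, e, Nat.cast_zero, sub_zero, ite_mul, one_mul, zero_mul, Finset.sum_ite_eq',
      Finset.mem_univ, if_true]
    exact htop x
  | succ n hn ih =>
    have ih' := fun x => ih (by omega) x
    have e : B + 1 - ((n + 1 : ℕ) : ℤ) = B - n := by push_cast; ring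
    have e2 : B + 1 - (n : ℤ) = B - n + 1 := by ring
    rw [e2] at ih'
    have h1 : ∀ x', stepL (B - n) x' x = _ := fun x' => hL (B - n) (by omega) (by omega) x' x
    have h2 : ∀ x' x, stepR (B - n) x' x = _ := hR (B - n) (by omega) (by omega)
    have yb := fun x' => yangBaxter t z hz (sub_nonneg.2 (hu (B - n))) (d' := d (B - n + 1))
      (d := d (B - n)) x' x
    rw [e, pathSum, Finset.mul_sum]
    simp only [pathSum, ← mul_assoc, ih']
    simp only [Fintype.sum_bool] at yb ⊢
    simp only [h1, h2]
    have y1 := yb true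
    have y2 := yb false
    linear_combination (g (B - n) * pathSum stepR B topR n true) * y1 +
      (g (B - n) * pathSum stepR B topR n false) * y2

/-- The free function `ψ` allows a product over levels to be merged into the steps; it will carry
the powers of `z` coming from the sums of the two outer rows. -/
theorem rowSum_eq_pathSum (t : K) {z : K} (hz : z ≠ 0) (hz1 : z ≠ 1) {p q P Q p' q' A B : ℤ}
    (hpq : p ≤ q) (hPQ : P ≤ Q) (hpq' : p' ≤ q') (h1 : P ≤ p) (h1' : p ≤ P + 1) (h2 : Q ≤ q)
    (h2' : q ≤ Q + 1) (h3 : p' ≤ P) (h3' : P ≤ p' + 1) (h4 : q' ≤ Q) (h4' : Q ≤ q' + 1)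
    (hAB : A ≤ B) {top bot : Bool} (htop : bit top = p - P) (hbot : bit bot = q - Q)
    {l ν : ℤ → ℤ} (hl : AntitoneOn l (Set.Ico p q)) (hν : AntitoneOn ν (Set.Ico p' q'))
    (hlw : ∀ j ∈ Finset.Ico p q, l j ∈ Finset.Icc A B)
    (hνw : ∀ j ∈ Finset.Ico p' q', ν j ∈ Finset.Icc A B) (ψ : ℤ → K) :
    (∏ c ∈ Finset.Icc A B, ψ c) * rowSum t z p q P Q p' q' A B l ν =
      z ^ (A * (Q - P)) * (1 - z) ^ (Q - P).toNat *
      ∑ x, pathSum (fun c x' x =>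
        vertexWeight t (height p q l c - height p q l (c + 1))
        (height p q l (c + 1) - height p' q' ν (c + 1)) (height p q l c - height p' q' ν c) x' x *
        (ψ c * (if c = A then 1 else z ^ (height p q l c - bit x - P)) *
          (edgeFactor z A B c / (1 - z)) ^
            (height p q l c - bit x - (height p q l (c + 1) - bit x')).toNat))
          B top (B - A).toNat x *
        (vertexWeight t (height p q l A - height p q l (A + 1))
        (height p q l (A + 1) - height p' q' ν (A + 1)) (height p q l A - height p' q' ν A) x bot *
        (ψ A * (edgeFactor z A B A / (1 - z)) ^
            (height p q l A - bit bot - (height p q l (A + 1) - bit x)).toNat)) := by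
  have key := sum_rows_eq_sum_paths t hpq hPQ hpq' h1 h1' h2 h2' h3 h3' h4 h4' hAB htop hbot hl hν
    hlw hνw (fun c h' h => ψ c * (if c = A then 1 else z ^ (h - P)) *
      (edgeFactor z A B c / (1 - z)) ^ (h - h').toNat)
  have key2 := sum_paths_eq_pathSum (fun c x' x =>
        vertexWeight t (height p q l c - height p q l (c + 1))
        (height p q l (c + 1) - height p' q' ν (c + 1)) (height p q l c - height p' q' ν c) x' x *
        (ψ c * (if c = A then 1 else z ^ (height p q l c - bit x - P)) *
          (edgeFactor z A B c / (1 - z)) ^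
            (height p q l c - bit x - (height p q l (c + 1) - bit x')).toNat)) hAB top bot
  simp only [if_true, mul_one] at key2
  rw [← key2, ← key, rowSum, Finset.mul_sum, Finset.mul_sum]
  refine Finset.sum_congr rfl fun μ hμ => ?_
  have hμw := (Finset.mem_finsupp_iff.1 hμ).2
  rw [zpow_sum_row hz hPQ hAB hμw, prod_edgeFactor hz1 hμw]
  simp only [Finset.prod_mul_distrib]
  ring

end KernelSwap

/-! ### Moving a growth step past a row -/

section KernelSwap

variable {K : Type*} [Field K]

/-- Sums over a row behind a growth step can be expressed in terms of sums over a row where the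
growth step has been moved down. -/
theorem rowSum_swap (t z : K) (hz : z ≠ 0) (hz1 : z ≠ 1) (htz : t * z ≠ 1) (p q : ℤ) (α β : Bool)
    (hpq : p ≤ q) (hPQ : p - bit α ≤ q - bit β) :
    ∃ κ c : K, κ ≠ 0 ∧ ∀ (A B : ℤ) (l ν : ℤ → ℤ), A < B →
      (∀ j ∈ Finset.Ico p q, l j ∈ Finset.Ioo A B) →
      (∀ j ∈ Finset.Ico (p - 1 - bit α) (q - bit β), ν j ∈ Finset.Ioo A B) →
      κ * rowSum t z p q (p - 1) q (p - 1 - bit α) (q - bit β) A B l ν =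
        c * (z ^ (∑ j ∈ Finset.Ico p q, l j +
            ∑ j ∈ Finset.Ico (p - 1 - bit α) (q - bit β), ν j) *
          rowSum t z⁻¹ p q (p - bit α) (q - bit β) (p - 1 - bit α) (q - bit β) A B l ν) := by
  have hz' : 1 - z ≠ 0 := sub_ne_zero.2 hz1.symm
  have htz' : 1 - t * z ≠ 0 := sub_ne_zero.2 htz.symm
  have hzi : z⁻¹ ≠ 1 := fun h => hz1 (inv_eq_one.1 h)
  have hzi' : 1 - z⁻¹ ≠ 0 := sub_ne_zero.2 hzi.symm
  have a0 := bit_nonneg α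
  have a1 := bit_le_one α
  have b0 := bit_nonneg β
  have b1 := bit_le_one β
  -- The constants come from the two ends of the window. The gap of the outer rows is `1 + bit α` at
  -- the upper end and `bit β` at the lower end; where it is 2 or 0 the R-matrix is the scalar `1 -
  -- t * z`. The constant `c₀` may vanish, since only `κ` has to be cancelled later.
  set c₀ : K := cond β ((t - z) * (1 - t * z) / (1 - z)) (1 - t * z) with hc₀
  refine ⟨cond α (1 - t * z) (1 - z), c₀ * (1 - z) ^ (q - (p - 1)).toNat /
    (1 - z⁻¹) ^ (q - bit β - (p - bit α)).toNat, by cases α <;> assumption, ?_⟩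
  intro A B l ν hAB hl hν
  by_cases hanti : AntitoneOn l (Set.Ico p q) ∧
      AntitoneOn ν (Set.Ico (p - 1 - bit α) (q - bit β))
  swap
  · rw [rowSum_eq_zero t z (by omega) (by omega) (by omega) (by omega) hanti,
      rowSum_eq_zero t z⁻¹ (by omega) (by omega) (by omega) (by omega) hanti]
    simp
  obtain ⟨hla, hνa⟩ := hanti
  have hlw : ∀ j ∈ Finset.Ico p q, l j ∈ Finset.Icc A B := fun j hj =>
    Finset.Ioo_subset_Icc_self (hl j hj)
  have hνw : ∀ j ∈ Finset.Ico (p - 1 - bit α) (q - bit β), ν j ∈ Finset.Icc A B := fun j hj =>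
    Finset.Ioo_subset_Icc_self (hν j hj)
  -- The longer row starts one index before `l` and ends with it, hence the boundary bits `true` and
  -- `false`; the replacing row has `α` and `β`.
  have eL := rowSum_eq_pathSum t hz hz1 (P := p - 1) (Q := q) hpq (by omega)
    (by omega : p - 1 - bit α ≤ q - bit β) (by omega) (by omega) le_rfl (by omega) (by omega)
    (by omega) (by omega) (by omega) hAB.le (top := true) (bot := false) (by simp [bit])
    (by simp [bit]) hla hνa hlw hνw (fun _ => 1)
  have eR := rowSum_eq_pathSum t (inv_ne_zero hz) hzi (P := p - bit α) (Q := q - bit β) hpq hPQ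
    (by omega : p - 1 - bit α ≤ q - bit β) (by omega) (by omega) (by omega) (by omega) (by omega)
    (by omega) (by omega) (by omega) hAB.le (top := α) (bot := β) (by omega)
    (by omega) hla hνa hlw hνw
    (fun c => (if c = A then 1 else z ^ (height p q l c - p)) *
      if c = A then 1 else z ^ (height (p - 1 - bit α) (q - bit β) ν c - (p - 1 - bit α)))
  have s1 := zpow_sum_row hz hpq hAB.le hlw
  have s2 := zpow_sum_row hz (by omega) hAB.le hνw
  rw [Finset.prod_mul_distrib] at eR
  rw [Finset.prod_const_one, one_mul] at eL
  -- The outer rows lie strictly inside the window, so their heights are constant from `A` to `A +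
  -- 1` and from `B` to `B + 1`, and the end steps are explicit.
  have lB : ∀ c, B ≤ c → height p q l c = p := fun c hc => height_eq_left fun j hj => by
    have := Finset.mem_Ioo.1 (hl j hj); omega
  have lA : ∀ c, c ≤ A + 1 → height p q l c = q := fun c hc => height_eq_right hpq fun j hj => by
    have := Finset.mem_Ioo.1 (hl j hj); omega
  have νB : ∀ c, B ≤ c → height (p - 1 - bit α) (q - bit β) ν c = p - 1 - bit α := fun c hc =>
    height_eq_left fun j hj => by have := Finset.mem_Ioo.1 (hν j hj); omega
  have νA : ∀ c, c ≤ A + 1 → height (p - 1 - bit α) (q - bit β) ν c = q - bit β := fun c hc =>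
    height_eq_right (by omega) fun j hj => by have := Finset.mem_Ioo.1 (hν j hj); omega
  set u := height p q l with hu
  set w := height (p - 1 - bit α) (q - bit β) ν with hw
  set stepL : ℤ → Bool → Bool → K := fun c x' x =>
        vertexWeight t (u c - u (c + 1)) (u (c + 1) - w (c + 1)) (u c - w c) x' x *
        (1 * (if c = A then 1 else z ^ (u c - bit x - (p - 1))) *
          (edgeFactor z A B c / (1 - z)) ^ (u c - bit x - (u (c + 1) - bit x')).toNat) with hstepL
  set stepR : ℤ → Bool → Bool → K := fun c x' x =>
        vertexWeight t (u c - u (c + 1)) (u (c + 1) - w (c + 1)) (u c - w c) x' x *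
        (((if c = A then 1 else z ^ (u c - p)) *
          if c = A then 1 else z ^ (w c - (p - 1 - bit α))) *
          (if c = A then 1 else z⁻¹ ^ (u c - bit x - (p - bit α))) *
          (edgeFactor z⁻¹ A B c / (1 - z⁻¹)) ^ (u c - bit x - (u (c + 1) - bit x')).toNat)
    with hstepR
  have hmono : ∀ c, u (c + 1) ≤ u c := fun c => by
    have := height_sub_height p q l c
    rw [← hu] at this
    omega
  have hint : ∀ c, A < c → c < B → edgeFactor z A B c / (1 - z) = 1 ∧
      edgeFactor z⁻¹ A B c / (1 - z⁻¹) = 1 := by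
    intro c h1 h2
    simp only [edgeFactor, h1, h2, if_true, mul_one]
    exact ⟨div_self hz', div_self hzi'⟩
  -- Both families of steps contain `z ^ (u c - p + 1)`. What remains is `z ^ (-bit x)` for the
  -- longer row and `z ^ (bit x - d)` for the other, the two sides of `yangBaxter`.
  have hzpow : ∀ c x, z ^ (u c - p) * z ^ (w c - (p - 1 - bit α)) *
      z⁻¹ ^ (u c - bit x - (p - bit α)) = z ^ (u c - p + 1) * z ^ (bit x - (u c - w c)) := by
    intro c x
    rw [inv_zpow', ← zpow_add₀ hz, ← zpow_add₀ hz, ← zpow_add₀ hz]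
    congr 1; ring
  have hN : ((B - A).toNat : ℤ) = B - A := Int.toNat_of_nonneg (by omega)
  have key := pathSum_intertwine (t := t) (κ := cond α (1 - t * z) (1 - z)) hz (B := B)
    (N := (B - A).toNat) (u := u) (d := fun c => u c - w c) (stepL := stepL) (stepR := stepR)
    (topL := true) (topR := α) hmono (fun c => z ^ (u c - p + 1)) ?_ ?_ ?_ (B - A).toNat
    (by omega) le_rfl
  · rw [hN] at key
    have e : B + 1 - (B - A) = A + 1 := by ring
    simp only [e, lA _ le_rfl, νA _ le_rfl, sub_sub_cancel] at key
    have hz2 : z ^ (∑ j ∈ Finset.Ico p q, l j +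
            ∑ j ∈ Finset.Ico (p - 1 - bit α) (q - bit β), ν j) *
          rowSum t z⁻¹ p q (p - bit α) (q - bit β) (p - 1 - bit α) (q - bit β) A B l ν =
        z ^ (A * (q - p)) * z ^ (A * (q - bit β - (p - 1 - bit α))) *
        (z⁻¹ ^ (A * (q - bit β - (p - bit α))) * (1 - z⁻¹) ^ (q - bit β - (p - bit α)).toNat *
          ∑ x, pathSum stepR B α (B - A).toNat x *
        (vertexWeight t (u A - u (A + 1)) (u (A + 1) - w (A + 1)) (u A - w A) x β *
        (((if A = A then 1 else z ^ (u A - p)) *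
            if A = A then 1 else z ^ (w A - (p - 1 - bit α))) *
          (edgeFactor z⁻¹ A B A / (1 - z⁻¹)) ^
            (u A - bit β - (u (A + 1) - bit x)).toNat))) := by
      rw [← eR, zpow_add₀ hz, s1, s2]; ring
    have hz3 : z ^ (A * (q - p)) * z ^ (A * (q - bit β - (p - 1 - bit α))) *
        z⁻¹ ^ (A * (q - bit β - (p - bit α))) = z ^ (A * (q - (p - 1))) := by
      rw [inv_zpow', ← zpow_add₀ hz, ← zpow_add₀ hz]
      congr 1; ring
    have hbot : cond α (1 - t * z) (1 - z) * ∑ x, pathSum stepL B true (B - A).toNat x *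
        (vertexWeight t (u A - u (A + 1)) (u (A + 1) - w (A + 1)) (u A - w A) x false *
        (1 * (edgeFactor z A B A / (1 - z)) ^
            (u A - bit false - (u (A + 1) - bit x)).toNat)) =
        c₀ * ∑ x, pathSum stepR B α (B - A).toNat x *
        (vertexWeight t (u A - u (A + 1)) (u (A + 1) - w (A + 1)) (u A - w A) x β *
        (((if A = A then 1 else z ^ (u A - p)) *
            if A = A then 1 else z ^ (w A - (p - 1 - bit α))) *
          (edgeFactor z⁻¹ A B A / (1 - z⁻¹)) ^
            (u A - bit β - (u (A + 1) - bit x)).toNat)) := by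
      rw [lA A (by omega), lA _ le_rfl, νA A (by omega), νA _ le_rfl]
      simp only [Fintype.sum_bool] at key ⊢
      have k1 := key true
      have k2 := key false
      have hE : edgeFactor z A B A / (1 - z) = -z / (1 - z) := by simp [edgeFactor, hAB]
      have expand : ∀ k a b v w : K, k * (a * v + b * w) = k * a * v + k * b * w :=
        fun _ _ _ _ _ => by ring
      rw [hE, expand, k1, k2, hc₀]
      cases β
      · simp [vertexWeight, rMatrix, bit]
        ring
      · simp [vertexWeight, rMatrix, bit]
        field_simp
        ring
    rw [eL, hz2]
    have : c₀ * (1 - z) ^ (q - (p - 1)).toNat / (1 - z⁻¹) ^ (q - bit β - (p - bit α)).toNat =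
      c₀ * (1 - z) ^ (q - (p - 1)).toNat * ((1 - z⁻¹) ^ (q - bit β - (p - bit α)).toNat)⁻¹ :=
      div_eq_mul_inv _ _
    rw [this]
    have hne : (1 - z⁻¹) ^ (q - bit β - (p - bit α)).toNat ≠ 0 := pow_ne_zero _ hzi'
    have swap : ∀ k a s : K, k * (a * s) = a * (k * s) := fun _ _ _ => by ring
    rw [swap, hbot, ← hz3]
    generalize (∑ x, pathSum stepR B α (B - A).toNat x * _) = S
    generalize (1 - z⁻¹) ^ (q - bit β - (p - bit α)).toNat = D at hne ⊢
    have cancel : ∀ a b c e f g : K, a * b * c * e * (f * g) =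
        f * e * D⁻¹ * (a * b * (c * D * g)) := fun a b c e f g => by
      rw [show f * e * D⁻¹ * (a * b * (c * D * g)) = a * b * c * e * (f * g) * (D⁻¹ * D) by ring,
        inv_mul_cancel₀ hne, mul_one]
    exact cancel _ _ _ _ _ _
  · intro c h1 h2 x' x
    rw [hN] at h1
    simp only [hstepL]
    rw [(hint c (by omega) h2).1, one_pow, if_neg (by omega), mul_one, one_mul]
    have : u c - bit x - (p - 1) = u c - p + 1 + -bit x := by ring
    rw [this, zpow_add₀ hz]; ring
  · intro c h1 h2 x' x
    rw [hN] at h1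
    simp only [hstepR]
    rw [(hint c (by omega) h2).2, one_pow, if_neg (by omega), if_neg (by omega),
      if_neg (by omega), mul_one, hzpow]
    ring
  · intro x
    have hBA : B ≠ A := by omega
    have hE : edgeFactor z A B B / (1 - z) = 1 / (1 - z) := by simp [edgeFactor, hAB]
    simp only [hstepL, hstepR, hBA, if_false, hzpow, hE]
    simp only [lB B le_rfl, lB (B + 1) (by omega), νB B le_rfl, νB (B + 1) (by omega)]
    have e1 : p - (p - 1 - bit α) = 1 + bit α := by ring
    have e2 : p - bit x - (p - 1) = 1 - bit x := by ring
    have e4 : ∀ y, (p - bit x - (p - bit y)).toNat = (bit y - bit x).toNat := fun y => by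
      congr 1; ring
    simp only [e1, e2, e4, sub_self]
    cases α <;> cases x <;> simp [vertexWeight, rMatrix, bit] <;> field_simp

end KernelSwap

/-! ### Regularized sums over one row -/

section RowWindow

variable {K : Type*} [Field K]

/-- In one coordinate, `f u - z * f (u - 1)` vanishes unless `A < u ≤ B`, and the remaining
differences sum to `∑ f` over `A < u ≤ B` minus `z * ∑ f` over `A ≤ u < B`; this is the origin of
`edgeFactor`. In the induction, `S` consists of the coordinates not yet confined to the window. -/
theorem act_window_aux (z : K) (J : Finset ℤ) {A B : ℤ} (S : Finset ℤ) (hS : S ⊆ J)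
    (f : (ℤ →₀ ℤ) → K) (hJ : ∀ μ, f μ ≠ 0 → μ.support ⊆ J)
    (hbox : ∀ μ, f μ ≠ 0 → ∀ j ∈ J, j ∉ S → μ j ∈ Finset.Icc A B)
    (hf : ∀ μ, ∀ j ∈ S, B ≤ μ j ∨ μ j < A → f (μ + Finsupp.single j 1) = z * f μ) :
    (act (∏ j ∈ S, (1 - AddMonoidAlgebra.single (Finsupp.single j (1 : ℤ)) z)) f).support.Finite ∧
    ∑ᶠ μ, act (∏ j ∈ S, (1 - AddMonoidAlgebra.single (Finsupp.single j (1 : ℤ)) z)) f μ =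
      ∑ μ ∈ J.finsupp (fun _ => Finset.Icc A B), f μ * ∏ j ∈ S, edgeFactor z A B (μ j) := by
  classical
  induction S using Finset.induction_on generalizing f with
  | empty =>
    have hsub : f.support ⊆ ↑(J.finsupp fun _ => Finset.Icc A B) := by
      intro μ hμ
      rw [Finset.mem_coe, Finset.mem_finsupp_iff]
      exact ⟨hJ μ hμ, fun j hj => hbox μ hμ j hj (by simp)⟩
    simp only [Finset.prod_empty, map_one, Module.End.one_apply, mul_one]
    exact ⟨(Finset.finite_toSet _).subset hsub, finsum_eq_sum_of_support_subset _ hsub⟩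
  | insert k S hk ih =>
    have hkJ : k ∈ J := hS (Finset.mem_insert_self _ _)
    set g : (ℤ →₀ ℤ) → K := act (1 - AddMonoidAlgebra.single (Finsupp.single k (1 : ℤ)) z) f
      with hg
    have hgv : ∀ μ, g μ = f μ - z * f (μ - Finsupp.single k 1) := fun μ =>
      act_one_sub_single _ _ _ _
    have hne : ∀ μ, g μ ≠ 0 → f μ ≠ 0 ∨ f (μ - Finsupp.single k 1) ≠ 0 := by
      intro μ hμ
      by_contra! h
      exact hμ (by rw [hgv, h.1, h.2]; simp)
    have hoff : ∀ (μ : ℤ →₀ ℤ) j, j ≠ k → (μ - Finsupp.single k (1 : ℤ)) j = μ j := by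
      intro μ j hj
      simp [hj.symm]
    have hat : ∀ μ : ℤ →₀ ℤ, (μ - Finsupp.single k (1 : ℤ)) k = μ k - 1 := by
      intro μ; simp
    have hgk : ∀ μ, ¬ (A < μ k ∧ μ k ≤ B) → g μ = 0 := by
      intro μ hμ
      have := hf (μ - Finsupp.single k 1) k (Finset.mem_insert_self _ _) (by rw [hat]; omega)
      rw [sub_add_cancel] at this
      rw [hgv, this, sub_self]
    have h := ih (fun j hj => hS (Finset.mem_insert_of_mem hj)) g ?_ ?_ ?_
    · rw [Finset.prod_insert hk, mul_comm, act_mul]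
      refine ⟨h.1, h.2.trans ?_⟩
      set W : (ℤ →₀ ℤ) → K := fun μ => ∏ j ∈ S, edgeFactor z A B (μ j) with hW
      have hWs : ∀ μ, W (μ + Finsupp.single k 1) = W μ := fun μ =>
        Finset.prod_congr rfl fun j hj => by
          have : j ≠ k := fun h => hk (h ▸ hj)
          rw [Finsupp.add_apply, Finsupp.single_apply, if_neg this.symm, add_zero]
      set Y := J.finsupp (fun _ => Finset.Icc A B) with hY
      have e1 : ∑ μ ∈ Y, g μ * W μ = ∑ μ ∈ Y.filter (fun μ => A < μ k), f μ * W μ -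
          z * ∑ μ ∈ Y.filter (fun μ => A < μ k), f (μ - Finsupp.single k 1) * W μ := by
        rw [Finset.mul_sum, ← Finset.sum_sub_distrib, Finset.sum_filter]
        refine Finset.sum_congr rfl fun μ _ => ?_
        split_ifs with hμ
        · rw [hgv]; ring
        · rw [hgk μ (by tauto), zero_mul]
      have e2 : ∑ μ ∈ Y.filter (fun μ => A < μ k), f (μ - Finsupp.single k 1) * W μ =
          ∑ μ ∈ Y.filter (fun μ => μ k < B), f μ * W μ := by
        refine Finset.sum_bij' (fun μ _ => μ - Finsupp.single k 1)
          (fun μ _ => μ + Finsupp.single k 1) ?_ ?_ ?_ ?_ ?_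
        · intro μ hμ
          rw [Finset.mem_filter, hY, Finset.mem_finsupp_iff] at hμ ⊢
          obtain ⟨⟨h1, h2⟩, h3⟩ := hμ
          have hk2 := Finset.mem_Icc.1 (h2 k hkJ)
          refine ⟨⟨fun j hj => ?_, fun j hj => ?_⟩, by rw [hat]; omega⟩
          · by_cases hjk : j = k
            · rwa [hjk]
            · rw [Finsupp.mem_support_iff, hoff _ _ hjk, ← Finsupp.mem_support_iff] at hj
              exact h1 hj
          · by_cases hjk : j = k
            · rw [hjk, hat, Finset.mem_Icc]; omega
            · rw [hoff _ _ hjk]; exact h2 j hj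
        · intro μ hμ
          rw [Finset.mem_filter, hY, Finset.mem_finsupp_iff] at hμ ⊢
          obtain ⟨⟨h1, h2⟩, h3⟩ := hμ
          have hk2 := Finset.mem_Icc.1 (h2 k hkJ)
          have hoff' : ∀ j, j ≠ k → (μ + Finsupp.single k (1 : ℤ)) j = μ j := by
            intro j hj
            simp [hj.symm]
          have hat' : (μ + Finsupp.single k (1 : ℤ)) k = μ k + 1 := by simp
          refine ⟨⟨fun j hj => ?_, fun j hj => ?_⟩, by rw [hat']; omega⟩
          · by_cases hjk : j = k
            · rwa [hjk]
            · rw [Finsupp.mem_support_iff, hoff' _ hjk, ← Finsupp.mem_support_iff] at hj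
              exact h1 hj
          · by_cases hjk : j = k
            · rw [hjk, hat', Finset.mem_Icc]; omega
            · rw [hoff' _ hjk]; exact h2 j hj
        · intro μ _; simp
        · intro μ _; simp
        · intro μ _
          rw [← hWs (μ - Finsupp.single k 1), sub_add_cancel]
      rw [e1, e2, Finset.sum_filter, Finset.sum_filter, Finset.mul_sum, ← Finset.sum_sub_distrib]
      refine Finset.sum_congr rfl fun μ _ => ?_
      rw [Finset.prod_insert hk, edgeFactor]
      split_ifs <;> ring
    · intro μ hμ
      rcases hne μ hμ with h | h
      · exact hJ μ h
      · intro j hj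
        by_cases hjk : j = k
        · rwa [hjk]
        · refine hJ _ h ?_
          rwa [Finsupp.mem_support_iff, hoff _ _ hjk, ← Finsupp.mem_support_iff]
    · intro μ hμ j hj hjS
      by_cases hjk : j = k
      · subst hjk
        by_contra hcon
        rw [Finset.mem_Icc] at hcon
        exact hμ (hgk μ (by omega))
      · rcases hne μ hμ with h | h
        · exact hbox μ h j hj (by simp [hjk, hjS])
        · rw [← hoff μ j hjk]; exact hbox _ h j hj (by simp [hjk, hjS])
    · intro μ j hj hμj
      have hjk : j ≠ k := fun h => hk (h ▸ hj)
      rw [hgv, hgv, hf μ j (Finset.mem_insert_of_mem hj) hμj, add_sub_right_comm,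
        hf (μ - Finsupp.single k 1) j (Finset.mem_insert_of_mem hj) (by rwa [hoff _ _ hjk])]
      ring

/-- The regularized sum of a function that is quasi-periodic in every coordinate outside a window
is a finite sum over the window. -/
theorem act_window (z : K) (J : Finset ℤ) {A B : ℤ} (f : (ℤ →₀ ℤ) → K)
    (hJ : ∀ μ, f μ ≠ 0 → μ.support ⊆ J)
    (hf : ∀ μ, ∀ j ∈ J, B ≤ μ j ∨ μ j < A → f (μ + Finsupp.single j 1) = z * f μ) :
    (act (∏ j ∈ J, (1 - AddMonoidAlgebra.single (Finsupp.single j (1 : ℤ)) z)) f).support.Finite ∧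
    ∑ᶠ μ, act (∏ j ∈ J, (1 - AddMonoidAlgebra.single (Finsupp.single j (1 : ℤ)) z)) f μ =
      ∑ μ ∈ J.finsupp (fun _ => Finset.Icc A B), f μ * ∏ j ∈ J, edgeFactor z A B (μ j) :=
  act_window_aux z J J subset_rfl f hJ (fun _ _ _ hj hj' => (hj' hj).elim) hf

/-- Moving an entry that lies outside of a window containing the two neighbouring rows does not
change the weight. -/
theorem stepTerm_mul_stepTerm_shift (t : K) {p q P Q A B : ℤ} (J' : Finset ℤ) (hP : p ≤ P + 1)
    (hQ : Q ≤ q) {l ν μ μ' : ℤ → ℤ} (hl : ∀ j ∈ Finset.Ico p q, l j ∈ Finset.Ioo A B)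
    (hν : ∀ j ∈ J', ν j ∈ Finset.Ioo A B) {j : ℤ} (hj : j ∈ Finset.Ico P Q)
    (hμ : B ≤ μ j ∨ μ j < A) (hj' : μ' j = μ j + 1) (hne : ∀ k, k ≠ j → μ' k = μ k) :
    stepTerm t (Finset.Ico p q) (Finset.Ico P Q) l μ' * stepTerm t (Finset.Ico P Q) J' μ' ν =
      stepTerm t (Finset.Ico p q) (Finset.Ico P Q) l μ * stepTerm t (Finset.Ico P Q) J' μ ν := by
  classical
  simp only [Finset.mem_Ico, Finset.mem_Ioo] at hl hj
  simp only [Finset.mem_Ioo] at hν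
  -- With two entries on the same side, interlacing with `l` fails before and after the move. A
  -- single entry outside keeps its order relation to all others. On the lower side the second entry
  -- is compared with `A` inclusively, because the moved entry may land on `A`.
  by_cases hcon : ∃ k ∈ Finset.Ico P Q, k ≠ j ∧ (B ≤ μ j ∧ B ≤ μ k ∨ μ j < A ∧ μ k ≤ A)
  · obtain ⟨k, hk, hkj, hcon⟩ := hcon
    rw [Finset.mem_Ico] at hk
    have h0 : ∀ m : ℤ → ℤ, (B ≤ m j ∧ B ≤ m k ∨ m j ≤ A ∧ m k ≤ A) →
        stepTerm t (Finset.Ico p q) (Finset.Ico P Q) l m = 0 := by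
      intro m hm
      refine if_neg fun hi => ?_
      simp only [Interlace, Finset.mem_Ico] at hi
      rcases hm with hm | hm
      · rcases lt_or_gt_of_ne hkj with h | h
        · have := (hi j hj).1 (by omega)
          have := hl j (by omega)
          omega
        · have := (hi k hk).1 (by omega)
          have := hl k (by omega)
          omega
      · rcases lt_or_gt_of_ne hkj with h | h
        · have := (hi k hk).2 (by omega)
          have := hl (k + 1) (by omega)
          omega
        · have := (hi j hj).2 (by omega)
          have := hl (j + 1) (by omega)
          omega
    rw [h0 μ (by omega), h0 μ' (by rw [hj', hne k hkj]; omega), zero_mul, zero_mul]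
  · push Not at hcon
    have hother : ∀ k ∈ Finset.Ico P Q, k ≠ j → (B ≤ μ j → μ k < B) ∧ (μ j < A → A < μ k) :=
      fun k hk hkj => ⟨(hcon k hk hkj).1, (hcon k hk hkj).2⟩
    have hcase : ∀ k, (k = j ∧ μ' k = μ k + 1) ∨ (k ≠ j ∧ μ' k = μ k) := fun k => by
      by_cases hk : k = j
      · subst hk; exact Or.inl ⟨rfl, hj'⟩
      · exact Or.inr ⟨hk, hne k hk⟩
    have hkj : ∀ k ∈ Finset.Ico P Q, (k = j ∧ μ' k = μ j + 1 ∧ μ k = μ j) ∨ (μ' k = μ k ∧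
        (B ≤ μ j → μ k < B) ∧ (μ j < A → A < μ k)) := fun k hk => by
      rcases hcase k with ⟨h, h'⟩ | ⟨h, h'⟩
      · subst h; exact Or.inl ⟨rfl, h', rfl⟩
      · exact Or.inr ⟨h', hother k hk h⟩
    congr 1
    · refine stepTerm_congr t ?_ ?_ ?_
      · intro k hk k' hk'
        have := hkj k hk
        have := hkj k' hk'
        omega
      · intro i hi k hk
        have := hkj k hk
        have := hl i (Finset.mem_Ico.1 hi)
        omega
      · intro i hi k hk
        have := hkj k hk
        have := hl i (Finset.mem_Ico.1 hi)
        omega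
    · refine stepTerm_congr t ?_ ?_ ?_
      · intro k hk k' hk'; rfl
      · intro k hk i hi
        have := hkj k hk
        have := hν i hi
        omega
      · intro k hk i hi
        have := hkj k hk
        have := hν i hi
        omega

theorem act_row_window (t z : K) (hz : z ≠ 0) {p q P Q p' q' A B : ℤ} (hP : p ≤ P + 1)
    (hQ : Q ≤ q) {l ν : ℤ → ℤ} (hl : ∀ j ∈ Finset.Ico p q, l j ∈ Finset.Ioo A B)
    (hν : ∀ j ∈ Finset.Ico p' q', ν j ∈ Finset.Ioo A B) (C : K) (f : (ℤ →₀ ℤ) → K)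
    (hf0 : ∀ μ, ¬ μ.support ⊆ Finset.Ico P Q → f μ = 0)
    (hf : ∀ μ : ℤ →₀ ℤ, μ.support ⊆ Finset.Ico P Q →
      f μ = C * (stepTerm t (Finset.Ico p q) (Finset.Ico P Q) l μ *
        stepTerm t (Finset.Ico P Q) (Finset.Ico p' q') μ ν * z ^ (∑ j ∈ Finset.Ico P Q, μ j))) :
    (act (∏ j ∈ Finset.Ico P Q,
      (1 - AddMonoidAlgebra.single (Finsupp.single j (1 : ℤ)) z)) f).support.Finite ∧
    ∑ᶠ μ, act (∏ j ∈ Finset.Ico P Q,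
        (1 - AddMonoidAlgebra.single (Finsupp.single j (1 : ℤ)) z)) f μ =
      C * rowSum t z p q P Q p' q' A B l ν := by
  classical
  have h := act_window z (Finset.Ico P Q) (A := A) (B := B) f
    (fun μ hμ => by by_contra hcon; exact hμ (hf0 μ hcon)) ?_
  · refine ⟨h.1, h.2.trans ?_⟩
    rw [rowSum, Finset.mul_sum]
    refine Finset.sum_congr rfl fun μ hμ => ?_
    rw [Finset.mem_finsupp_iff] at hμ
    rw [hf μ hμ.1]
    ring
  · intro μ j hj hμj
    have hval : ∀ k, (μ + Finsupp.single j (1 : ℤ)) k = μ k + if k = j then 1 else 0 := fun k => by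
      rw [Finsupp.add_apply, Finsupp.single_apply]; simp only [eq_comm]
    have hsupp : (μ + Finsupp.single j (1 : ℤ)).support ⊆ Finset.Ico P Q ↔
        μ.support ⊆ Finset.Ico P Q := by
      refine forall_congr' fun k => ?_
      rw [Finsupp.mem_support_iff, Finsupp.mem_support_iff, hval]
      by_cases hk : k = j
      · subst hk; simp [hj]
      · simp [hk]
    by_cases hs : μ.support ⊆ Finset.Ico P Q
    · rw [hf μ hs, hf _ (hsupp.2 hs), stepTerm_mul_stepTerm_shift t (Finset.Ico p' q') hP hQ hl hν
        hj hμj (by simp) (fun k hk => by simp [hval, hk])]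
      simp only [hval, Finset.sum_add_distrib, Finset.sum_ite_eq', hj, if_true]
      rw [zpow_add_one₀ hz]
      ring
    · rw [hf0 μ hs, hf0 _ (fun h => hs (hsupp.1 h)), mul_zero]

end RowWindow

/-! ### Vanishing of the regularized sums over chains of rows -/

section ChainVanishing

variable {K : Type*} [Field K]

open Classical in
/-- The part of the weighted series of a chain of rows that does not involve the row `r`. -/
noncomputable def outerPart (t : K) (y : ℤ → Kˣ) (a e : ℤ) (row : ℤ → Finset ℤ) (b : ℤ → ℤ) (r : ℤ)
    (s : ℤ × ℤ →₀ ℤ) : K :=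
  (if (∀ v, v ∉ chainVertices a e row → s v = 0) ∧ ∀ j ∈ row a, s (a, j) = b j then 1 else 0) *
    (∏ k ∈ ((Finset.Ioc a e).erase r).erase (r + 1),
      stepTerm t (row (k - 1)) (row k) (fun j => s (k - 1, j)) fun j => s (k, j)) *
    ∏ k ∈ (Finset.Icc a e).erase r, ((y k ^ (∑ j ∈ row k, s (k, j)) : Kˣ) : K)

/-- The embedding of the functions on a row. -/
noncomputable def rowEmb (r : ℤ) : (ℤ →₀ ℤ) →+ (ℤ × ℤ →₀ ℤ) :=
  Finsupp.mapDomain.addMonoidHom (Prod.mk r)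

/-- The projection that forgets a row. -/
noncomputable def rowForget (r : ℤ) : (ℤ × ℤ →₀ ℤ) →+ (ℤ × ℤ →₀ ℤ) :=
  Finsupp.filterAddHom fun v => v.1 ≠ r

theorem rowEmb_apply_same (r : ℤ) (μ : ℤ →₀ ℤ) (j : ℤ) : rowEmb r μ (r, j) = μ j :=
  Finsupp.mapDomain_apply (Prod.mk_right_injective r) μ j

theorem rowEmb_apply_of_ne (r : ℤ) (μ : ℤ →₀ ℤ) {v : ℤ × ℤ} (hv : v.1 ≠ r) : rowEmb r μ v = 0 := by
  refine Finsupp.mapDomain_of_notMem_range μ v ?_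
  rintro ⟨j, rfl⟩
  exact hv rfl

theorem rowForget_apply (r : ℤ) (s : ℤ × ℤ →₀ ℤ) (v : ℤ × ℤ) :
    rowForget r s v = if v.1 = r then 0 else s v := by
  classical
  have : rowForget r s v = (s.filter fun v => v.1 ≠ r) v := rfl
  rw [this, Finsupp.filter_apply]
  simp

theorem rowForget_eq_self_iff {r : ℤ} {s : ℤ × ℤ →₀ ℤ} :
    rowForget r s = s ↔ ∀ j, s (r, j) = 0 := by
  constructor
  · intro h j
    rw [← h, rowForget_apply, if_pos rfl]
  · intro h
    ext v
    rw [rowForget_apply]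
    split_ifs with hv
    · obtain ⟨i, j⟩ := v
      simp only at hv
      rw [hv, h]
    · rfl

theorem rowEmb_injective (r : ℤ) : Function.Injective (rowEmb r) :=
  Finsupp.mapDomain_injective (Prod.mk_right_injective r)

theorem rowForget_rowEmb (r : ℤ) (μ : ℤ →₀ ℤ) : rowForget r (rowEmb r μ) = 0 := by
  ext v
  rw [rowForget_apply]
  split_ifs with hv
  · rfl
  · rw [rowEmb_apply_of_ne r μ hv]; rfl

theorem exists_eq_rowForget_add (r : ℤ) (s : ℤ × ℤ →₀ ℤ) :
    ∃ μ, s = rowForget r s + rowEmb r μ := by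
  refine ⟨s.comapDomain (Prod.mk r) (Prod.mk_right_injective r).injOn, ?_⟩
  ext v
  rw [Finsupp.add_apply, rowForget_apply]
  obtain ⟨i, j⟩ := v
  by_cases hv : i = r
  · subst hv
    rw [if_pos rfl, rowEmb_apply_same, zero_add, Finsupp.comapDomain_apply]
  · rw [if_neg hv, rowEmb_apply_of_ne _ _ hv, add_zero]

theorem chainSeries_add_rowEmb_eq_zero (t : K) (y : ℤ → Kˣ) {a e : ℤ} (row : ℤ → Finset ℤ)
    (b : ℤ → ℤ) {r : ℤ} {s : ℤ × ℤ →₀ ℤ} (hs : rowForget r s = s)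
    {μ : ℤ →₀ ℤ} (hμ : ¬ μ.support ⊆ row r) :
    chainSeries t y a e row b (s + rowEmb r μ) = 0 := by
  rw [Finset.not_subset] at hμ
  obtain ⟨j, hj, hjr⟩ := hμ
  rw [chainSeries, if_neg, zero_mul, zero_mul]
  rintro ⟨h, -⟩
  have := h (r, j) fun hv => hjr (mem_chainVertices.1 hv).2
  rw [Finsupp.add_apply, rowForget_eq_self_iff.1 hs, rowEmb_apply_same, zero_add] at this
  exact Finsupp.mem_support_iff.1 hj this

theorem chainSeries_add_rowEmb (t : K) (y : ℤ → Kˣ) {a e : ℤ} (row : ℤ → Finset ℤ)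
    (b : ℤ → ℤ) {r : ℤ} (har : a < r) (hre : r < e) {s : ℤ × ℤ →₀ ℤ} (hs : rowForget r s = s)
    {μ : ℤ →₀ ℤ} (hμ : μ.support ⊆ row r) :
    chainSeries t y a e row b (s + rowEmb r μ) = outerPart t y a e row b r s *
      (stepTerm t (row (r - 1)) (row r) (fun j => s (r - 1, j)) μ *
        stepTerm t (row r) (row (r + 1)) μ (fun j => s (r + 1, j)) *
        (y r : K) ^ (∑ j ∈ row r, μ j)) := by
  classical
  have hs' := rowForget_eq_self_iff.1 hs
  have v1 : ∀ k j, k ≠ r → (s + rowEmb r μ) (k, j) = s (k, j) := fun k j hk => by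
    rw [Finsupp.add_apply, rowEmb_apply_of_ne _ _ hk, add_zero]
  have v2 : ∀ j, (s + rowEmb r μ) (r, j) = μ j := fun j => by
    rw [Finsupp.add_apply, rowEmb_apply_same, hs', zero_add]
  have hind : ((∀ v, v ∉ chainVertices a e row → (s + rowEmb r μ) v = 0) ∧
      ∀ j ∈ row a, (s + rowEmb r μ) (a, j) = b j) ↔
      ((∀ v, v ∉ chainVertices a e row → s v = 0) ∧ ∀ j ∈ row a, s (a, j) = b j) := by
    refine and_congr (forall₂_congr fun v hv => ?_) (forall₂_congr fun j _ => ?_)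
    · obtain ⟨k, j⟩ := v
      by_cases hk : k = r
      · subst hk
        rw [v2, hs']
        have : j ∉ row k := fun h => hv (mem_chainVertices.2 ⟨⟨har.le, hre.le⟩, h⟩)
        have : μ j = 0 := by
          by_contra h
          exact this (hμ (Finsupp.mem_support_iff.2 h))
        simp [this]
      · rw [v1 k j hk]
    · rw [v1 a j har.ne]
  have h1 : r ∈ Finset.Ioc a e := by rw [Finset.mem_Ioc]; omega
  have h2 : r + 1 ∈ (Finset.Ioc a e).erase r := by
    rw [Finset.mem_erase, Finset.mem_Ioc]; omega
  have h3 : r ∈ Finset.Icc a e := by rw [Finset.mem_Icc]; omega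
  have e1 : (fun j => (s + rowEmb r μ) (r - 1, j)) = fun j => s (r - 1, j) :=
    funext fun j => v1 _ _ (by omega)
  have e2 : (fun j => (s + rowEmb r μ) (r + 1, j)) = fun j => s (r + 1, j) :=
    funext fun j => v1 _ _ (by omega)
  have e3 : (fun j => (s + rowEmb r μ) (r, j)) = μ := funext v2
  have e4 : ∏ k ∈ ((Finset.Ioc a e).erase r).erase (r + 1),
      stepTerm t (row (k - 1)) (row k) (fun j => (s + rowEmb r μ) (k - 1, j))
        (fun j => (s + rowEmb r μ) (k, j)) =
      ∏ k ∈ ((Finset.Ioc a e).erase r).erase (r + 1),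
      stepTerm t (row (k - 1)) (row k) (fun j => s (k - 1, j)) (fun j => s (k, j)) := by
    refine Finset.prod_congr rfl fun k hk => ?_
    rw [Finset.mem_erase, Finset.mem_erase] at hk
    congr 1
    · exact funext fun j => v1 _ _ (by omega)
    · exact funext fun j => v1 _ _ (by omega)
  have e5 : ∏ k ∈ (Finset.Icc a e).erase r,
      ((y k ^ (∑ j ∈ row k, (s + rowEmb r μ) (k, j)) : Kˣ) : K) =
      ∏ k ∈ (Finset.Icc a e).erase r, ((y k ^ (∑ j ∈ row k, s (k, j)) : Kˣ) : K) := by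
    refine Finset.prod_congr rfl fun k hk => ?_
    simp only [v1 k _ (Finset.mem_erase.1 hk).1]
  rw [chainSeries, outerPart, ← Finset.mul_prod_erase _ _ h1, ← Finset.mul_prod_erase _ _ h2,
    ← Finset.mul_prod_erase _ _ h3, e4, e5]
  simp only [hind, e1, e2, v2, add_sub_cancel_right, Units.val_zpow_eq_zpow_val]
  ring

theorem aug_row_prod (z : K) (J : Finset ℤ) :
    aug (∏ j ∈ J, (1 - AddMonoidAlgebra.single (Finsupp.single j (1 : ℤ)) z)) =
      (1 - z) ^ J.card := by
  rw [map_prod, Finset.prod_congr rfl fun j _ => by rw [map_sub, map_one, aug_single],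
    Finset.prod_const]

/-- Fubini's theorem for the sum over a row of a chain, expressed by finite sums over windows. -/
theorem HasRegSum.chain_row (t : K) (y : ℤ → Kˣ) {a e : ℤ} (p q : ℤ → ℤ) (b : ℤ → ℤ) {r : ℤ}
    (har : a < r) (hre : r < e) (hp : p (r - 1) ≤ p r + 1) (hq : q r ≤ q (r - 1)) {v : K}
    (h : HasRegSum (chainSeries t y a e (fun k => Finset.Ico (p k) (q k)) b) v)
    (A B : (ℤ × ℤ →₀ ℤ) → ℤ)
    (hl : ∀ s, ∀ j ∈ Finset.Ico (p (r - 1)) (q (r - 1)), s (r - 1, j) ∈ Finset.Ioo (A s) (B s))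
    (hν : ∀ s, ∀ j ∈ Finset.Ico (p (r + 1)) (q (r + 1)), s (r + 1, j) ∈ Finset.Ioo (A s) (B s)) :
    HasRegSum (fun s => ∑ᶠ (_ : rowForget r s = s),
      outerPart t y a e (fun k => Finset.Ico (p k) (q k)) b r s *
        rowSum t (y r : K) (p (r - 1)) (q (r - 1)) (p r) (q r) (p (r + 1)) (q (r + 1)) (A s) (B s)
          (fun j => s (r - 1, j)) (fun j => s (r + 1, j)))
      ((1 - (y r : K)) ^ (Finset.Ico (p r) (q r)).card * v) := by
  classical
  set row : ℤ → Finset ℤ := fun k => Finset.Ico (p k) (q k) with hrow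
  set Q : AddMonoidAlgebra K (ℤ →₀ ℤ) :=
    ∏ j ∈ Finset.Ico (p r) (q r), (1 - AddMonoidAlgebra.single (Finsupp.single j (1 : ℤ)) (y r : K))
    with hQ
  have hw : ∀ s, rowForget r s = s →
      (act Q (fun μ => chainSeries t y a e row b (s + rowEmb r μ))).support.Finite ∧
      ∑ᶠ μ, act Q (fun μ => chainSeries t y a e row b (s + rowEmb r μ)) μ =
        outerPart t y a e row b r s *
        rowSum t (y r : K) (p (r - 1)) (q (r - 1)) (p r) (q r) (p (r + 1)) (q (r + 1)) (A s) (B s)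
          (fun j => s (r - 1, j)) (fun j => s (r + 1, j)) := by
    intro s hs
    refine act_row_window t (y r : K) (y r).ne_zero hp hq (hl s) (hν s) _ _ ?_ ?_
    · exact fun μ hμ => chainSeries_add_rowEmb_eq_zero t y row b hs hμ
    · exact fun μ hμ => chainSeries_add_rowEmb t y row b har hre hs hμ
  -- An arbitrary base point differs from its projection by an element of the row, which only
  -- translates the function on the row.
  have hfin : ∀ s,
      (act Q (fun μ => chainSeries t y a e row b (s + rowEmb r μ))).support.Finite := by
    intro s
    obtain ⟨μ₀, hμ₀⟩ := exists_eq_rowForget_add r s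
    have hidem : rowForget r (rowForget r s) = rowForget r s := by
      rw [rowForget_eq_self_iff]
      intro j
      rw [rowForget_apply, if_pos rfl]
    have h1 := (hw _ hidem).1
    have h2 : ∀ μ, act Q (fun μ => chainSeries t y a e row b (s + rowEmb r μ)) μ =
        act Q (fun μ => chainSeries t y a e row b (rowForget r s + rowEmb r μ)) (μ₀ + μ) := by
      intro μ
      rw [← act_mapDomain (rowEmb r) Q (chainSeries t y a e row b),
        ← act_mapDomain (rowEmb r) Q (chainSeries t y a e row b), map_add, ← add_assoc, ← hμ₀]
    refine Set.Finite.subset (h1.preimage (f := fun μ => μ₀ + μ)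
      (add_right_injective μ₀).injOn) fun μ hμ => ?_
    rw [Function.mem_support, h2] at hμ
    exact hμ
  have h3 := h.summand (rowForget r) (rowEmb r) (rowEmb_injective r) (rowForget_rowEmb r)
    (exists_eq_rowForget_add r) Q hfin
  rw [hQ, aug_row_prod] at h3
  convert h3 using 1
  funext s
  exact finsum_congr fun hs => ((hw s hs).2).symm

/-- The action of moving a growth step past the row `r` on the characters of the rows. -/
noncomputable def swapChar (y : ℤ → Kˣ) (r : ℤ) : ℤ → Kˣ := fun k =>
  if k = r then (y r)⁻¹ else if k = r - 1 ∨ k = r + 1 then y k * y r else y k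

/-- The new characters of the rows `r - 1` and `r + 1` supply exactly the power of `y r` that arises
in `rowSum_swap`. -/
theorem outerPart_swap (t : K) (y : ℤ → Kˣ) {a e : ℤ} (row row' : ℤ → Finset ℤ) (b : ℤ → ℤ) {r : ℤ}
    (har : a < r) (hre : r < e) (hrow : ∀ k, k ≠ r → row' k = row k) {s : ℤ × ℤ →₀ ℤ}
    (hs : rowForget r s = s) :
    outerPart t (swapChar y r) a e row' b r s = outerPart t y a e row b r s *
      (y r : K) ^ (∑ j ∈ row (r - 1), s (r - 1, j) + ∑ j ∈ row (r + 1), s (r + 1, j)) := by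
  classical
  have hs' := rowForget_eq_self_iff.1 hs
  have hind : ((∀ v, v ∉ chainVertices a e row' → s v = 0) ∧ ∀ j ∈ row' a, s (a, j) = b j) ↔
      ((∀ v, v ∉ chainVertices a e row → s v = 0) ∧ ∀ j ∈ row a, s (a, j) = b j) := by
    rw [hrow a har.ne]
    refine and_congr_left' (forall_congr' fun v => ?_)
    obtain ⟨k, j⟩ := v
    by_cases hk : k = r
    · subst hk; simp [hs']
    · rw [mem_chainVertices, mem_chainVertices]
      simp only [hrow k hk]
  have h1 : ∏ k ∈ ((Finset.Ioc a e).erase r).erase (r + 1),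
      stepTerm t (row' (k - 1)) (row' k) (fun j => s (k - 1, j)) (fun j => s (k, j)) =
      ∏ k ∈ ((Finset.Ioc a e).erase r).erase (r + 1),
      stepTerm t (row (k - 1)) (row k) (fun j => s (k - 1, j)) (fun j => s (k, j)) := by
    refine Finset.prod_congr rfl fun k hk => ?_
    rw [Finset.mem_erase, Finset.mem_erase] at hk
    rw [hrow k hk.2.1, hrow (k - 1) (by omega)]
  have m1 : r - 1 ∈ (Finset.Icc a e).erase r := by
    rw [Finset.mem_erase, Finset.mem_Icc]; omega
  have m2 : r + 1 ∈ ((Finset.Icc a e).erase r).erase (r - 1) := by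
    rw [Finset.mem_erase, Finset.mem_erase, Finset.mem_Icc]; omega
  have h2 : ∏ k ∈ (((Finset.Icc a e).erase r).erase (r - 1)).erase (r + 1),
      ((swapChar y r k ^ (∑ j ∈ row' k, s (k, j)) : Kˣ) : K) =
      ∏ k ∈ (((Finset.Icc a e).erase r).erase (r - 1)).erase (r + 1),
      ((y k ^ (∑ j ∈ row k, s (k, j)) : Kˣ) : K) := by
    refine Finset.prod_congr rfl fun k hk => ?_
    simp only [Finset.mem_erase] at hk
    rw [hrow k hk.2.2.1, swapChar, if_neg hk.2.2.1, if_neg (by omega)]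
  have s1 : swapChar y r (r - 1) = y (r - 1) * y r := by simp [swapChar]
  have s2 : swapChar y r (r + 1) = y (r + 1) * y r := by simp [swapChar]
  rw [outerPart, outerPart, h1, ← Finset.mul_prod_erase _ _ m1, ← Finset.mul_prod_erase _ _ m2, h2,
    ← Finset.mul_prod_erase _ _ m1, ← Finset.mul_prod_erase _ _ m2, s1, s2,
    hrow (r - 1) (by omega), hrow (r + 1) (by omega), mul_zpow, mul_zpow,
    zpow_add₀ (y r).ne_zero]
  simp only [hind, Units.val_mul, Units.val_zpow_eq_zpow_val]
  ring

/-- Characters of the rows that are multiplicatively independent, also from `t`. -/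
def IsGenericChar (t : K) (y : ℤ → Kˣ) : Prop :=
  ∃ χ : (ℤ →₀ ℤ) →+ Additive Kˣ, Function.Injective χ ∧
    (∀ m, t * ((χ m).toMul : K) ≠ 1) ∧ ∀ k, y k = (χ (Finsupp.single k 1)).toMul

theorem IsGenericChar.swapChar {t : K} {y : ℤ → Kˣ} (h : IsGenericChar t y) (r : ℤ) :
    IsGenericChar t (swapChar y r) := by
  obtain ⟨χ, hχ, ht, hy⟩ := h
  -- On exponents the change of characters is the simple reflection `n r ↦ n (r - 1) + n (r + 1) - n
  -- r`.
  let L : (ℤ →₀ ℤ) →+ (ℤ →₀ ℤ) := AddMonoidHom.id _ + (Finsupp.singleAddHom r).comp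
    (Finsupp.applyAddHom (r - 1) + Finsupp.applyAddHom (r + 1) - 2 • Finsupp.applyAddHom r)
  have hL : ∀ n, L n = n + Finsupp.single r (n (r - 1) + n (r + 1) - 2 * n r) := by
    intro n; simp [L]
  have hinj : Function.Injective L := by
    rw [injective_iff_map_eq_zero]
    intro n hn
    rw [hL] at hn
    have h1 : ∀ k, k ≠ r → n k = 0 := fun k hk => by
      simpa [Finsupp.single_apply, hk.symm] using DFunLike.congr_fun hn k
    have h2 := DFunLike.congr_fun hn r
    simp only [Finsupp.add_apply, Finsupp.single_eq_same, h1 (r - 1) (by omega),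
      h1 (r + 1) (by omega), Finsupp.coe_zero, Pi.zero_apply] at h2
    ext k
    by_cases hk : k = r
    · rw [hk, Finsupp.zero_apply]; omega
    · exact h1 k hk
  refine ⟨χ.comp L, hχ.comp hinj, fun m => ht _, fun k => ?_⟩
  rw [AddMonoidHom.comp_apply, hL]
  unfold _root_.swapChar
  split_ifs with h1 h2
  · subst h1
    have : Finsupp.single k (1 : ℤ) + Finsupp.single k ((Finsupp.single k (1 : ℤ)) (k - 1) +
        (Finsupp.single k (1 : ℤ)) (k + 1) - 2 * (Finsupp.single k (1 : ℤ)) k) =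
        -Finsupp.single k 1 := by
      rw [← Finsupp.single_add, ← Finsupp.single_neg]
      congr 1
      simp
    rw [this, map_neg, toMul_neg, hy]
  · have : (Finsupp.single k (1 : ℤ)) (r - 1) + (Finsupp.single k (1 : ℤ)) (r + 1) -
        2 * (Finsupp.single k (1 : ℤ)) r = 1 := by
      simp only [Finsupp.single_apply]
      split_ifs <;> omega
    rw [this, map_add, toMul_add, hy, hy]
  · have : (Finsupp.single k (1 : ℤ)) (r - 1) + (Finsupp.single k (1 : ℤ)) (r + 1) -
        2 * (Finsupp.single k (1 : ℤ)) r = 0 := by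
      simp only [Finsupp.single_apply]
      split_ifs <;> omega
    rw [this, Finsupp.single_zero, add_zero, hy]

/-- The exponent vector of the product has coordinate sum `U.card`, hence is nonzero. -/
theorem IsGenericChar.prod_ne_one {t : K} {y : ℤ → Kˣ} (h : IsGenericChar t y)
    {U : Finset (ℤ × ℤ)} (hU : U.Nonempty) : ∏ v ∈ U, y v.1 ≠ 1 := by
  obtain ⟨χ, hχ, -, hy⟩ := h
  intro hcon
  have h1 : χ (∑ v ∈ U, Finsupp.single v.1 1) = 0 := by
    rw [map_sum]
    apply Additive.toMul.injective
    rw [toMul_sum, toMul_zero, ← hcon]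
    exact Finset.prod_congr rfl fun v _ => (hy _).symm
  have h2 := (injective_iff_map_eq_zero χ).1 hχ _ h1
  have h3 := congrArg (fun n : ℤ →₀ ℤ => n.sum fun _ m => m) h2
  simp only [Finsupp.sum_zero_index] at h3
  rw [← Finsupp.sum_finsetSum_index (by simp) (by simp)] at h3
  simp only [Finsupp.sum_single_index, Finset.sum_const, nsmul_eq_mul, mul_one,
    Nat.cast_eq_zero, Finset.card_eq_zero] at h3
  exact hU.ne_empty h3

theorem IsGenericChar.ne_one {t : K} {y : ℤ → Kˣ} (h : IsGenericChar t y) (k : ℤ) :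
    (y k : K) ≠ 1 := by
  have := h.prod_ne_one (Finset.singleton_nonempty ((k, 0) : ℤ × ℤ))
  rw [Finset.prod_singleton] at this
  exact fun h => this (Units.ext h)

theorem IsGenericChar.mul_ne_one {t : K} {y : ℤ → Kˣ} (h : IsGenericChar t y) (k : ℤ) :
    t * (y k : K) ≠ 1 := by
  obtain ⟨χ, -, ht, hy⟩ := h
  rw [hy]; exact ht _

theorem IsGenericChar.exists_hasRegSum {t : K} {y : ℤ → Kˣ} (h : IsGenericChar t y) (a e : ℤ)
    (row : ℤ → Finset ℤ) (b : ℤ → ℤ) : ∃ v, HasRegSum (chainSeries t y a e row b) v := by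
  have hne : aug (chainDenominator y (chainVertices a e row)) ≠ 0 := by
    rw [chainDenominator, map_prod, Finset.prod_ne_zero_iff]
    intro U hU
    rw [Finset.mem_erase, ← Finset.nonempty_iff_ne_empty] at hU
    rw [map_sub, map_one, aug_single, sub_ne_zero]
    exact fun h' => h.prod_ne_one hU.1 (Units.ext h'.symm)
  refine ⟨(aug (chainDenominator y (chainVertices a e row)))⁻¹ * ∑ᶠ s,
    act (chainDenominator y (chainVertices a e row)) (chainSeries t y a e row b) s, _, hne,
    chainSeries_act_finite t y a e row b, ?_⟩
  rw [mul_inv_cancel_left₀ hne]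

theorem exists_window (L N : Finset ℤ) (l ν : ℤ → ℤ) :
    ∃ A B : ℤ, A < B ∧ (∀ j ∈ L, l j ∈ Finset.Ioo A B) ∧ ∀ j ∈ N, ν j ∈ Finset.Ioo A B := by
  classical
  set M : ℤ := ∑ j ∈ L, |l j| + ∑ j ∈ N, |ν j| + 1 with hM
  have h1 : 0 ≤ ∑ j ∈ L, |l j| := Finset.sum_nonneg fun _ _ => abs_nonneg _
  have h2 : 0 ≤ ∑ j ∈ N, |ν j| := Finset.sum_nonneg fun _ _ => abs_nonneg _
  refine ⟨-M, M, by omega, fun j hj => ?_, fun j hj => ?_⟩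
  · have := Finset.single_le_sum (f := fun j => |l j|) (fun _ _ => abs_nonneg _) hj
    rw [Finset.mem_Ioo, ← abs_lt]
    omega
  · have := Finset.single_le_sum (f := fun j => |ν j|) (fun _ _ => abs_nonneg _) hj
    rw [Finset.mem_Ioo, ← abs_lt]
    omega

theorem exists_bit_eq {d : ℤ} (h : d = 0 ∨ d = 1) : ∃ α, bit α = d := by
  rcases h with rfl | rfl
  · exact ⟨false, rfl⟩
  · exact ⟨true, rfl⟩

/-- If a chain of rows with a growth step ends with a row of one vertex, then its regularized sum
vanishes. -/
theorem chainSeries_hasRegSum_zero (t : K) (n : ℕ) (y : ℤ → Kˣ) (hy : IsGenericChar t y) (a e r : ℤ)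
    (p q : ℤ → ℤ) (b : ℤ → ℤ) (hn : r + n = e) (har : a < r) (hp : p r = p (r - 1) - 1)
    (hq : q r = q (r - 1)) (h0 : p (r - 1) ≤ q (r - 1))
    (hne : ∀ k, r ≤ k → k ≤ e → p k < q k)
    (hsp : ∀ k, r ≤ k → k < e → p k - p (k + 1) = 0 ∨ p k - p (k + 1) = 1)
    (hsq : ∀ k, r ≤ k → k < e → q k - q (k + 1) = 0 ∨ q k - q (k + 1) = 1)
    (hlast : q e = p e + 1) :
    HasRegSum (chainSeries t y a e (fun k => Finset.Ico (p k) (q k)) b) 0 := by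
  classical
  -- The induction is on the distance from the growth step to the last row. The shapes are only
  -- constrained from row `r - 1` on, and that row may be empty, because the exchange produces such
  -- rows.
  induction n generalizing y r p q with
  | zero =>
    have hre : r = e := by simpa using hn
    subst hre
    have hI : Finset.Ico (p (r - 1)) (q (r - 1)) = ∅ := Finset.Ico_eq_empty (by omega)
    have hJ : Finset.Ico (p r) (q r) = {p r} := by
      ext j; rw [Finset.mem_Ico, Finset.mem_singleton]; omega
    -- The row above is empty and there is no row below, so the single entry is free and the series
    -- is quasi-periodic in it.
    refine hasRegSum_zero_of_act_eq_zero
      (1 - AddMonoidAlgebra.single (indicatorVec {(r, p r)}) (y r : K)) ?_ ?_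
    · rw [map_sub, map_one, aug_single]
      exact sub_ne_zero.2 (hy.ne_one r).symm
    · funext s
      rw [act_one_sub_single, Pi.zero_apply, sub_eq_zero]
      have hv : ∀ k j, k ≠ r → (s - indicatorVec {(r, p r)}) (k, j) = s (k, j) := fun k j hk => by
        rw [Finsupp.coe_sub, Pi.sub_apply, indicatorVec_apply, if_neg, sub_zero]
        rw [Finset.mem_singleton, Prod.mk.injEq]
        exact fun h => hk h.1
      refine (chainSeries_shift_of_stepTerm_eq t y a r _ b s {(r, p r)} ?_ ?_ ?_).trans (by simp)
      · rw [Finset.singleton_subset_iff, mem_chainVertices, Finset.mem_Ico]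
        exact ⟨⟨har.le, le_rfl⟩, by simp only; omega⟩
      · intro u hu
        rw [Finset.mem_singleton.1 hu]
        exact har.ne'
      · intro k hk
        rw [Finset.mem_Ioc] at hk
        by_cases hkr : k = r
        · subst hkr
          rw [hI, hJ]
          refine stepTerm_congr t ?_ (by simp) (by simp)
          intro j hj k hk
          rw [Finset.mem_singleton] at hj hk
          rw [hj, hk]
          simp
        · have e1 : (fun j => (s - indicatorVec {(r, p r)}) (k - 1, j)) = fun j => s (k - 1, j) :=
            funext fun j => hv _ _ (by omega)
          have e2 : (fun j => (s - indicatorVec {(r, p r)}) (k, j)) = fun j => s (k, j) :=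
            funext fun j => hv _ _ hkr
          rw [e1, e2]
  | succ n ih =>
    have hre : r < e := by push_cast at hn; omega
    obtain ⟨α, hα⟩ := exists_bit_eq (hsp r le_rfl hre)
    obtain ⟨β, hβ⟩ := exists_bit_eq (hsq r le_rfl hre)
    have a0 := bit_nonneg α
    have a1 := bit_le_one α
    have b0 := bit_nonneg β
    have b1 := bit_le_one β
    have hr1 := hne (r + 1) (by omega) (by omega)
    -- The replacement of row `r` is chosen so that row `r + 1` extends it by one vertex on the
    -- left.
    set p' := Function.update p r (p (r - 1) - bit α) with hp'
    set q' := Function.update q r (q (r - 1) - bit β) with hq'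
    have p1 : ∀ k, k ≠ r → p' k = p k := fun k hk => Function.update_of_ne hk _ _
    have q1 : ∀ k, k ≠ r → q' k = q k := fun k hk => Function.update_of_ne hk _ _
    have p2 : p' r = p (r - 1) - bit α := Function.update_self _ _ _
    have q2 : q' r = q (r - 1) - bit β := Function.update_self _ _ _
    have hIH := ih (swapChar y r) (hy.swapChar r) (r + 1) p' q' (by push_cast at hn ⊢; omega)
      (by omega) (by rw [add_sub_cancel_right, p2, p1 _ (by omega)]; omega)
      (by rw [add_sub_cancel_right, q2, q1 _ (by omega)]; omega)
      (by rw [add_sub_cancel_right, p2, q2]; omega)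
      (fun k hk hke => by rw [p1 k (by omega), q1 k (by omega)]; exact hne k (by omega) hke)
      (fun k hk hke => by
        rw [p1 k (by omega), p1 (k + 1) (by omega)]; exact hsp k (by omega) hke)
      (fun k hk hke => by
        rw [q1 k (by omega), q1 (k + 1) (by omega)]; exact hsq k (by omega) hke)
      (by rw [p1 e (by omega), q1 e (by omega)]; exact hlast)
    -- Some value `v` exists. Summing over row `r` first will show that `(1 - y r) ^ (length of row
    -- r) * v = 0`.
    obtain ⟨v, hv⟩ := hy.exists_hasRegSum a e (fun k => Finset.Ico (p k) (q k)) b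
    choose A B hAB hl hν using fun s : ℤ × ℤ →₀ ℤ =>
      exists_window (Finset.Ico (p (r - 1)) (q (r - 1))) (Finset.Ico (p (r + 1)) (q (r + 1)))
        (fun j => s (r - 1, j)) (fun j => s (r + 1, j))
    have e1 : p (r + 1) = p (r - 1) - 1 - bit α := by omega
    have e2 : q (r + 1) = q (r - 1) - bit β := by omega
    have g := hv.chain_row t y p q b har hre (by omega) (by omega) A B hl hν
    have g' := hIH.chain_row t (swapChar y r) p' q' b har hre
      (by rw [p1 (r - 1) (by omega), p2]; omega) (by rw [q1 (r - 1) (by omega), q2]; omega) A B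
      (by rw [p1 (r - 1) (by omega), q1 (r - 1) (by omega)]; exact hl)
      (by rw [p1 (r + 1) (by omega), q1 (r + 1) (by omega)]; exact hν)
    obtain ⟨κ, c, hκ, hswap⟩ := rowSum_swap t (y r : K) (y r).ne_zero (hy.ne_one r)
      (hy.mul_ne_one r) (p (r - 1)) (q (r - 1)) α β h0 (by omega)
    have sr : ((swapChar y r r : Kˣ) : K) = (y r : K)⁻¹ := by simp [swapChar]
    rw [mul_zero, p1 (r - 1) (by omega), q1 (r - 1) (by omega), p1 (r + 1) (by omega),
      q1 (r + 1) (by omega), p2, q2, sr, e1, e2] at g'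
    rw [e1, e2, hp, hq] at g
    rw [e1, e2] at hν
    have g0 := g'.const_mul c
    rw [mul_zero] at g0
    -- For fixed remaining rows, `κ` times the inner sum is `c` times the inner sum of the exchanged
    -- chain. Both constants are independent of the rows and the windows, so the vanishing for the
    -- exchanged chain carries over.
    have key := HasRegSum.of_const_mul hκ (F := fun s => ∑ᶠ (_ : rowForget r s = s),
      outerPart t y a e (fun k => Finset.Ico (p k) (q k)) b r s *
        rowSum t (y r : K) (p (r - 1)) (q (r - 1)) (p (r - 1) - 1) (q (r - 1))
          (p (r - 1) - 1 - bit α) (q (r - 1) - bit β) (A s) (B s)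
          (fun j => s (r - 1, j)) (fun j => s (r + 1, j))) ?_
    · have := g.unique key
      rw [mul_eq_zero] at this
      rcases this with h | h
      · exact absurd h (pow_ne_zero _ (sub_ne_zero.2 (hy.ne_one r).symm))
      · rwa [h] at hv
    · convert g0 using 1
      funext s
      by_cases hs : rowForget r s = s
      · simp only [finsum_eq_if, hs, if_true]
        rw [outerPart_swap t y (fun k => Finset.Ico (p k) (q k)) _ b har hre
          (fun k hk => by simp only [p1 k hk, q1 k hk]) hs]
        have := hswap (A s) (B s) (fun j => s (r - 1, j)) (fun j => s (r + 1, j)) (hAB s) (hl s)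
          (hν s)
        simp only [e1, e2]
        linear_combination outerPart t y a e (fun k => Finset.Ico (p k) (q k)) b r s * this
      · simp only [finsum_eq_if, hs, if_false, mul_zero]

end ChainVanishing

/-! ### The rows of ordinary subgraphs -/

section OrdinaryRows

theorem rotatedLattice_adj {u v : ℤ × ℤ} : rotatedLattice.Adj u v ↔
    (v = (u.1 - 1, u.2) ∨ v = (u.1 - 1, u.2 + 1)) ∨
      (u = (v.1 - 1, v.2) ∨ u = (v.1 - 1, v.2 + 1)) := by
  rw [rotatedLattice, SimpleGraph.fromRel_adj, and_iff_right_iff_imp]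
  rintro h rfl
  simp only [Prod.ext_iff] at h
  omega

/-- Two vertices of a row that are joined by an unbroken sequence of vertices of the row. -/
def SameRun (Γ : Finset (ℤ × ℤ)) (u v : ℤ × ℤ) : Prop :=
  u.1 = v.1 ∧ ∀ j, (u.2 ≤ j ∧ j ≤ v.2) ∨ (v.2 ≤ j ∧ j ≤ u.2) → (u.1, j) ∈ Γ

/-- The vertex `v` is one of the two lower neighbours of `u`. -/
def IsBelow (u v : ℤ × ℤ) : Prop := v.1 = u.1 + 1 ∧ (v.2 = u.2 ∨ v.2 = u.2 - 1)

variable {Γ : Finset (ℤ × ℤ)}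

theorem SameRun.refl {u : ℤ × ℤ} (hu : u ∈ Γ) : SameRun Γ u u :=
  ⟨rfl, fun j hj => by
    have : j = u.2 := by omega
    rw [this]; exact hu⟩

theorem SameRun.symm {u v : ℤ × ℤ} (h : SameRun Γ u v) : SameRun Γ v u :=
  ⟨h.1.symm, fun j hj => by rw [← h.1]; exact h.2 j hj.symm⟩

theorem SameRun.trans {u v w : ℤ × ℤ} (h : SameRun Γ u v) (h' : SameRun Γ v w) :
    SameRun Γ u w := by
  refine ⟨h.1.trans h'.1, fun j hj => ?_⟩
  by_cases hj' : (u.2 ≤ j ∧ j ≤ v.2) ∨ (v.2 ≤ j ∧ j ≤ u.2)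
  · exact h.2 j hj'
  · rw [h.1]; exact h'.2 j (by omega)

/-- Condition (2) supplies all vertices strictly between the two lower neighbours. So at most one
run lies below a given run; by condition (3), the same holds above. -/
theorem SameRun.below (hΓ : IsOrdinary Γ) {u v u' v' : ℤ × ℤ} (h : SameRun Γ u v)
    (hu : IsBelow u u') (hv : IsBelow v v') (hu' : u' ∈ Γ) (hv' : v' ∈ Γ) : SameRun Γ u' v' := by
  have e : u'.1 = v'.1 := by rw [hu.1, hv.1, h.1]
  refine ⟨e, fun j hj => ?_⟩
  by_cases h1 : j = u'.2
  · rw [h1]; exact hu'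
  by_cases h2 : j = v'.2
  · rw [h2, e]; exact hv'
  have a1 := hu.2
  have a2 := hv.2
  rw [hu.1]
  exact hΓ.below _ _ (h.2 j (by omega)) (h.2 (j + 1) (by omega))

theorem SameRun.above (hΓ : IsOrdinary Γ) {u v u' v' : ℤ × ℤ} (h : SameRun Γ u v)
    (hu : IsBelow u' u) (hv : IsBelow v' v) (hu' : u' ∈ Γ) (hv' : v' ∈ Γ)
    (htop : topRow Γ < u.1) : SameRun Γ u' v' := by
  have e : u'.1 = v'.1 := by have := hu.1; have := hv.1; have := h.1; omega
  refine ⟨e, fun j hj => ?_⟩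
  by_cases h1 : j = u'.2
  · rw [h1]; exact hu'
  by_cases h2 : j = v'.2
  · rw [h2, e]; exact hv'
  have a1 := hu.2
  have a2 := hv.2
  have := hΓ.above u.1 (j - 1) htop (h.2 _ (by omega)) (h.2 _ (by omega))
  rwa [hu.1, add_sub_cancel_right, sub_add_cancel] at this

theorem bddBelow_rows (Γ : Finset (ℤ × ℤ)) : BddBelow (Prod.fst '' (Γ : Set (ℤ × ℤ))) :=
  (Γ.finite_toSet.image _).bddBelow

theorem topRow_le {u : ℤ × ℤ} (hu : u ∈ Γ) : topRow Γ ≤ u.1 :=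
  csInf_le (bddBelow_rows Γ) ⟨u, hu, rfl⟩

theorem exists_mem_topRow (hne : Γ.Nonempty) : ∃ u ∈ Γ, u.1 = topRow Γ := by
  have h : (Prod.fst '' (Γ : Set (ℤ × ℤ))).Nonempty := Set.Nonempty.image _ hne
  obtain ⟨u, hu, h⟩ := Int.csInf_mem h (bddBelow_rows Γ)
  exact ⟨u, hu, h⟩

/-- The vertices reached from the run of `u₀` by `n` downward steps between runs. -/
def Strand (Γ : Finset (ℤ × ℤ)) (u₀ : ℤ × ℤ) : ℕ → ℤ × ℤ → Prop
  | 0, w => SameRun Γ w u₀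
  | n + 1, w => ∃ u v, Strand Γ u₀ n u ∧ u ∈ Γ ∧ v ∈ Γ ∧ IsBelow u v ∧ SameRun Γ w v

theorem Strand.congr {u₀ w w' : ℤ × ℤ} {n : ℕ} (h : Strand Γ u₀ n w) (hw : SameRun Γ w' w) :
    Strand Γ u₀ n w' := by
  cases n with
  | zero => exact hw.trans h
  | succ n =>
    obtain ⟨u, v, h1, h2, h3, h4, h5⟩ := h
    exact ⟨u, v, h1, h2, h3, h4, hw.trans h5⟩

theorem Strand.sameRun (hΓ : IsOrdinary Γ) {u₀ w w' : ℤ × ℤ} {n : ℕ} (h : Strand Γ u₀ n w)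
    (h' : Strand Γ u₀ n w') : SameRun Γ w w' := by
  induction n generalizing w w' with
  | zero => exact SameRun.trans h (SameRun.symm h')
  | succ n ih =>
    obtain ⟨u, v, h1, h2, h3, h4, h5⟩ := h
    obtain ⟨u', v', h1', h2', h3', h4', h5'⟩ := h'
    exact h5.trans (((ih h1 h1').below hΓ h4 h4' h3 h3').trans h5'.symm)

theorem Strand.row {u₀ w : ℤ × ℤ} {n : ℕ} (h : Strand Γ u₀ n w) : w.1 = u₀.1 + n := by
  induction n generalizing w with
  | zero => have := h.1; push_cast; omega
  | succ n ih =>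
    obtain ⟨u, v, h1, h2, h3, h4, h5⟩ := h
    have := ih h1
    have := h4.1
    have := h5.1
    push_cast; omega

/-- Along a walk from the top row, a step down extends the strand, and a step up returns to its
previous run by `SameRun.above`; from level 0 no step up exists. -/
theorem IsOrdinary.exists_strand (hΓ : IsOrdinary Γ) {u₀ : ℤ × ℤ} (hu₀ : u₀ ∈ Γ)
    (htop : u₀.1 = topRow Γ) {w : ℤ × ℤ} (hw : w ∈ Γ) : ∃ n, Strand Γ u₀ n w := by
  have key : ∀ x y : (Γ : Set (ℤ × ℤ)),
      (rotatedLattice.induce (Γ : Set (ℤ × ℤ))).Reachable x y →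
      (∃ n, Strand Γ u₀ n x) → ∃ n, Strand Γ u₀ n y := by
    rintro x y ⟨W⟩
    induction W with
    | nil => exact id
    | @cons x y _ hadj _ ih =>
      rintro ⟨n, hn⟩
      apply ih
      have hx : (x : ℤ × ℤ) ∈ Γ := x.2
      have hy : (y : ℤ × ℤ) ∈ Γ := y.2
      rw [SimpleGraph.induce_adj, rotatedLattice_adj] at hadj
      rcases hadj with hup | hdown
      · have hb : IsBelow (y : ℤ × ℤ) x := by
          simp only [Prod.ext_iff] at hup
          constructor <;> omega
        cases n with
        | zero =>
          have h1 := Strand.row hn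
          have h2 := topRow_le hy
          have h3 := hb.1
          push_cast at h1
          omega
        | succ n =>
          have hrow := hn.row
          obtain ⟨u, v, h1, h2, h3, h4, h5⟩ := hn
          refine ⟨n, h1.congr (h5.above hΓ hb h4 hy h2 ?_)⟩
          push_cast at hrow
          omega
      · have hb : IsBelow (x : ℤ × ℤ) y := by
          simp only [Prod.ext_iff] at hdown
          constructor <;> omega
        exact ⟨n + 1, x, y, hn, hx, hy, hb, SameRun.refl hy⟩
  exact key ⟨u₀, hu₀⟩ ⟨w, hw⟩ (hΓ.connected.preconnected _ _) ⟨0, SameRun.refl hu₀⟩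

theorem IsOrdinary.nonempty (hΓ : IsOrdinary Γ) : Γ.Nonempty := by
  obtain ⟨u⟩ := hΓ.connected.nonempty
  exact ⟨u, u.2⟩

/-- Both vertices lie on the strand of a top vertex, at the same depth since they share a row, and a
strand has one run per depth. -/
theorem IsOrdinary.sameRun (hΓ : IsOrdinary Γ) {u v : ℤ × ℤ} (hu : u ∈ Γ) (hv : v ∈ Γ)
    (h : u.1 = v.1) : SameRun Γ u v := by
  obtain ⟨u₀, hu₀, htop⟩ := exists_mem_topRow hΓ.nonempty
  obtain ⟨n, hn⟩ := hΓ.exists_strand hu₀ htop hu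
  obtain ⟨m, hm⟩ := hΓ.exists_strand hu₀ htop hv
  have h1 := hn.row
  have h2 := hm.row
  have : n = m := by omega
  subst this
  exact hn.sameRun hΓ hm

theorem IsOrdinary.exists_isBelow (hΓ : IsOrdinary Γ) {w : ℤ × ℤ} (hw : w ∈ Γ) {k : ℤ}
    (hk : topRow Γ ≤ k) (hkw : k < w.1) : ∃ u ∈ Γ, ∃ v ∈ Γ, u.1 = k ∧ IsBelow u v := by
  obtain ⟨u₀, hu₀, htop⟩ := exists_mem_topRow hΓ.nonempty
  obtain ⟨n, hn⟩ := hΓ.exists_strand hu₀ htop hw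
  have hrow := hn.row
  clear hw
  induction n generalizing w with
  | zero => push_cast at hrow; omega
  | succ n ih =>
    obtain ⟨u, v, h1, h2, h3, h4, h5⟩ := hn
    have h6 := h1.row
    push_cast at hrow
    by_cases h : k = u.1
    · exact ⟨u, h2, v, h3, h.symm, h4⟩
    · exact ih (by omega) h1 h6

/-- The subgraph `Γ` consists of the rows `p k ≤ j < q k` with `k` from the top row to `e`; the ends
of consecutive rows differ by half steps, and the last row has one vertex. -/
structure IsRowChain (Γ : Finset (ℤ × ℤ)) (e : ℤ) (p q : ℤ → ℤ) : Prop where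
  mem_iff : ∀ k j, (k, j) ∈ Γ ↔ (topRow Γ ≤ k ∧ k ≤ e) ∧ p k ≤ j ∧ j < q k
  top_le : topRow Γ ≤ e
  lt : ∀ k, topRow Γ ≤ k → k ≤ e → p k < q k
  left : ∀ k, topRow Γ ≤ k → k < e → p k - p (k + 1) = 0 ∨ p k - p (k + 1) = 1
  right : ∀ k, topRow Γ ≤ k → k < e → q k - q (k + 1) = 0 ∨ q k - q (k + 1) = 1
  last : q e = p e + 1

theorem IsOrdinary.exists_isRowChain (hΓ : IsOrdinary Γ) : ∃ e p q, IsRowChain Γ e p q := by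
  classical
  have hint : ∀ k, ∃ p q : ℤ, ∀ j, (k, j) ∈ Γ ↔ p ≤ j ∧ j < q := by
    intro k
    set S := (Γ.filter fun v => v.1 = k).image Prod.snd with hS
    have hmem : ∀ j, j ∈ S ↔ (k, j) ∈ Γ := by
      intro j
      simp only [hS, Finset.mem_image, Finset.mem_filter]
      constructor
      · rintro ⟨⟨i, j'⟩, ⟨h, rfl⟩, rfl⟩; exact h
      · exact fun h => ⟨(k, j), ⟨h, rfl⟩, rfl⟩
    by_cases hne : S.Nonempty
    · refine ⟨S.min' hne, S.max' hne + 1, fun j => ⟨fun h => ?_, fun h => ?_⟩⟩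
      · rw [← hmem] at h
        have h1 := S.min'_le j h
        have h2 := S.le_max' j h
        omega
      · have h1 := (hmem _).1 (S.min'_mem hne)
        have h2 := (hmem _).1 (S.max'_mem hne)
        exact (hΓ.sameRun h1 h2 rfl).2 j (by simp only; omega)
    · rw [Finset.not_nonempty_iff_eq_empty] at hne
      refine ⟨0, 0, fun j => ?_⟩
      rw [← hmem, hne]
      simp
  choose p q hpq using hint
  obtain ⟨w, hw, hmax⟩ := Finset.exists_max_image Γ Prod.fst hΓ.nonempty
  have hlt : ∀ u ∈ Γ, p u.1 ≤ u.2 ∧ u.2 < q u.1 := fun u hu => (hpq u.1 u.2).1 hu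
  have hstep : ∀ k, topRow Γ ≤ k → k < w.1 → p k < q k ∧ p (k + 1) < q (k + 1) ∧
      (p k - p (k + 1) = 0 ∨ p k - p (k + 1) = 1) ∧
      (q k - q (k + 1) = 0 ∨ q k - q (k + 1) = 1) := by
    intro k hk hkw
    obtain ⟨u, hu, v, hv, rfl, hb⟩ := hΓ.exists_isBelow hw hk hkw
    have h1 := hlt u hu
    have h2 := hlt v hv
    obtain ⟨hb1, hb2⟩ := hb
    rw [hb1] at h2
    -- Conditions (2) and (3) at the extreme pairs of vertices bound the displacement of the ends;
    -- rows with a single vertex are controlled by the edge from `u` to `v`.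
    have hbelow : ∀ j, p u.1 ≤ j → j + 1 < q u.1 → p (u.1 + 1) ≤ j ∧ j < q (u.1 + 1) :=
      fun j hj hj' => (hpq _ _).1 (hΓ.below u.1 j ((hpq _ _).2 (by omega)) ((hpq _ _).2 (by omega)))
    have habove : ∀ j, p (u.1 + 1) ≤ j → j + 1 < q (u.1 + 1) → p u.1 ≤ j + 1 ∧ j + 1 < q u.1 := by
      intro j hj hj'
      have := hΓ.above (u.1 + 1) j (by omega) ((hpq _ _).2 (by omega)) ((hpq _ _).2 (by omega))
      rw [add_sub_cancel_right] at this
      exact (hpq _ _).1 this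
    have b1 := hbelow (p u.1)
    have b2 := hbelow (q u.1 - 2)
    have a1 := habove (p (u.1 + 1))
    have a2 := habove (q (u.1 + 1) - 2)
    refine ⟨by omega, by omega, by omega, by omega⟩
  have htw := topRow_le hw
  have hw' := hlt w hw
  refine ⟨w.1, p, q, ⟨fun k j => ⟨fun h => ⟨⟨topRow_le h, hmax _ h⟩, (hpq k j).1 h⟩,
    fun h => (hpq k j).2 h.2⟩, htw, fun k hk hkw => ?_, fun k hk hkw => (hstep k hk hkw).2.2.1,
    fun k hk hkw => (hstep k hk hkw).2.2.2, ?_⟩⟩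
  · by_cases h : k < w.1
    · exact (hstep k hk h).1
    · have : k = w.1 := by omega
      rw [this]; omega
  -- Two vertices in the last row would have a common lower neighbour by condition (2).
  · by_contra hcon
    have := hmax _ (hΓ.below w.1 (p w.1) ((hpq _ _).2 (by omega)) ((hpq _ _).2 (by omega)))
    simp only at this
    omega

variable {e : ℤ} {p q : ℤ → ℤ}

theorem IsRowChain.rowOf_eq (h : IsRowChain Γ e p q) {k : ℤ} (hk : topRow Γ ≤ k) (hke : k ≤ e) :
    rowOf Γ k = Finset.Ico (p k) (q k) := by
  ext j
  simp only [rowOf, Finset.mem_image, Finset.mem_filter, Finset.mem_Ico]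
  constructor
  · rintro ⟨⟨i, j'⟩, ⟨h1, rfl⟩, rfl⟩
    exact ((h.mem_iff _ _).1 h1).2
  · intro hj
    exact ⟨(k, j), ⟨(h.mem_iff _ _).2 ⟨⟨hk, hke⟩, hj⟩, rfl⟩, rfl⟩

theorem IsRowChain.rowOf_eq_empty (h : IsRowChain Γ e p q) {k : ℤ} (hke : e < k) :
    rowOf Γ k = ∅ := by
  rw [rowOf, Finset.image_eq_empty, Finset.filter_eq_empty_iff]
  rintro ⟨i, j⟩ hv rfl
  have := ((h.mem_iff _ _).1 hv).1
  simp only at hke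
  omega

theorem IsRowChain.exists_growth (h : IsRowChain Γ e p q) {i : ℤ} (hi : topRow Γ ≤ i)
    (hrow : (rowOf Γ i).card < (rowOf Γ (i + 1)).card) :
    i + 1 ≤ e ∧ p (i + 1) = p i - 1 ∧ q (i + 1) = q i := by
  have he : i + 1 ≤ e := by
    by_contra! hcon
    rw [h.rowOf_eq_empty hcon] at hrow
    simp at hrow
  rw [h.rowOf_eq hi (by omega), h.rowOf_eq (by omega) he, Int.card_Ico, Int.card_Ico] at hrow
  have h1 := h.lt i hi (by omega)
  have h2 := h.lt (i + 1) (by omega) he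
  have h3 := h.left i hi (by omega)
  have h4 := h.right i hi (by omega)
  omega

theorem IsRowChain.chainVertices_eq (h : IsRowChain Γ e p q) :
    chainVertices (topRow Γ) e (fun k => Finset.Ico (p k) (q k)) = Γ := by
  ext ⟨k, j⟩
  rw [mem_chainVertices, h.mem_iff, Finset.mem_Ico]

end OrdinaryRows

/-! ### Faces of Gelfand-Tsetlin polyhedra and their weights -/

section Faces

variable {Γ : Finset (ℤ × ℤ)} {b : Fin (rowOf Γ (topRow Γ)).card → ℤ}

theorem gtPolyhedron_le_of_up {s : ℤ × ℤ → ℝ} (hs : s ∈ gtPolyhedron Γ b) {i j : ℤ}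
    (h : (i, j) ∈ Γ) (h' : (i - 1, j) ∈ Γ) : s (i, j) ≤ s (i - 1, j) :=
  (hs.2.2 i j h).1 h'

theorem gtPolyhedron_le_of_up_right {s : ℤ × ℤ → ℝ} (hs : s ∈ gtPolyhedron Γ b) {i j : ℤ}
    (h : (i, j) ∈ Γ) (h' : (i - 1, j + 1) ∈ Γ) : s (i - 1, j + 1) ≤ s (i, j) :=
  (hs.2.2 i j h).2 h'

theorem mem_minFace_self {ι : Type*} {P : Set (ι → ℝ)} {x : ι → ℝ} : x ∈ minFace P x :=
  fun _ hf => hf.2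

/-- The functional `s u - s v` is at most 0 on `P` and vanishes at `x`, so it exposes a face
containing `x`, hence containing the minimal face. -/
theorem minFace_eq_of_le {ι : Type*} {P : Set (ι → ℝ)} {x : ι → ℝ} (hx : x ∈ P) {u v : ι}
    (hle : ∀ s ∈ P, s u ≤ s v) (h : x u = x v) {s : ι → ℝ} (hs : s ∈ minFace P x) :
    s u = s v := by
  have hface : {s ∈ P | s u = s v} ∈ polyFaces P := by
    refine ⟨⟨x, hx, h⟩, fun _ => ⟨ContinuousLinearMap.proj (R := ℝ)
      (φ := fun _ : ι => ℝ) u - ContinuousLinearMap.proj (R := ℝ) (φ := fun _ : ι => ℝ) v, ?_⟩⟩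
    ext s
    simp only [Set.mem_ofPred_eq, sub_apply, ContinuousLinearMap.proj_apply]
    refine and_congr_right fun hs => ⟨fun hsuv y hy => ?_, fun hmax => ?_⟩
    · have := hle y hy
      linarith
    · have h1 := hmax x hx
      have h2 := hle s hs
      linarith
  exact (hs _ ⟨hface, hx, h⟩).2

theorem faceGraph_minFace_adj {x : ℤ × ℤ → ℝ} (hx : x ∈ gtPolyhedron Γ b) {u v : Γ} :
    (faceGraph Γ (minFace (gtPolyhedron Γ b) x)).Adj u v ↔
      rotatedLattice.Adj (u : ℤ × ℤ) v ∧ x u = x v := by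
  change rotatedLattice.Adj (u : ℤ × ℤ) v ∧
    (∀ s ∈ minFace (gtPolyhedron Γ b) x, s u = s v) ↔ _
  refine and_congr_right fun hadj => ⟨fun h => h x mem_minFace_self, fun h s hs => ?_⟩
  obtain ⟨⟨i, j⟩, hu⟩ := u
  obtain ⟨⟨k, l⟩, hv⟩ := v
  rw [rotatedLattice_adj] at hadj
  simp only [Prod.mk.injEq] at hadj
  simp only at h ⊢
  rcases hadj with (⟨rfl, rfl⟩ | ⟨rfl, rfl⟩) | (⟨rfl, rfl⟩ | ⟨rfl, rfl⟩)
  · exact minFace_eq_of_le hx (fun s hs => gtPolyhedron_le_of_up hs hu hv) h hs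
  · exact (minFace_eq_of_le hx (fun s hs => gtPolyhedron_le_of_up_right hs hu hv) h.symm hs).symm
  · exact (minFace_eq_of_le hx (fun s hs => gtPolyhedron_le_of_up hs hv hu) h.symm hs).symm
  · exact minFace_eq_of_le hx (fun s hs => gtPolyhedron_le_of_up_right hs hv hu) h hs

variable {e : ℤ} {p q : ℤ → ℤ}

theorem IsRowChain.below_mem (h : IsRowChain Γ e p q) {k j : ℤ} (h1 : (k, j) ∈ Γ)
    (h2 : (k, j + 1) ∈ Γ) : (k + 1, j) ∈ Γ := by
  rw [h.mem_iff] at h1 h2 ⊢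
  have hke : k < e := by
    by_contra hcon
    have : k = e := by omega
    subst this
    have := h.last
    omega
  have := h.left k h1.1.1 hke
  have := h.right k h1.1.1 hke
  omega

/-- The common lower neighbour of two adjacent vertices of a row belongs to `Γ` and its coordinate
lies between theirs. -/
theorem IsRowChain.antitone_row (h : IsRowChain Γ e p q) {x : ℤ × ℤ → ℝ}
    (hx : x ∈ gtPolyhedron Γ b) {k j j' : ℤ} (hjj' : j ≤ j') (h1 : (k, j) ∈ Γ)
    (h2 : (k, j') ∈ Γ) : x (k, j') ≤ x (k, j) := by
  induction j', hjj' using Int.leInduction with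
  | base => exact le_rfl
  | succ m hm ih =>
    have hmem : (k, m) ∈ Γ := by
      rw [h.mem_iff] at h1 h2 ⊢
      omega
    have hb := h.below_mem hmem h2
    have e1 : k + 1 - 1 = k := by ring
    have l1 := gtPolyhedron_le_of_up hx hb (by rwa [e1])
    have l2 := gtPolyhedron_le_of_up_right hx hb (by rwa [e1])
    rw [e1] at l1 l2
    exact (l2.trans l1).trans (ih hmem)

theorem eq_of_reachable {x : ℤ × ℤ → ℝ} (hx : x ∈ gtPolyhedron Γ b) {u v : Γ}
    (h : (faceGraph Γ (minFace (gtPolyhedron Γ b) x)).Reachable u v) : x u = x v := by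
  obtain ⟨W⟩ := h
  induction W with
  | nil => rfl
  | cons hadj _ ih => exact ((faceGraph_minFace_adj hx).1 hadj).2.trans ih

theorem reachable_up {x : ℤ × ℤ → ℝ} (hx : x ∈ gtPolyhedron Γ b) {i j : ℤ} (h : (i, j) ∈ Γ)
    (h' : (i - 1, j) ∈ Γ) (heq : x (i, j) = x (i - 1, j)) :
    (faceGraph Γ (minFace (gtPolyhedron Γ b) x)).Reachable ⟨(i, j), h⟩ ⟨(i - 1, j), h'⟩ :=
  SimpleGraph.Adj.reachable ((faceGraph_minFace_adj hx).2
    ⟨rotatedLattice_adj.2 (Or.inl (Or.inl rfl)), heq⟩)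

theorem reachable_up_right {x : ℤ × ℤ → ℝ} (hx : x ∈ gtPolyhedron Γ b) {i j : ℤ}
    (h : (i, j) ∈ Γ) (h' : (i - 1, j + 1) ∈ Γ) (heq : x (i, j) = x (i - 1, j + 1)) :
    (faceGraph Γ (minFace (gtPolyhedron Γ b) x)).Reachable ⟨(i, j), h⟩ ⟨(i - 1, j + 1), h'⟩ :=
  SimpleGraph.Adj.reachable ((faceGraph_minFace_adj hx).2
    ⟨rotatedLattice_adj.2 (Or.inl (Or.inr rfl)), heq⟩)

/-- Equal ends squeeze all entries between them and their common lower neighbours, giving a zigzag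
path of edges in the face graph. -/
theorem IsRowChain.reachable_row_of_le (h : IsRowChain Γ e p q) {x : ℤ × ℤ → ℝ}
    (hx : x ∈ gtPolyhedron Γ b) {k j j' : ℤ} (hjj' : j ≤ j') (h1 : (k, j) ∈ Γ)
    (h2 : (k, j') ∈ Γ) (heq : x (k, j) = x (k, j')) :
    (faceGraph Γ (minFace (gtPolyhedron Γ b) x)).Reachable ⟨(k, j), h1⟩ ⟨(k, j'), h2⟩ := by
  induction j', hjj' using Int.leInduction with
  | base => exact SimpleGraph.Reachable.refl _
  | succ m hm ih =>
    have hmem : (k, m) ∈ Γ := by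
      rw [h.mem_iff] at h1 h2 ⊢
      omega
    have hb := h.below_mem hmem h2
    have hm1 := h.antitone_row hx hm h1 hmem
    have hm2 := h.antitone_row hx (by omega : m ≤ m + 1) hmem h2
    have e1 : k + 1 - 1 = k := by ring
    have hmem' : (k + 1 - 1, m) ∈ Γ := by rwa [e1]
    have h2' : (k + 1 - 1, m + 1) ∈ Γ := by rwa [e1]
    have l1 := gtPolyhedron_le_of_up hx hb hmem'
    have l2 := gtPolyhedron_le_of_up_right hx hb h2'
    have r1 := (reachable_up hx hb hmem' (by rw [e1] at l1 l2 ⊢; linarith)).symm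
    have r2 := reachable_up_right hx hb h2' (by rw [e1] at l1 l2 ⊢; linarith)
    simp only [e1] at r1 r2
    exact ((ih hmem (by linarith)).trans r1).trans r2

theorem IsRowChain.reachable_row (h : IsRowChain Γ e p q) {x : ℤ × ℤ → ℝ}
    (hx : x ∈ gtPolyhedron Γ b) {k j j' : ℤ} (h1 : (k, j) ∈ Γ)
    (h2 : (k, j') ∈ Γ) (heq : x (k, j) = x (k, j')) :
    (faceGraph Γ (minFace (gtPolyhedron Γ b) x)).Reachable ⟨(k, j), h1⟩ ⟨(k, j'), h2⟩ := by
  rcases le_total j j' with hjj' | hjj'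
  · exact h.reachable_row_of_le hx hjj' h1 h2 heq
  · exact (h.reachable_row_of_le hx hjj' h2 h1 heq.symm).symm

/-- One goes to the upper neighbour on the side of the target, whose coordinate is squeezed between
the two equal ones, and then along the row. -/
theorem IsRowChain.reachable_row_above (h : IsRowChain Γ e p q) {x : ℤ × ℤ → ℝ}
    (hx : x ∈ gtPolyhedron Γ b) {k j j' : ℤ} (h1 : (k, j) ∈ Γ)
    (h2 : (k - 1, j') ∈ Γ) (heq : x (k, j) = x (k - 1, j')) :
    (faceGraph Γ (minFace (gtPolyhedron Γ b) x)).Reachable ⟨(k, j), h1⟩ ⟨(k - 1, j'), h2⟩ := by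
  have m1 := (h.mem_iff _ _).1 h1
  have m2 := (h.mem_iff _ _).1 h2
  have st1 := h.left (k - 1) m2.1.1 (by omega)
  have st2 := h.right (k - 1) m2.1.1 (by omega)
  rw [sub_add_cancel] at st1 st2
  rcases le_or_gt j' j with hj | hj
  · have hu : (k - 1, j) ∈ Γ := (h.mem_iff _ _).2 (by omega)
    have l1 := gtPolyhedron_le_of_up hx h1 hu
    have l2 := h.antitone_row hx hj h2 hu
    exact (reachable_up hx h1 hu (by linarith)).trans (h.reachable_row hx hu h2 (by linarith))
  · have hu : (k - 1, j + 1) ∈ Γ := (h.mem_iff _ _).2 (by omega)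
    have l1 := gtPolyhedron_le_of_up_right hx h1 hu
    have l2 := h.antitone_row hx (by omega : j + 1 ≤ j') hu h2
    exact (reachable_up_right hx h1 hu (by linarith)).trans
      (h.reachable_row hx hu h2 (by linarith))

theorem rowCount_eq_mult {G : SimpleGraph Γ} (E : G.ConnectedComponent) (k : ℤ) (J : Finset ℤ)
    (μ : ℤ → ℤ) (c : ℤ) (hJ : ∀ j, j ∈ J ↔ (k, j) ∈ Γ)
    (hE : ∀ j (h : (k, j) ∈ Γ), G.connectedComponentMk ⟨(k, j), h⟩ = E ↔ μ j = c) :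
    rowCount E k = mult J μ c := by
  classical
  rw [rowCount, mult, ← Set.ncard_coe_finset]
  refine Set.ncard_congr (fun v _ => v.1.2) ?_ ?_ ?_
  · rintro ⟨⟨i, j⟩, hv⟩ ⟨h1, rfl⟩
    rw [SimpleGraph.ConnectedComponent.mem_supp_iff] at h1
    exact Finset.mem_coe.2 (Finset.mem_filter.2 ⟨(hJ j).2 hv, (hE j hv).1 h1⟩)
  · rintro ⟨⟨i, j⟩, hv⟩ ⟨⟨i', j'⟩, hv'⟩ ⟨_, h1⟩ ⟨_, h2⟩ h3
    simp only at h1 h2 h3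
    subst h1 h2 h3
    rfl
  · intro j hj
    obtain ⟨h1, h2⟩ := Finset.mem_filter.1 (Finset.mem_coe.1 hj)
    have hv := (hJ j).1 h1
    exact ⟨⟨(k, j), hv⟩, ⟨(SimpleGraph.ConnectedComponent.mem_supp_iff _ _).2 ((hE j hv).2 h2),
      rfl⟩, rfl⟩

/-- The weight of the minimal face of an integer point is the product of the weights of the
pairs of consecutive rows. -/
theorem IsRowChain.faceWeight_minFace (h : IsRowChain Γ e p q) {s : ℤ × ℤ → ℤ}
    (hs : (fun v => (s v : ℝ)) ∈ gtPolyhedron Γ b) :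
    faceWeight Γ (minFace (gtPolyhedron Γ b) fun v => (s v : ℝ)) =
      ∏ k ∈ Finset.Ioc (topRow Γ) e, stepWeight (Polynomial.X : Polynomial ℤ)
        (Finset.Ico (p (k - 1)) (q (k - 1))) (Finset.Ico (p k) (q k))
        (fun j => s (k - 1, j)) fun j => s (k, j) := by
  classical
  set G := faceGraph Γ (minFace (gtPolyhedron Γ b) fun v => (s v : ℝ)) with hG
  have : Fintype G.ConnectedComponent := Fintype.ofFinite _
  have hval : ∀ u v : Γ, G.connectedComponentMk u = G.connectedComponentMk v →
      s u = s v := fun u v huv => by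
    have := eq_of_reachable hs (SimpleGraph.ConnectedComponent.exact huv)
    exact_mod_cast this
  have hrows : (Γ.image Prod.fst).filter (fun i => topRow Γ < i) = Finset.Ioc (topRow Γ) e := by
    ext k
    simp only [Finset.mem_filter, Finset.mem_image, Finset.mem_Ioc]
    constructor
    · rintro ⟨⟨⟨i, j⟩, hv, rfl⟩, hk⟩
      exact ⟨hk, ((h.mem_iff _ _).1 hv).1.2⟩
    · rintro ⟨hk, hke⟩
      have := h.lt k hk.le hke
      exact ⟨⟨(k, p k), (h.mem_iff _ _).2 ⟨⟨hk.le, hke⟩, le_rfl, this⟩, rfl⟩, hk⟩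
  rw [faceWeight, finprod_eq_prod_of_fintype, hrows, Finset.prod_comm]
  refine Finset.prod_congr rfl fun k hk => ?_
  rw [Finset.mem_Ioc] at hk
  have hJ : ∀ j, j ∈ Finset.Ico (p k) (q k) ↔ (k, j) ∈ Γ := fun j => by
    rw [Finset.mem_Ico, h.mem_iff]
    exact ⟨fun h => ⟨⟨hk.1.le, hk.2⟩, h⟩, fun h => h.2⟩
  have hI : ∀ j, j ∈ Finset.Ico (p (k - 1)) (q (k - 1)) ↔ (k - 1, j) ∈ Γ := fun j => by
    rw [Finset.mem_Ico, h.mem_iff]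
    exact ⟨fun h => ⟨⟨by omega, by omega⟩, h⟩, fun h => h.2⟩
  have hcount : ∀ j (hj : (k, j) ∈ Γ),
      rowCount (G.connectedComponentMk ⟨(k, j), hj⟩) k =
        mult (Finset.Ico (p k) (q k)) (fun j => s (k, j)) (s (k, j)) ∧
      rowCount (G.connectedComponentMk ⟨(k, j), hj⟩) (k - 1) =
        mult (Finset.Ico (p (k - 1)) (q (k - 1))) (fun j => s (k - 1, j)) (s (k, j)) := by
    intro j hj
    constructor
    · refine rowCount_eq_mult _ k _ _ _ hJ fun j' hj' => ⟨fun heq => hval _ _ heq, fun heq => ?_⟩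
      exact SimpleGraph.ConnectedComponent.sound
        (h.reachable_row hs hj' hj (by exact_mod_cast heq))
    · refine rowCount_eq_mult _ (k - 1) _ _ _ hI fun j' hj' =>
        ⟨fun heq => hval _ _ heq, fun heq => ?_⟩
      exact SimpleGraph.ConnectedComponent.sound
        (h.reachable_row_above hs hj hj' (by exact_mod_cast heq.symm)).symm
  have hex : ∀ c ∈ (Finset.Ico (p k) (q k)).image (fun j => s (k, j)),
      ∃ j, ∃ _ : (k, j) ∈ Γ, s (k, j) = c := by
    intro c hc
    obtain ⟨j, hj, rfl⟩ := Finset.mem_image.1 hc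
    exact ⟨j, (hJ j).1 hj, rfl⟩
  choose! f hfΓ hf using hex
  symm
  -- Distinct components may share a value, but not if both meet row `k`. So the components meeting
  -- row `k` correspond to the values in that row, and the others contribute 1.
  rw [stepWeight, ← Finset.prod_subset (Finset.subset_univ
    (Finset.univ.filter fun E : G.ConnectedComponent => rowCount E k ≠ 0))]
  · refine Finset.prod_bij (fun c hc => G.connectedComponentMk ⟨(k, f c), hfΓ c hc⟩) ?_ ?_ ?_ ?_
    · intro c hc
      rw [Finset.mem_filter, (hcount _ (hfΓ c hc)).1, mult, Finset.card_ne_zero]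
      exact ⟨Finset.mem_univ _, f c, Finset.mem_filter.2 ⟨(hJ _).2 (hfΓ c hc), rfl⟩⟩
    · intro c hc c' hc' heq
      have := hval _ _ heq
      rw [← hf c hc, ← hf c' hc']
      exact this
    · intro E hE
      obtain ⟨⟨⟨i, j⟩, hv⟩, h1, h2⟩ := Set.nonempty_of_ncard_ne_zero (Finset.mem_filter.1 hE).2
      simp only at h2
      subst h2
      rw [SimpleGraph.ConnectedComponent.mem_supp_iff] at h1
      have hc : s (i, j) ∈ (Finset.Ico (p i) (q i)).image (fun j => s (i, j)) :=
        Finset.mem_image_of_mem (fun j => s (i, j)) ((hJ j).2 hv)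
      refine ⟨s (i, j), hc, ?_⟩
      rw [← h1]
      exact SimpleGraph.ConnectedComponent.sound
        (h.reachable_row hs (hfΓ _ hc) hv (by exact_mod_cast hf _ hc))
    · intro c hc
      have hcnt := hcount _ (hfΓ c hc)
      rw [hf c hc] at hcnt
      rw [hcnt.1, hcnt.2]
  · intro E _ hE
    rw [Finset.mem_filter, not_and, not_not] at hE
    rw [if_neg]
    rw [hE (Finset.mem_univ _)]
    omega

/-- The weighted generating function of a Gelfand-Tsetlin polyhedron is the series of a chain of
rows. -/
theorem IsRowChain.weightedSeries_eq (h : IsRowChain Γ e p q)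
    (b : Fin (rowOf Γ (topRow Γ)).card → ℤ) :
    ∃ b' : ℤ → ℤ, weightedSeries (gtPolyhedron Γ b) (faceWeight Γ) =
      chainSeries (Polynomial.X : Polynomial ℤ) 1 (topRow Γ) e
        (fun k => Finset.Ico (p k) (q k)) b' := by
  classical
  set emb := (rowOf Γ (topRow Γ)).orderEmbOfFin rfl with hemb
  refine ⟨Function.extend emb b 0, funext fun s => ?_⟩
  have htop : (∀ j ∈ Finset.Ico (p (topRow Γ)) (q (topRow Γ)),
      s (topRow Γ, j) = Function.extend emb b 0 j) ↔ ∀ k, s (topRow Γ, emb k) = b k := by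
    rw [← h.rowOf_eq le_rfl h.top_le]
    constructor
    · intro hj k
      rw [hj _ (Finset.orderEmbOfFin_mem _ _ k), emb.injective.extend_apply]
    · intro hk j hj
      rw [← Finset.mem_coe, ← Finset.range_orderEmbOfFin (rowOf Γ (topRow Γ)) rfl] at hj
      obtain ⟨k, rfl⟩ := hj
      rw [hk k, emb.injective.extend_apply]
  have hmem : (fun v => (s v : ℝ)) ∈ gtPolyhedron Γ b ↔
      ((∀ v, v ∉ Γ → s v = 0) ∧ ∀ j ∈ Finset.Ico (p (topRow Γ)) (q (topRow Γ)),
        s (topRow Γ, j) = Function.extend emb b 0 j) ∧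
      ∀ k ∈ Finset.Ioc (topRow Γ) e, Interlace (Finset.Ico (p (k - 1)) (q (k - 1)))
        (Finset.Ico (p k) (q k)) (fun j => s (k - 1, j)) fun j => s (k, j) := by
    rw [htop, and_assoc]
    refine and_congr ?_ (and_congr ?_ ?_)
    · exact forall₂_congr fun v _ => Int.cast_eq_zero
    · exact forall_congr' fun k => Int.cast_inj
    · constructor
      · intro hle k hk j hj
        rw [Finset.mem_Ioc] at hk
        rw [Finset.mem_Ico] at hj
        have := hle k j ((h.mem_iff _ _).2 ⟨⟨hk.1.le, hk.2⟩, hj⟩)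
        constructor
        · intro hj'
          rw [Finset.mem_Ico] at hj'
          exact Int.cast_le.1 (this.1 ((h.mem_iff _ _).2 ⟨by omega, hj'⟩))
        · intro hj'
          rw [Finset.mem_Ico] at hj'
          exact Int.cast_le.1 (this.2 ((h.mem_iff _ _).2 ⟨by omega, hj'⟩))
      · intro hint k j hv
        have hv' := (h.mem_iff _ _).1 hv
        constructor
        · intro hu
          have hu' := (h.mem_iff _ _).1 hu
          have := (hint k (Finset.mem_Ioc.2 (by omega)) j (Finset.mem_Ico.2 hv'.2)).1
            (Finset.mem_Ico.2 hu'.2)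
          exact Int.cast_le.2 this
        · intro hu
          have hu' := (h.mem_iff _ _).1 hu
          have := (hint k (Finset.mem_Ioc.2 (by omega)) j (Finset.mem_Ico.2 hv'.2)).2
            (Finset.mem_Ico.2 hu'.2)
          exact Int.cast_le.2 this
  rw [weightedSeries, chainSeries, h.chainVertices_eq]
  simp only [Pi.one_apply, one_zpow, Units.val_one, Finset.prod_const_one, mul_one]
  by_cases hs : (fun v => (s v : ℝ)) ∈ gtPolyhedron Γ b
  · rw [if_pos hs, h.faceWeight_minFace hs, if_pos (hmem.1 hs).1, one_mul]
    refine Finset.prod_congr rfl fun k hk => ?_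
    rw [stepTerm, if_pos ((hmem.1 hs).2 k hk)]
  · rw [if_neg hs]
    by_cases hc : (∀ v, v ∉ Γ → s v = 0) ∧ ∀ j ∈ Finset.Ico (p (topRow Γ)) (q (topRow Γ)),
        s (topRow Γ, j) = Function.extend emb b 0 j
    · have : ¬ ∀ k ∈ Finset.Ioc (topRow Γ) e, Interlace (Finset.Ico (p (k - 1)) (q (k - 1)))
        (Finset.Ico (p k) (q k)) (fun j => s (k - 1, j)) fun j => s (k, j) :=
        fun hi => hs (hmem.2 ⟨hc, hi⟩)
      push Not at this
      obtain ⟨k, hk, hk'⟩ := this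
      rw [Finset.prod_eq_zero hk (by rw [stepTerm, if_neg hk']), mul_zero]
    · rw [if_neg hc, zero_mul]

end Faces

/-! ### Specialization of weighted integer point transforms -/

section Specialization

variable {R ι κ : Type*} [CommRing R]

/-- The exponent vector of a monomial after a monomial substitution. -/
noncomputable def substExp (m : ι → (κ →₀ ℤ)) : (ι →₀ ℤ) →+ (κ →₀ ℤ) :=
  Finsupp.liftAddHom fun k => (zmultiplesHom (κ →₀ ℤ)) (m k)

theorem substExp_single (m : ι → (κ →₀ ℤ)) (k : ι) (n : ℤ) :
    substExp m (Finsupp.single k n) = n • m k := by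
  simp [substExp]

theorem monomialSubst_single (m : ι → (κ →₀ ℤ)) (a : ι →₀ ℤ) (c : R) :
    monomialSubst R m (AddMonoidAlgebra.single a c) =
      AddMonoidAlgebra.single (substExp m a) c := by
  simp [monomialSubst, substExp]

theorem laurentMul_eq_act (Q : LaurentPoly R ι) (S : (ι →₀ ℤ) → R) : laurentMul Q S = act Q S := by
  induction Q using AddMonoidAlgebra.induction_linear with
  | zero => funext a; simp [laurentMul]
  | add P Q hP hQ =>
    rw [act_add, ← hP, ← hQ]
    funext a
    simp only [laurentMul, AddMonoidAlgebra.coeff_add, Pi.add_apply]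
    exact Finsupp.sum_add_index' (by simp) (by intros; ring)
  | single m r => funext a; rw [act_single]; simp [laurentMul]

variable {K : Type*} [Field K]

/-- The image of a Laurent polynomial in the group algebra over a field that contains the values of
the substituted monomials. -/
noncomputable def twistPoly (m : ι → (κ →₀ ℤ)) (φ : LaurentPoly R κ →+* K) :
    LaurentPoly R ι →+ AddMonoidAlgebra K (ι →₀ ℤ) :=
  (Finsupp.liftAddHom fun a => (AddMonoidAlgebra.singleAddHom a).comp
    (φ.toAddMonoidHom.comp (AddMonoidAlgebra.singleAddHom (substExp m a)))).comp
      AddMonoidAlgebra.coeffAddEquiv.toAddMonoidHom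

/-- The series obtained by the substitution of monomials in every term. -/
noncomputable def twistSeries (m : ι → (κ →₀ ℤ)) (φ : LaurentPoly R κ →+* K)
    (S : (ι →₀ ℤ) → R) : (ι →₀ ℤ) → K :=
  fun a => φ (AddMonoidAlgebra.single (substExp m a) (S a))

theorem twistPoly_single (m : ι → (κ →₀ ℤ)) (φ : LaurentPoly R κ →+* K) (a : ι →₀ ℤ) (c : R) :
    twistPoly m φ (AddMonoidAlgebra.single a c) =
      AddMonoidAlgebra.single a (φ (AddMonoidAlgebra.single (substExp m a) c)) := by
  simp [twistPoly]

theorem aug_twistPoly (m : ι → (κ →₀ ℤ)) (φ : LaurentPoly R κ →+* K) (Q : LaurentPoly R ι) :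
    aug (twistPoly m φ Q) = φ (monomialSubst R m Q) := by
  induction Q using AddMonoidAlgebra.induction_linear with
  | zero => simp
  | add P Q hP hQ => simp only [map_add, hP, hQ]
  | single a c => rw [twistPoly_single, aug_single, monomialSubst_single]

theorem twistSeries_add (m : ι → (κ →₀ ℤ)) (φ : LaurentPoly R κ →+* K) (S T : (ι →₀ ℤ) → R) :
    twistSeries m φ (S + T) = twistSeries m φ S + twistSeries m φ T := by
  funext a
  simp [twistSeries, AddMonoidAlgebra.single_add]

/-- Each monomial keeps its exponent and receives its specialized value as an additional
coefficient. Multiplicativity of these values makes the twist compatible with products, while the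
augmentation of a twisted polynomial is its specialization. -/
theorem act_twistPoly (m : ι → (κ →₀ ℤ)) (φ : LaurentPoly R κ →+* K) (Q : LaurentPoly R ι)
    (S : (ι →₀ ℤ) → R) :
    act (twistPoly m φ Q) (twistSeries m φ S) = twistSeries m φ (act Q S) := by
  induction Q using AddMonoidAlgebra.induction_linear with
  | zero => funext a; simp [twistSeries]
  | add P Q hP hQ => rw [map_add, act_add, act_add, twistSeries_add, hP, hQ]
  | single a c =>
    funext s
    rw [twistPoly_single, act_single]
    simp only [twistSeries, act_single]
    rw [← map_mul, AddMonoidAlgebra.single_mul_single, ← map_add, add_sub_cancel]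

theorem twistSeries_coeff (m : ι → (κ →₀ ℤ)) (φ : LaurentPoly R κ →+* K) (N : LaurentPoly R ι) :
    twistSeries m φ ⇑N.coeff = ⇑(twistPoly m φ N).coeff := by
  induction N using AddMonoidAlgebra.induction_linear with
  | zero => funext a; simp [twistSeries]
  | add P Q hP hQ =>
    rw [map_add, AddMonoidAlgebra.coeff_add, AddMonoidAlgebra.coeff_add, Finsupp.coe_add,
      Finsupp.coe_add, twistSeries_add, hP, hQ]
  | single a c =>
    classical
    funext s
    rw [twistPoly_single]
    simp only [twistSeries, AddMonoidAlgebra.coeff_single, Finsupp.single_apply]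
    split_ifs with h
    · rw [h]
    · simp

theorem finsum_coeff (N : AddMonoidAlgebra K (ι →₀ ℤ)) : ∑ᶠ a, N.coeff a = aug N := by
  classical
  have h := finsum_act N (F := fun a : ι →₀ ℤ => if a = 0 then (1 : K) else 0)
    ((Set.finite_singleton 0).subset fun a ha => by
      by_contra hcon
      exact ha (if_neg hcon))
  rw [finsum_eq_single _ 0 fun a ha => if_neg ha, if_pos rfl, mul_one] at h
  rw [← h]
  refine finsum_congr fun a => ?_
  rw [← laurentMul_eq_act, laurentMul, Finsupp.sum]
  simp only [sub_eq_zero, mul_ite, mul_one, mul_zero, Finset.sum_ite_eq]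
  split_ifs with h0
  · rfl
  · exact Finsupp.notMem_support_iff.1 h0

/-- If the substituted series has regularized sum zero, so has the value of the numerator of its
rational function. -/
theorem monomialSubst_eq_zero_of_hasRegSum (m : ι → (κ →₀ ℤ)) (φ : LaurentPoly R κ →+* K)
    (hφ : Function.Injective φ) {S : (ι →₀ ℤ) → R} {Q N : LaurentPoly R ι}
    (hQ : monomialSubst R m Q ≠ 0) (hN : laurentMul Q S = ⇑N.coeff)
    (h : HasRegSum (twistSeries m φ S) 0) : monomialSubst R m N = 0 := by
  have h1 : act (twistPoly m φ Q) (twistSeries m φ S) = ⇑(twistPoly m φ N).coeff := by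
    rw [act_twistPoly, ← laurentMul_eq_act, hN, twistSeries_coeff]
  have hQ' : aug (twistPoly m φ Q) ≠ 0 := by
    rw [aug_twistPoly]
    exact (map_ne_zero_iff φ hφ).2 hQ
  -- The quotient of the specialized numerator and denominator is itself a regularized sum of the
  -- twisted series, so uniqueness applies.
  have h2 : HasRegSum (twistSeries m φ S)
      ((aug (twistPoly m φ Q))⁻¹ * aug (twistPoly m φ N)) := by
    refine ⟨_, hQ', ?_, ?_⟩
    · rw [h1]; exact Finsupp.hasFiniteSupport _
    · rw [h1, finsum_coeff, mul_inv_cancel_left₀ hQ']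
  have h3 := h2.unique h
  rw [mul_eq_zero, inv_eq_zero, aug_twistPoly m φ N, map_eq_zero_iff φ hφ] at h3
  exact h3.resolve_left hQ'

end Specialization

/-! ### The characters of the rows given by the specialization -/

section GelfandTsetlinCharacter

/-- The exponent vectors of the products of powers of the monomials `x_k⁻¹ x_{k+1}`. -/
noncomputable def rowExp : (ℤ →₀ ℤ) →+ (ℤ →₀ ℤ) :=
  substExp fun k => Finsupp.single (k + 1) 1 - Finsupp.single k 1

theorem rowExp_apply (n : ℤ →₀ ℤ) (k : ℤ) : rowExp n k = n (k - 1) - n k := by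
  induction n using Finsupp.induction_linear with
  | zero => simp
  | add f g hf hg =>
    rw [map_add, Finsupp.add_apply, hf, hg, Finsupp.add_apply, Finsupp.add_apply]
    ring
  | single i c =>
    rw [rowExp, substExp_single]
    simp only [Finsupp.smul_apply, Finsupp.sub_apply, Finsupp.single_apply, smul_eq_mul]
    split_ifs <;> omega

/-- An element of the kernel is constant along `ℤ` and finitely supported. -/
theorem rowExp_injective : Function.Injective rowExp := by
  rw [injective_iff_map_eq_zero]
  intro n hn
  have h1 : ∀ k, n (k - 1) = n k := fun k => by
    have := rowExp_apply n k
    rw [hn, Finsupp.zero_apply] at this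
    omega
  have h2 : ∀ k, n k = n 0 := by
    intro k
    induction k using Int.induction_on with
    | zero => rfl
    | succ i ih => rw [← ih, ← h1 (i + 1), add_sub_cancel_right]
    | pred i ih => rw [h1, ih]
  obtain ⟨k, hk⟩ := Infinite.exists_notMem_finset n.support
  rw [Finsupp.notMem_support_iff] at hk
  ext j
  rw [h2 j, ← h2 k, hk, Finsupp.zero_apply]

variable {R K : Type*} [CommRing R] [Field K]

/-- The monomials as units. -/
noncomputable def monomialUnit (φ : LaurentPoly R ℤ →+* K) : (ℤ →₀ ℤ) →+ Additive Kˣ :=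
  AddMonoidHom.mk' (fun n => Additive.ofMul (((φ : LaurentPoly R ℤ →* K).comp
    (AddMonoidAlgebra.of R (ℤ →₀ ℤ))).toHomUnits (Multiplicative.ofAdd n))) fun a b => by
      rw [ofAdd_add, map_mul, ofMul_mul]

theorem monomialUnit_coe (φ : LaurentPoly R ℤ →+* K) (n : ℤ →₀ ℤ) :
    ((monomialUnit φ n).toMul : K) = φ (AddMonoidAlgebra.single n 1) := rfl

/-- The values of the variables of row `k` under the specialization. -/
noncomputable def rowChar (φ : LaurentPoly R ℤ →+* K) (k : ℤ) : Kˣ :=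
  (monomialUnit φ (rowExp (Finsupp.single k 1))).toMul

theorem gtSpec_eq (v : ℤ × ℤ) : gtSpec v = rowExp (Finsupp.single v.1 1) := by
  rw [rowExp, substExp_single, one_smul, gtSpec]

theorem isGenericChar_rowChar [IsDomain R] (φ : LaurentPoly R ℤ →+* K) (hφ : Function.Injective φ)
    {t : R} (ht : t ≠ 0) (ht1 : t ≠ 1) :
    IsGenericChar (φ (AddMonoidAlgebra.single 0 t)) (rowChar φ) := by
  classical
  refine ⟨(monomialUnit φ).comp rowExp, ?_, fun n hn => ?_, fun k => rfl⟩
  · rw [injective_iff_map_eq_zero]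
    intro n hn
    have h1 := monomialUnit_coe φ (rowExp n)
    rw [AddMonoidHom.comp_apply] at hn
    rw [hn, toMul_zero, Units.val_one, ← map_one φ] at h1
    have h2 := hφ h1
    rw [AddMonoidAlgebra.one_def, AddMonoidAlgebra.single_left_inj one_ne_zero] at h2
    exact (injective_iff_map_eq_zero _).1 rowExp_injective n h2.symm
  · rw [AddMonoidHom.comp_apply, monomialUnit_coe, ← map_mul, AddMonoidAlgebra.single_mul_single,
      zero_add, mul_one, ← map_one φ] at hn
    have h2 := congrArg (fun P => P.coeff (rowExp n)) (hφ hn)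
    simp only [AddMonoidAlgebra.one_def, AddMonoidAlgebra.coeff_single,
      Finsupp.single_apply, if_true] at h2
    split_ifs at h2 with h3
    · exact ht1 (by simpa using h2)
    · exact ht (by simpa using h2)

theorem monomial_substExp_gtSpec (φ : LaurentPoly R ℤ →+* K) (s : ℤ × ℤ →₀ ℤ)
    (V : Finset (ℤ × ℤ)) (hs : ∀ v, v ∉ V → s v = 0) :
    φ (AddMonoidAlgebra.single (substExp gtSpec s) 1) =
      ((∏ v ∈ V, rowChar φ v.1 ^ s v : Kˣ) : K) := by
  have h1 : substExp gtSpec s = ∑ v ∈ V, s v • gtSpec v := by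
    rw [substExp, Finsupp.liftAddHom_apply, Finsupp.sum_of_support_subset _ (s := V)]
    · rfl
    · intro v hv
      by_contra hcon
      exact Finsupp.mem_support_iff.1 hv (hs v hcon)
    · simp
  rw [← monomialUnit_coe, h1, map_sum, toMul_sum]
  congr 1
  refine Finset.prod_congr rfl fun v _ => ?_
  rw [map_zsmul, toMul_zsmul, gtSpec_eq, rowChar]

theorem map_stepWeight {S : Type*} [CommRing S] (f : R →+* S) (t : R) (I J : Finset ℤ)
    (l μ : ℤ → ℤ) : f (stepWeight t I J l μ) = stepWeight (f t) I J l μ := by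
  rw [stepWeight, map_prod, stepWeight]
  refine Finset.prod_congr rfl fun c _ => ?_
  split_ifs <;> simp

theorem map_stepTerm {S : Type*} [CommRing S] (f : R →+* S) (t : R) (I J : Finset ℤ)
    (l μ : ℤ → ℤ) : f (stepTerm t I J l μ) = stepTerm (f t) I J l μ := by
  unfold stepTerm
  split_ifs
  · exact map_stepWeight f t I J l μ
  · exact map_zero f

/-- The specialized variables depend only on the row, so the monomial of an array is a product of
powers indexed by the row sums. -/
theorem twistSeries_chainSeries (φ : LaurentPoly R ℤ →+* K) (t : R) (a e : ℤ)
    (row : ℤ → Finset ℤ) (b : ℤ → ℤ) :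
    twistSeries gtSpec φ (chainSeries t 1 a e row b) =
      chainSeries (φ (AddMonoidAlgebra.single 0 t)) (rowChar φ) a e row b := by
  classical
  funext s
  rw [twistSeries, chainSeries, chainSeries]
  by_cases hs : (∀ v, v ∉ chainVertices a e row → s v = 0) ∧ ∀ j ∈ row a, s (a, j) = b j
  · simp only [Pi.one_apply, one_zpow, Units.val_one, Finset.prod_const_one, mul_one]
    rw [if_pos hs, if_pos hs, one_mul, one_mul, prod_rows_eq,
      ← monomial_substExp_gtSpec φ s _ hs.1]
    have h1 : ∀ c : R, φ (AddMonoidAlgebra.single (substExp gtSpec s) c) =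
        φ.comp (AddMonoidAlgebra.singleZeroRingHom) c *
          φ (AddMonoidAlgebra.single (substExp gtSpec s) 1) := by
      intro c
      rw [RingHom.comp_apply, ← map_mul]
      simp [AddMonoidAlgebra.single_mul_single]
    rw [h1, map_prod]
    congr 1
    exact Finset.prod_congr rfl fun k _ => map_stepTerm _ _ _ _ _ _
  · rw [if_neg hs, if_neg hs]
    simp

/-- By genericity the monomial of a nonempty set `U` does not specialize to 1, so no factor becomes
0. -/
theorem monomialSubst_chainDenominator_ne_zero [IsDomain R] (φ : LaurentPoly R ℤ →+* K) {t : K}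
    (h : IsGenericChar t (rowChar φ)) (V : Finset (ℤ × ℤ)) :
    monomialSubst R gtSpec (chainDenominator 1 V) ≠ 0 := by
  classical
  rw [chainDenominator, map_prod, Finset.prod_ne_zero_iff]
  intro U hU hcon
  rw [Finset.mem_erase, ← Finset.nonempty_iff_ne_empty] at hU
  refine h.prod_ne_one hU.1 (Units.ext ?_)
  simp only [Pi.one_apply, Finset.prod_const_one, Units.val_one] at hcon
  rw [map_sub, map_one, monomialSubst_single, sub_eq_zero] at hcon
  have h1 := monomial_substExp_gtSpec φ (indicatorVec U) U fun v hv => by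
    rw [indicatorVec_apply, if_neg hv]
  rw [← hcon, map_one] at h1
  rw [Units.val_one, h1]
  congr 1
  refine Finset.prod_congr rfl fun v hv => ?_
  rw [indicatorVec_apply, if_pos hv, zpow_one]

end GelfandTsetlinCharacter

/-! ### Vanishing of the specialized transform -/

theorem theorem7 (Γ : Finset (ℤ × ℤ)) (hΓ : IsOrdinary Γ) (i : ℤ) (hi : topRow Γ ≤ i)
    (hrow : (rowOf Γ i).card < (rowOf Γ (i + 1)).card)
    (b : Fin (rowOf Γ (topRow Γ)).card → ℤ) (hb : Antitone b) :
    (∃ σ, SumsTo (weightedSeries (gtPolyhedron Γ b) (faceWeight Γ)) σ) ∧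
      (∃ f, SpecializesTo gtSpec (weightedIPT (gtPolyhedron Γ b) (faceWeight Γ)) f) ∧
      psi Γ b = 0 := by
  obtain ⟨e, p, q, h⟩ := hΓ.exists_isRowChain
  obtain ⟨b', hS⟩ := h.weightedSeries_eq b
  obtain ⟨hie, hp, hq⟩ := h.exists_growth hi hrow
  set S := weightedSeries (gtPolyhedron Γ b) (faceWeight Γ) with hSdef
  set φ := algebraMap (LaurentPoly (Polynomial ℤ) ℤ) (RatFun (Polynomial ℤ) ℤ) with hφdef
  have hφ : Function.Injective φ := IsFractionRing.injective _ _
  have hgen : IsGenericChar (φ (AddMonoidAlgebra.single 0 Polynomial.X)) (rowChar φ) :=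
    isGenericChar_rowChar φ hφ Polynomial.X_ne_zero fun hX => by
      simpa using congrArg (Polynomial.eval 0) hX
  -- The same denominator, with trivial characters, makes the unspecialized series a Laurent
  -- polynomial and survives the specialization.
  set Q : LaurentPoly (Polynomial ℤ) (ℤ × ℤ) := chainDenominator 1 Γ with hQdef
  have hQ : monomialSubst (Polynomial ℤ) gtSpec Q ≠ 0 :=
    monomialSubst_chainDenominator_ne_zero φ hgen Γ
  have hQ0 : Q ≠ 0 := fun h0 => hQ (by rw [h0, map_zero])
  have hfin : (act Q S).support.Finite := by
    have := chainSeries_act_finite (Polynomial.X : Polynomial ℤ) 1 (topRow Γ) e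
      (fun k => Finset.Ico (p k) (q k)) b'
    rwa [h.chainVertices_eq, ← hS] at this
  obtain ⟨N, hN⟩ : ∃ N : LaurentPoly (Polynomial ℤ) (ℤ × ℤ), laurentMul Q S = ⇑N.coeff :=
    ⟨AddMonoidAlgebra.ofCoeff (Finsupp.ofSupportFinite _ hfin), laurentMul_eq_act Q S⟩
  have hreg : HasRegSum (twistSeries gtSpec φ S) 0 := by
    rw [hS, twistSeries_chainSeries]
    refine chainSeries_hasRegSum_zero _ (e - (i + 1)).toNat _ hgen _ e (i + 1) p q b' ?_ ?_ ?_ ?_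
      ?_ ?_ ?_ ?_ h.last
    · rw [Int.toNat_of_nonneg (by omega)]; ring
    · omega
    · rwa [add_sub_cancel_right]
    · rwa [add_sub_cancel_right]
    · rw [add_sub_cancel_right]; exact (h.lt i hi (by omega)).le
    · exact fun k hk hke => h.lt k (by omega) hke
    · exact fun k hk hke => h.left k (by omega) hke
    · exact fun k hk hke => h.right k (by omega) hke
  have hN0 := monomialSubst_eq_zero_of_hasRegSum gtSpec φ hφ hQ hN hreg
  have hsum : ∃ σ, SumsTo S σ := ⟨_, Q, N, hQ0, hN, rfl⟩
  have hipt : weightedIPT (gtPolyhedron Γ b) (faceWeight Γ) =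
      algebraMap _ (RatFun (Polynomial ℤ) (ℤ × ℤ)) N / algebraMap _ _ Q := by
    rw [weightedIPT, dif_pos hsum]
    exact hsum.choose_spec.unique ⟨Q, N, hQ0, hN, rfl⟩
  have hspec : SpecializesTo gtSpec (weightedIPT (gtPolyhedron Γ b) (faceWeight Γ)) 0 :=
    ⟨N, Q, hQ, hipt, by rw [hN0, map_zero, zero_div]⟩
  refine ⟨hsum, ⟨0, hspec⟩, ?_⟩
  have hex : ∃ f, SpecializesTo gtSpec (weightedIPT (gtPolyhedron Γ b) (faceWeight Γ)) f :=
    ⟨0, hspec⟩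
  rw [psi, specialize, dif_pos hex]
  exact hex.choose_spec.unique hspec
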